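/- Let $G=(V,E)$ be a finite simple graph with $n$ vertices and $m$ edges. A set $X\subseteq V$ is a *dominating set* if every vertex is in $X$ or has a neighbour in $X$; let $N$ be the number of dominating sets of $G$. $G$ is *$k$-degenerate* if every nonempty induced subgraph has a vertex of degree at most $k$. Fix a numbering of $V$; comparisons, $\min$, and the notations $A^{<v}$, $A^{v<}$, $A^{v\le}$ (the members of $A\subseteq V$ that are smaller than $v$, larger than $v$, at least $v$) refer to it. It is a *degeneracy ordering* for $k$ if every vertex has at most $k$ larger neighbours. For $X\ne V$ the *parent* of $X$ is $\mathcal P(X)=X\cup\{\min(V\setminus X)\}$. The *candidate set* $C(X)$ is the set of all $v$ such that $X\setminus\{v\}$ is a dominating set with parent $X$. The *dominated list* $D_u(X)$ is $N(u)^{<u}\cap(X\setminus C(X))$ if $u\in X$, and $N(u)\cap(X\setminus C(X))$ if $u\notin X$. The algorithm EDS-D is the following recursive procedure with arguments $(X,C,(D_u)_{u\in V})$; the first call has $X=V$, $C$ the set of non-isolated vertices, and all $D_u$ empty. Output $X$. Then, for each $v\in C$ in decreasing order, let - $\mathrm{Del}_1=\{u\in C^{<v}: N[u]\cap X=\{u,v\}\}$,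 - $\mathrm{Del}_2=\{u\in C^{<v}: N[w]\cap X=\{u,v\}\text{ for some }w\in V\setminus(X\setminus\{v\})\}$, - $\mathrm{Del}_3=C^{v\le}$, and call the procedure with $X\setminus\{v\}$, $C\setminus(\mathrm{Del}_1\cup\mathrm{Del}_2\cup\mathrm{Del}_3)$ and the sets $D'_u=D_u\cup(N(u)^{<u}\cap(\mathrm{Del}_1\cup\mathrm{Del}_2\cup\mathrm{Del}_3\setminus\{v\}))$ for $u\ne v$, $D'_v=D_v\cup(N(v)^{<v}\cap(\mathrm{Del}_1\cup\mathrm{Del}_2))\cup(N(v)^{v<}\cap X)$. **Theorem.** 1. For every graph $G$ and every numbering of its vertices, EDS-D outputs every dominating set of $G$ exactly once and nothing else, and in every call $C=C(X)$ and $D_u=D_u(X)$ for all $u$. 2. There are two fixed random access machine programs (preprocessing and enumeration) and a constant $c$ with the following property. For every graph $G$, given by adjacency lists in any order, the two programs, run one after the other on a memory of $c(n+m+1)$ words, each holding a number below $c(n+m+1)$, halt. The preprocessing takes at most $c(n+m+1)$ steps, outputs no solution, and leaves in memory a numbering that is a degeneracy ordering for every $k$ for which $G$ is $k$-degenerate.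 The enumeration outputs exactly the sets that EDS-D with this numbering outputs, in the same order, and if $G$ is $k$-degenerate it takes at most $c(kN+1)$ steps. If moreover $G$ is nonempty and has no isolated vertices, both programs together take at most $c\,kN$ steps. Hence EDS-D runs in $O(k)$ amortized time per solution, after $O(n+m)$ preprocessing, and uses $O(n+m)$ space. 3. Every program of this machine that, given the adjacency lists of $G$, outputs (at least) all the dominating sets takes at least $N$ steps. Hence the enumeration by EDS-D is optimal up to a constant factor for graphs of constant degeneracy. Here every elementary command (assigning, adding or subtracting registers, reading or writing a memory word, testing two registers for $<$ or $=$) costs one step. Output is write-only: the machine keeps a current output set, inserts or removes one element of it in one step, and reports the current set as a solution in one step. -/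

import Mathlib

namespace DomEnum

/-! ## Graph notions

The vertex set is `Fin n`.  A numbering of the vertices is a permutation `σ`, where `σ v` is the
index of `v`; all comparisons "smaller / larger" of vertices refer to this index. -/

section Graph

variable {n : ℕ} (G : SimpleGraph (Fin n)) [DecidableRel G.Adj] (σ : Equiv.Perm (Fin n))

/-- The closed neighbourhood `N[v]`. -/
def closedNbhd (v : Fin n) : Finset (Fin n) := insert v (G.neighborFinset v)

/-- `X` is a dominating set: every vertex is in `X` or has a neighbour in `X`. -/
def IsDominating (X : Finset (Fin n)) : Prop :=
  ∀ v, v ∈ X ∨ ∃ u ∈ X, G.Adj u v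

instance (X : Finset (Fin n)) : Decidable (IsDominating G X) := by
  unfold IsDominating; infer_instance

/-- The finite set of all dominating sets. -/
def dominatingSets : Finset (Finset (Fin n)) :=
  Finset.univ.filter fun X => IsDominating G X

/-- Every nonempty induced subgraph has a vertex of degree at most `k`. -/
def IsDegenerate (k : ℕ) : Prop :=
  ∀ S : Finset (Fin n), S.Nonempty → ∃ v ∈ S, (G.neighborFinset v ∩ S).card ≤ k

/-- `A^{<v}`: the members of `A` whose index is smaller than that of `v`. -/
def below (A : Finset (Fin n)) (v : Fin n) : Finset (Fin n) := A.filter fun u => σ u < σ v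

/-- `A^{v<}`: the members of `A` whose index is larger than that of `v`. -/
def above (A : Finset (Fin n)) (v : Fin n) : Finset (Fin n) := A.filter fun u => σ v < σ u

/-- Every vertex has at most `k` neighbours of larger index. -/
def IsDegeneracyOrdering (k : ℕ) : Prop :=
  ∀ v, (above σ (G.neighborFinset v) v).card ≤ k

/-! ## Reverse search: parent, candidate sets, dominated lists -/

/-- The parent `X ∪ {min (V ∖ X)}` of a set `X ≠ V`  (and `V` itself for `X = V`). -/
def parent (X : Finset (Fin n)) : Finset (Fin n) :=
  X ∪ Finset.univ.filter fun v => v ∉ X ∧ ∀ w, w ∉ X → σ v ≤ σ w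

/-- The candidate set of `X`: the vertices `v` such that `X ∖ {v}` is a dominating set whose parent
is `X`. -/
def cand (X : Finset (Fin n)) : Finset (Fin n) :=
  Finset.univ.filter fun v => IsDominating G (X.erase v) ∧ parent σ (X.erase v) = X

/-- The dominated list of `u` for `X`. -/
def domList (X : Finset (Fin n)) (u : Fin n) : Finset (Fin n) :=
  if u ∈ X then below σ (G.neighborFinset u) u ∩ (X \ cand G σ X)
  else G.neighborFinset u ∩ (X \ cand G σ X)

/-! ## The algorithm EDS-D

It carries the current solution `X`, a set `C` (meant to be the candidate set of `X`) and a family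
of sets `D u` (meant to be the dominated lists); `C` and `D` of a child are computed from those of
its parent. -/

/-- The arguments of a call of the recursive procedure. -/
structure Call (n : ℕ) where
  X : Finset (Fin n)
  C : Finset (Fin n)
  D : Fin n → Finset (Fin n)

/-- Smaller candidates `u` that are dominated only by `u` and `v`. -/
def del1 (s : Call n) (v : Fin n) : Finset (Fin n) :=
  (below σ s.C v).filter fun u => closedNbhd G u ∩ s.X = {u, v}

/-- Smaller candidates `u` such that some vertex `w` outside `X ∖ {v}` is dominated only by `u`
and `v`. -/
def del2 (s : Call n) (v : Fin n) : Finset (Fin n) :=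
  (below σ s.C v).filter fun u => ∃ w, w ∉ s.X.erase v ∧ closedNbhd G w ∩ s.X = {u, v}

/-- Candidates that are not smaller than `v`. -/
def del3 (s : Call n) (v : Fin n) : Finset (Fin n) :=
  s.C.filter fun u => σ v ≤ σ u

/-- The arguments of the recursive call made when `v` is removed from the current solution. -/
def child (s : Call n) (v : Fin n) : Call n where
  X := s.X.erase v
  C := s.C \ (del1 G σ s v ∪ del2 G σ s v ∪ del3 σ s v)
  D := fun u =>
    if u = v then
      s.D v ∪ (below σ (G.neighborFinset v) v ∩ (del1 G σ s v ∪ del2 G σ s v)) ∪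
        (above σ (G.neighborFinset v) v ∩ s.X)
    else
      s.D u ∪ (below σ (G.neighborFinset u) u ∩ (del1 G σ s v ∪ del2 G σ s v)) ∪
        (below σ (G.neighborFinset u) u ∩ (del3 σ s v).erase v)

/-- The members of `A`, listed by decreasing index. -/
def descending (A : Finset (Fin n)) : List (Fin n) :=
  ((List.finRange n).reverse.map σ.symm).filter fun v => v ∈ A

theorem mem_of_mem_descending {A : Finset (Fin n)} {v : Fin n} (h : v ∈ descending σ A) :
    v ∈ A := by
  simpa using (List.mem_filter.1 h).2

theorem child_card_lt (s : Call n) {v : Fin n} (h : v ∈ s.C) :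
    (child G σ s v).C.card < s.C.card := by
  apply Finset.card_lt_card
  refine ⟨Finset.sdiff_subset, fun hs => ?_⟩
  have h1 := hs h
  simp [child, del3, h] at h1

/-- The recursive procedure: output the current solution, then remove each candidate in turn, by
decreasing index, and recurse.  The result is the list of all calls, in the order in which they are
made; each call outputs its set `X`. -/
def allChildren (s : Call n) : List (Call n) :=
  s :: (descending σ s.C).attach.flatMap fun v => allChildren (child G σ s v.1)
termination_by s.C.card
decreasing_by exact child_card_lt G σ s (mem_of_mem_descending σ v.2)

/-- The first call: the whole vertex set, whose candidates are the non-isolated vertices, and empty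
dominated lists. -/
def rootCall : Call n where
  X := Finset.univ
  C := Finset.univ.filter fun v => (G.neighborFinset v).Nonempty
  D := fun _ => ∅

/-- The run of EDS-D on `G` with the numbering `σ`. -/
def edsd : List (Call n) := allChildren G σ (rootCall G)

end Graph

/-! ## The machine model

A random access machine with finitely many registers (those that the program mentions) and an array
of memory words.  Programs are structured; every elementary operation and every evaluation of a
test costs one unit of time.  The output device is write-only: it holds a current set, which is
changed by inserting or removing one element at a time, and the command `report` outputs the current
set as a solution. -/

inductive Test where
  | lt (x y : ℕ)
  | eq (x y : ℕ)

/-- Commands; the arguments `x y z` are names of registers. -/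
inductive Cmd where
  | skip
  | const (x a : ℕ)
  | copy (x y : ℕ)
  | plus (x y z : ℕ)
  | minus (x y z : ℕ)
  | load (x y : ℕ)
  | store (x y : ℕ)
  | insert (x : ℕ)
  | remove (x : ℕ)
  | report
  | seq (p q : Cmd)
  | ite (b : Test) (p q : Cmd)
  | while (b : Test) (p : Cmd)

structure State where
  reg : ℕ → ℕ
  mem : ℕ → ℕ
  current : Finset ℕ
  reported : List (Finset ℕ)

def Test.holds (s : State) : Test → Prop
  | .lt x y => s.reg x < s.reg y
  | .eq x y => s.reg x = s.reg y

def State.setReg (s : State) (x a : ℕ) : State := { s with reg := Function.update s.reg x a }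

def State.setMem (s : State) (i a : ℕ) : State := { s with mem := Function.update s.mem i a }

/-- `Exec W p s t s'`: on a machine with `W` memory words, each holding a number less than `W`,
the program `p` started in state `s` halts after exactly `t` steps in state `s'`.  There is no
execution that addresses a word outside the memory or computes a number that is not less
than `W`. -/
inductive Exec (W : ℕ) : Cmd → State → ℕ → State → Prop
  | skip (s) : Exec W .skip s 1 s
  | const (s x a) : a < W → Exec W (.const x a) s 1 (s.setReg x a)
  | copy (s x y) : Exec W (.copy x y) s 1 (s.setReg x (s.reg y))
  | plus (s x y z) : s.reg y + s.reg z < W →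
      Exec W (.plus x y z) s 1 (s.setReg x (s.reg y + s.reg z))
  | minus (s x y z) : Exec W (.minus x y z) s 1 (s.setReg x (s.reg y - s.reg z))
  | load (s x y) : s.reg y < W → Exec W (.load x y) s 1 (s.setReg x (s.mem (s.reg y)))
  | store (s x y) : s.reg x < W → Exec W (.store x y) s 1 (s.setMem (s.reg x) (s.reg y))
  | insert (s x) : Exec W (.insert x) s 1 { s with current := Insert.insert (s.reg x) s.current }
  | remove (s x) : Exec W (.remove x) s 1 { s with current := s.current.erase (s.reg x) }
  | report (s) : Exec W .report s 1 { s with reported := s.reported ++ [s.current] }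
  | seq {p q s s₁ s₂ t₁ t₂} : Exec W p s t₁ s₁ → Exec W q s₁ t₂ s₂ →
      Exec W (.seq p q) s (t₁ + t₂) s₂
  | iteTrue {b p q s s' t} : b.holds s → Exec W p s t s' → Exec W (.ite b p q) s (t + 1) s'
  | iteFalse {b p q s s' t} : ¬ b.holds s → Exec W q s t s' → Exec W (.ite b p q) s (t + 1) s'
  | whileTrue {b p s s₁ s₂ t₁ t₂} : b.holds s → Exec W p s t₁ s₁ →
      Exec W (.while b p) s₁ t₂ s₂ → Exec W (.while b p) s (t₁ + t₂ + 1) s₂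
  | whileFalse {b p s} : ¬ b.holds s → Exec W (.while b p) s 1 s

/-! ## Input -/

/-- Adjacency lists of `G`, each in an arbitrary order. -/
structure AdjLists {n : ℕ} (G : SimpleGraph (Fin n)) where
  list : Fin n → List (Fin n)
  nodup : ∀ v, (list v).Nodup
  mem_iff : ∀ v u, u ∈ list v ↔ G.Adj v u

section Input

variable {n : ℕ} {G : SimpleGraph (Fin n)} (L : AdjLists G)

/-- The address at which the adjacency list of vertex `i` starts (for `i = n`: the first address
after the last list). -/
def AdjLists.offset (i : ℕ) : ℕ :=
  n + 2 + (((List.ofFn L.list).take i).map List.length).sum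

/-- The input: the number `n`, the addresses of the `n` adjacency lists together with the end
address, and then the adjacency lists one after the other. -/
def AdjLists.encode : List ℕ :=
  n :: ((List.range (n + 1)).map L.offset ++ (List.ofFn L.list).flatten.map Fin.val)

/-- The initial state: the input is stored in memory from address `0` on; everything else is
zero or empty. -/
def AdjLists.init : State where
  reg := fun _ => 0
  mem := fun i => L.encode.getD i 0
  current := ∅
  reported := []

end Input

/-- A vertex set as a set of natural numbers. -/
def toNatSet {n : ℕ} (X : Finset (Fin n)) : Finset ℕ := X.map Fin.valEmbedding

end DomEnum

namespace DomEnum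

set_option linter.constructorNameAsVariable false

/-! ### Correctness of the reverse search -/

section Correctness

variable {n : ℕ} {G : SimpleGraph (Fin n)} [DecidableRel G.Adj] {σ : Equiv.Perm (Fin n)}

/-! EDS-D is a reverse search. Adding the smallest missing vertex again and again leads from any
dominating set to `V`, so the dominating sets form a tree with root `V`, and the children of `X`
arise by removing the members of `cand G σ X`. If two vertices can be removed singly, they can be
removed together unless some closed neighbourhood meets `X` in exactly these two (`Conflict`,
`isDominating_erase_erase`). Hence the candidates of `X \ {v}` are the candidates below `v` that are
not in conflict with `v`, and this is what the three deletions compute (`mem_child_C`,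
`Call.Valid.child`). Completeness is an induction along parents (`mem_edsd_iff`); sibling subtrees
are disjoint because only one of them keeps the larger of the two removed vertices
(`allChildren_nodup`).

The implementation does not store dominated lists. For each vertex `w` it keeps the size and the sum
modulo `n` of a set `A w` of dominators; if this set has two elements and one of them is known, the
sum reveals the other. A candidate `v` is smaller than every missing vertex, so the missing
neighbours of `v` are found in the list `U v` of `v` and its larger neighbours, of length at most `k
+ 1`. The sets `A w` are exact for missing vertices and for candidates, and merely too large
elsewhere; this suffices to detect conflicts (`Approx.conflict_iff`) and is preserved by removals
(`Approx.child`). All candidates are kept in one linked list by decreasing index. The list of a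
child is a tail of the current one with the conflicting candidates unlinked (`descending_child`);
these are chained up and relinked in reverse order on backtracking (`wp_sweep`, `wp_relink`). So the
whole recursion runs in linear space, as a single loop (`wp_search`).

Visiting and leaving the child `X \ {v}` costs `O(k + 1)`, plus `O(1)` for each candidate below `v`,
plus `O(k + 1)` for each candidate that remains. The remaining candidates correspond to children of
the child and are charged to them. Of the deleted ones, `del2` has at most `|U v|` members for each
`v`, and the sets `del1` have at most `|C|` members for all `v` together. Summation over the tree
gives `O(kN)` (`sum_stepCost_le`, `treeCost_le`).

The numbering is found by peeling in rounds `d = 0, 1, ...`, in which vertices with at most `d`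
remaining neighbours are numbered. If vertices are left for round `d`, they induce a subgraph of
minimum degree at least `d`, so `d` is at most the degeneracy (`le_of_isDegenerate`). A vertex is
scanned in at most one more round than its degree, so the time is linear (`wp_peel`). Without
isolated vertices, `n ≤ N` and `m ≤ kn`, and the preprocessing is absorbed by `O(kN)`. The lower
bound holds because a step reports at most one set.

The programs are written in a small language with named arrays and an explicit clock;
`Layout.wp_of_vc` transfers what is proved there to the machine. -/

theorem mem_closedNbhd {v w : Fin n} : w ∈ closedNbhd G v ↔ w = v ∨ G.Adj v w := by
  simp [closedNbhd]

theorem isDominating_iff_closedNbhd {X : Finset (Fin n)} :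
    IsDominating G X ↔ ∀ w, (closedNbhd G w ∩ X).Nonempty := by
  unfold IsDominating
  refine forall_congr' fun w => ?_
  constructor
  · rintro (h | ⟨u, hu, ha⟩)
    · exact ⟨w, by simp [mem_closedNbhd, h]⟩
    · exact ⟨u, by simp [mem_closedNbhd, hu, ha.symm]⟩
  · rintro ⟨u, hu⟩
    rw [Finset.mem_inter, mem_closedNbhd] at hu
    rcases hu with ⟨rfl | h, hu⟩
    · exact Or.inl hu
    · exact Or.inr ⟨u, hu, h.symm⟩

omit [DecidableRel G.Adj] in
theorem IsDominating.mono {X Y : Finset (Fin n)} (h : IsDominating G X) (hXY : X ⊆ Y) :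
    IsDominating G Y := by
  intro v
  rcases h v with h | ⟨u, hu, ha⟩
  · exact Or.inl (hXY h)
  · exact Or.inr ⟨u, hXY hu, ha⟩

/-- The parent puts back the smallest missing vertex, so `v` must become the smallest missing vertex
by its removal. -/
theorem mem_cand {X : Finset (Fin n)} {v : Fin n} :
    v ∈ cand G σ X ↔ v ∈ X ∧ (∀ w, w ∉ X → σ v < σ w) ∧ IsDominating G (X.erase v) := by
  simp only [cand, Finset.mem_filter, Finset.mem_univ, true_and]
  constructor
  · rintro ⟨hd, hp⟩
    have hv : v ∈ X := by
      by_contra hv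
      -- If `v` were missing, `X` would be its own parent, although the parent contains the smallest
      -- missing vertex.
      rw [Finset.erase_eq_of_notMem hv] at hp
      obtain ⟨w, hw, hm⟩ := Finset.exists_min_image (Finset.univ \ X) σ ⟨v, by simp [hv]⟩
      have : w ∈ parent σ X := by
        simp only [parent, Finset.mem_union, Finset.mem_filter, Finset.mem_univ, true_and]
        refine Or.inr ⟨by simpa using hw, fun x hx => hm x (by simpa using hx)⟩
      rw [hp] at this
      simp [this] at hw
    refine ⟨hv, fun w hw => ?_, hd⟩
    have h1 : v ∈ parent σ (X.erase v) := by rw [hp]; exact hv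
    simp only [parent, Finset.mem_union, Finset.mem_filter, Finset.mem_univ, true_and,
      Finset.mem_erase, ne_eq, not_true_eq_false, false_and, not_false_eq_true, false_or] at h1
    refine lt_of_le_of_ne (h1 w (by simp [hw])) fun h => hw ?_
    rw [← σ.injective h]; exact hv
  · rintro ⟨hv, hlt, hd⟩
    refine ⟨hd, ?_⟩
    ext x
    simp only [parent, Finset.mem_union, Finset.mem_filter, Finset.mem_univ, true_and,
      Finset.mem_erase, ne_eq, not_and]
    constructor
    · rintro (h | ⟨h1, h2⟩)
      · exact h.2
      · by_contra hx
        have := h2 v (fun h => absurd rfl h)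
        exact absurd (hlt x hx) (not_lt.2 this)
    · intro hx
      by_cases hxv : x = v
      · subst hxv
        refine Or.inr ⟨fun h => absurd rfl h, fun w hw => ?_⟩
        by_cases hwx : w = x
        · rw [hwx]
        · exact (hlt w (hw hwx)).le
      · exact Or.inl ⟨hxv, hx⟩

/-- `u` and `v` are the only two dominators of some vertex. -/
def Conflict (G : SimpleGraph (Fin n)) [DecidableRel G.Adj] (X : Finset (Fin n))
    (u v : Fin n) : Prop :=
  ∃ w, closedNbhd G w ∩ X = {u, v}

/-- A vertex that loses all its dominators had no others than `u` and `v`; it had both, since it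
survives either single removal. -/
theorem isDominating_erase_erase {X : Finset (Fin n)} {u v : Fin n} (hu : u ∈ X) (hv : v ∈ X)
    (huv : u ≠ v) (hdu : IsDominating G (X.erase u)) (hdv : IsDominating G (X.erase v)) :
    IsDominating G ((X.erase v).erase u) ↔ ¬ Conflict G X u v := by
  rw [isDominating_iff_closedNbhd] at *
  constructor
  · rintro h ⟨w, hw⟩
    obtain ⟨x, hx⟩ := h w
    simp only [Finset.mem_inter, Finset.mem_erase] at hx
    have : x ∈ ({u, v} : Finset (Fin n)) := by rw [← hw]; simp [hx]
    simp only [Finset.mem_insert, Finset.mem_singleton] at this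
    tauto
  · intro h w
    by_contra hne
    rw [Finset.not_nonempty_iff_eq_empty] at hne
    have key : ∀ x, x ∈ closedNbhd G w → x ∈ X → x = u ∨ x = v := by
      intro x hx hX
      by_contra hc
      push Not at hc
      have : x ∈ closedNbhd G w ∩ (X.erase v).erase u := by simp [hx, hX, hc]
      rw [hne] at this
      exact Finset.notMem_empty _ this
    apply h
    refine ⟨w, ?_⟩
    obtain ⟨x, hx⟩ := hdu w
    obtain ⟨y, hy⟩ := hdv w
    simp only [Finset.mem_inter, Finset.mem_erase] at hx hy
    have hxv : x = v := (key x hx.1 hx.2.2).resolve_left hx.2.1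
    have hyu : y = u := (key y hy.1 hy.2.2).resolve_right hy.2.1
    subst hxv hyu
    ext z
    simp only [Finset.mem_inter, Finset.mem_insert, Finset.mem_singleton]
    constructor
    · exact fun hz => key z hz.1 hz.2
    · rintro (rfl | rfl)
      · exact ⟨hy.1, hu⟩
      · exact ⟨hx.1, hv⟩

/-- The two rules divide the conflicts by the place of the witness `w`. If `w` stays in the
solution, it dominates itself, so it is one of `u`, `v`, and not `v`. -/
theorem mem_del1_or_del2 {s : Call n} {u v : Fin n} :
    u ∈ del1 G σ s v ∪ del2 G σ s v ↔ u ∈ s.C ∧ σ u < σ v ∧ Conflict G s.X u v := by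
  simp only [del1, del2, below, Finset.mem_union, Finset.mem_filter]
  constructor
  · rintro (⟨⟨h1, h2⟩, h3⟩ | ⟨⟨h1, h2⟩, w, h3, h4⟩)
    · exact ⟨h1, h2, u, h3⟩
    · exact ⟨h1, h2, w, h4⟩
  · rintro ⟨h1, h2, w, h3⟩
    by_cases hw : w ∈ s.X.erase v
    · left
      rw [Finset.mem_erase] at hw
      have : w ∈ ({u, v} : Finset (Fin n)) := by
        rw [← h3]; simp [mem_closedNbhd, hw.2]
      simp only [Finset.mem_insert, Finset.mem_singleton] at this
      obtain rfl := this.resolve_right hw.1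
      exact ⟨⟨h1, h2⟩, h3⟩
    · exact Or.inr ⟨⟨h1, h2⟩, w, hw, h3⟩

theorem mem_child_C {s : Call n} {u v : Fin n} :
    u ∈ (child G σ s v).C ↔ u ∈ s.C ∧ σ u < σ v ∧ ¬ Conflict G s.X u v := by
  simp only [child, Finset.mem_sdiff]
  rw [Finset.mem_union, mem_del1_or_del2]
  simp only [del3, Finset.mem_filter]
  constructor
  · rintro ⟨h1, h2⟩
    push Not at h2
    refine ⟨h1, h2.2 h1, h2.1 h1 (h2.2 h1)⟩
  · rintro ⟨h1, h2, h3⟩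
    refine ⟨h1, ?_⟩
    rintro (h | h)
    · exact h3 h.2.2
    · exact absurd h2 (not_lt.2 h.2)

variable (G σ) in
/-- The arguments of a call are what they are meant to be. -/
structure Call.Valid (s : Call n) : Prop where
  dom : IsDominating G s.X
  C_eq : s.C = cand G σ s.X
  D_eq : ∀ u, s.D u = domList G σ s.X u

/-- For the candidates: `v` is now the smallest missing vertex, so exactly the smaller candidates
can qualify, and `isDominating_erase_erase` decides which do. For the lists: the non-candidates of
the child are the old ones and the deleted candidates other than `v`. -/
theorem Call.Valid.child {s : Call n} (hs : s.Valid G σ) {v : Fin n} (hv : v ∈ s.C) :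
    (child G σ s v).Valid G σ := by
  have hmem : ∀ u, u ∈ s.C ↔ u ∈ s.X ∧ (∀ w, w ∉ s.X → σ u < σ w) ∧
      IsDominating G (s.X.erase u) := fun u => by rw [hs.C_eq]; exact mem_cand
  have hv' := (hmem v).1 hv
  have hC : (DomEnum.child G σ s v).C = cand G σ (s.X.erase v) := by
    ext u
    rw [mem_child_C, mem_cand, hmem]
    constructor
    · rintro ⟨⟨hu, h1, h2⟩, h3, h4⟩
      have huv : u ≠ v := by rintro rfl; exact lt_irrefl _ h3
      refine ⟨Finset.mem_erase.2 ⟨huv, hu⟩, fun w hw => ?_, ?_⟩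
      · by_cases hwv : w = v
        · rwa [hwv]
        · exact h1 w (by simpa [hwv] using hw)
      · exact (isDominating_erase_erase hu hv'.1 huv h2 hv'.2.2).2 h4
    · rintro ⟨hu, h1, h2⟩
      rw [Finset.mem_erase] at hu
      have hdu : IsDominating G (s.X.erase u) :=
        h2.mono (Finset.erase_subset_erase _ (Finset.erase_subset _ _))
      refine ⟨⟨hu.2, fun w hw => h1 w (by simp [hw]), hdu⟩, h1 v (by simp), ?_⟩
      exact (isDominating_erase_erase hu.2 hv'.1 hu.1 hdu hv'.2.2).1 h2
  refine ⟨hv'.2.2, hC, fun u => ?_⟩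
  have hX : (DomEnum.child G σ s v).X = s.X.erase v := rfl
  have hmem' : ∀ x, x ∈ s.X.erase v \ (DomEnum.child G σ s v).C ↔ x ∈ s.X \ s.C ∨
      x ∈ del1 G σ s v ∪ del2 G σ s v ∨ x ∈ (del3 σ s v).erase v := by
    intro x
    rw [mem_del1_or_del2, Finset.mem_sdiff, mem_child_C]
    simp only [del3, Finset.mem_sdiff, Finset.mem_erase, Finset.mem_filter]
    have := hmem x
    by_cases hxv : x = v
    · subst hxv; simp [hv]
    · by_cases hxC : x ∈ s.C
      · have hlt := lt_or_ge (σ x) (σ v)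
        have hxX := (this.1 hxC).1
        simp only [hxC, hxX]
        rcases hlt with hlt | hlt
        · simp [hlt, hxv, not_le.2 hlt]
        · simp [hlt, not_lt.2 hlt]
      · simp [hxv, hxC]
  ext x
  have hx' := hmem' x
  unfold domList
  rw [hX, ← hC]
  -- Only the list of `v` changes its form, as `v` leaves the solution: it now has to contain larger
  -- neighbours too, and all of these that lie in `X` are non-candidates of the child. At a vertex
  -- that was missing before, restricting the additions to smaller neighbours loses nothing, since
  -- candidates are smaller than every missing vertex.
  by_cases huv : u = v
  · subst huv
    rw [if_neg (by simp)]
    simp only [DomEnum.child, if_true] at hx' ⊢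
    rw [hs.D_eq, domList, if_pos hv'.1, ← hs.C_eq]
    rw [Finset.mem_inter, hx']
    simp only [Finset.mem_union, Finset.mem_inter, below, above, Finset.mem_filter]
    rw [← Finset.mem_union, mem_del1_or_del2]
    simp only [del3, Finset.mem_sdiff, Finset.mem_erase, Finset.mem_filter]
    have hne : x ∈ G.neighborFinset u → x ≠ u := by
      rintro h rfl; simp at h
    rcases lt_trichotomy (σ x) (σ u) with h | h | h
    · have h1 := not_lt.2 h.le
      have h2 := not_le.2 h
      clear * -h h1 h2
      simp only [h, h1, h2]
      tauto
    · have := σ.injective h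
      clear * -hne this
      tauto
    · have h1 := not_lt.2 h.le
      have h2 := h.le
      have := fun h => ((hmem x).1 h).1
      clear * -h h1 h2 this hne
      simp only [h, h1, h2]
      tauto
  · by_cases huX : u ∈ s.X
    · rw [if_pos (by simp [huv, huX])]
      simp only [DomEnum.child, if_neg huv] at hx' ⊢
      rw [hs.D_eq, domList, if_pos huX, ← hs.C_eq]
      rw [Finset.mem_inter, hx']
      simp only [Finset.mem_union, Finset.mem_inter]
      clear * -
      tauto
    · rw [if_neg (by simp [huX])]
      simp only [DomEnum.child, if_neg huv] at hx' ⊢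
      rw [hs.D_eq, domList, if_neg huX, ← hs.C_eq]
      rw [Finset.mem_inter, hx']
      simp only [Finset.mem_union, Finset.mem_inter, below, Finset.mem_filter]
      rw [← Finset.mem_union, mem_del1_or_del2]
      simp only [del3, Finset.mem_erase, Finset.mem_filter]
      have := fun h => ((hmem x).1 h).2.1 u huX
      clear * -this
      tauto

theorem rootCall_valid : (rootCall G).Valid G σ := by
  have hC : (rootCall G).C = cand G σ Finset.univ := by
    ext v
    rw [mem_cand]
    simp only [rootCall, Finset.mem_filter, Finset.mem_univ, true_and, not_true_eq_false,
      false_imp_iff, implies_true]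
    constructor
    · rintro ⟨u, hu⟩ w
      rw [SimpleGraph.mem_neighborFinset] at hu
      by_cases hw : w = v
      · subst hw
        exact Or.inr ⟨u, by simpa using hu.ne', hu.symm⟩
      · exact Or.inl (by simpa using hw)
    · intro h
      rcases h v with h | ⟨u, -, hu⟩
      · simp at h
      · exact ⟨u, by simpa using hu.symm⟩
  refine ⟨fun v => Or.inl (by simp [rootCall]), hC, fun u => ?_⟩
  simp only [domList]
  rw [show (rootCall G).X = Finset.univ from rfl, if_pos (Finset.mem_univ _), ← hC]
  -- The non-candidates are the isolated vertices, which occur in no neighbourhood.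
  ext x
  simp only [rootCall, below, Finset.mem_inter, Finset.mem_filter, Finset.mem_sdiff,
    Finset.mem_univ, true_and, Finset.notMem_empty, false_iff, not_and, not_not]
  intro h
  exact ⟨u, by simpa using ((G.mem_neighborFinset _ _).1 h.1).symm⟩

theorem mem_descending {A : Finset (Fin n)} {v : Fin n} : v ∈ descending σ A ↔ v ∈ A := by
  simp only [descending, List.mem_filter, List.mem_map, List.mem_reverse, List.mem_finRange,
    true_and, decide_eq_true_eq, and_iff_right_iff_imp]
  exact fun _ => ⟨σ v, by simp⟩

theorem descending_pairwise (A : Finset (Fin n)) :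
    (descending σ A).Pairwise fun u v => σ v < σ u := by
  unfold descending
  apply List.Pairwise.filter
  rw [List.pairwise_map]
  simp only [Equiv.apply_symm_apply]
  rw [List.pairwise_reverse]
  exact List.pairwise_lt_finRange n

theorem descending_nodup (A : Finset (Fin n)) : (descending σ A).Nodup :=
  (descending_pairwise A).imp fun h => by rintro rfl; exact lt_irrefl _ h

theorem allChildren_eq (s : Call n) :
    allChildren G σ s =
      s :: (descending σ s.C).flatMap fun v => allChildren G σ (child G σ s v) := by
  rw [allChildren]
  congr 1
  rw [List.flatMap_subtype (g := fun v => allChildren G σ (child G σ s v)) (hf := fun _ _ => rfl)]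
  simp

theorem allChildren_induction {P : Call n → Prop}
    (h : ∀ s, (∀ v ∈ s.C, P (child G σ s v)) → P s) (s : Call n) : P s := by
  induction hk : s.C.card using Nat.strong_induction_on generalizing s with
  | _ k ih =>
    subst hk
    exact h s fun v hv => ih _ (child_card_lt G σ s hv) _ rfl

theorem valid_of_mem_allChildren {s : Call n} (hs : s.Valid G σ) :
    ∀ t ∈ allChildren G σ s, t.Valid G σ := by
  induction s using allChildren_induction (G := G) (σ := σ) with
  | h s ih =>
    intro t ht
    rw [allChildren_eq, List.mem_cons, List.mem_flatMap] at ht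
    rcases ht with rfl | ⟨v, hv, ht⟩
    · exact hs
    · rw [mem_descending] at hv
      exact ih v hv (hs.child hv) t ht

theorem child_mem_allChildren {r t : Call n} (ht : t ∈ allChildren G σ r) {v : Fin n}
    (hv : v ∈ t.C) : child G σ t v ∈ allChildren G σ r := by
  induction r using allChildren_induction (G := G) (σ := σ) with
  | h s ih =>
    rw [allChildren_eq, List.mem_cons, List.mem_flatMap] at ht ⊢
    right
    rcases ht with rfl | ⟨w, hw, ht⟩
    · exact ⟨v, mem_descending.2 hv, by rw [allChildren_eq]; simp⟩
    · exact ⟨w, hw, ih w (mem_descending.1 hw) ht⟩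

/-- Candidate sets shrink along the recursion, so nothing but candidates of `s` is ever removed
below `s`. This separates sibling subtrees. -/
theorem subset_of_mem_allChildren {s t : Call n} (ht : t ∈ allChildren G σ s) :
    t.X ⊆ s.X ∧ ∀ w ∈ s.X, w ∉ t.X → w ∈ s.C := by
  induction s using allChildren_induction (G := G) (σ := σ) with
  | h s ih =>
    rw [allChildren_eq, List.mem_cons, List.mem_flatMap] at ht
    rcases ht with rfl | ⟨v, hv, ht⟩
    · exact ⟨subset_rfl, fun w h h' => absurd h h'⟩
    · rw [mem_descending] at hv
      obtain ⟨h1, h2⟩ := ih v hv ht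
      refine ⟨h1.trans (Finset.erase_subset _ _), fun w hw hwt => ?_⟩
      by_cases hwv : w = v
      · rwa [hwv]
      · exact (mem_child_C.1 (h2 w (Finset.mem_erase.2 ⟨hwv, hw⟩) hwt)).1

/-- For candidates `v` below `u`, all sets in the subtree of `u` miss `u`, whereas those in the
subtree of `v` contain it, because only candidates smaller than `v` are removed there. -/
theorem allChildren_nodup {s : Call n} (hs : s.Valid G σ) :
    ((allChildren G σ s).map Call.X).Nodup := by
  have hCX : ∀ {s : Call n}, s.Valid G σ → ∀ v ∈ s.C, v ∈ s.X := fun hs v hv => by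
    rw [hs.C_eq] at hv; exact (mem_cand.1 hv).1
  induction s using allChildren_induction (G := G) (σ := σ) with
  | h s ih =>
    have hnot : ∀ v, ∀ t ∈ allChildren G σ (child G σ s v), v ∉ t.X := fun v t ht hvt => by
      have := (subset_of_mem_allChildren ht).1 hvt
      simp [child] at this
    rw [allChildren_eq, List.map_cons, List.nodup_cons, List.map_flatMap, List.nodup_flatMap]
    refine ⟨?_, ?_, ?_⟩
    · simp only [List.mem_flatMap, List.mem_map, not_exists, not_and]
      rintro v hv t ht h
      rw [mem_descending] at hv
      exact hnot v t ht (h ▸ hCX hs v hv)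
    · intro v hv
      rw [mem_descending] at hv
      exact ih v hv (hs.child hv)
    · refine (descending_pairwise s.C).imp_of_mem ?_
      intro u v hu hv huv
      rw [mem_descending] at hu hv
      simp only [Function.onFun, List.disjoint_left, List.mem_map]
      rintro _ ⟨t, ht, rfl⟩ ⟨t', ht', h⟩
      have h1 := hnot u t ht
      rw [← h] at h1
      have hne : u ≠ v := by rintro rfl; exact lt_irrefl _ huv
      have h2 := (subset_of_mem_allChildren ht').2 u
        (Finset.mem_erase.2 ⟨hne, hCX hs u hu⟩) h1
      exact absurd (mem_child_C.1 h2).2.1 (not_lt.2 huv.le)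

/-- Completeness is an induction on the number of missing vertices: the parent occurs in the run,
and the smallest missing vertex is a candidate of it. -/
theorem mem_edsd_iff {X : Finset (Fin n)} :
    X ∈ (edsd G σ).map Call.X ↔ IsDominating G X := by
  constructor
  · rw [List.mem_map]
    rintro ⟨t, ht, rfl⟩
    exact (valid_of_mem_allChildren rootCall_valid t ht).dom
  · intro hX
    induction hk : (Finset.univ \ X).card using Nat.strong_induction_on generalizing X with
    | _ k ih =>
      subst hk
      rcases (Finset.univ \ X).eq_empty_or_nonempty with he | hne
      · have : X = Finset.univ := by
          rw [Finset.sdiff_eq_empty_iff_subset] at he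
          exact Finset.univ_subset_iff.1 he
        subst this
        exact List.mem_map.2 ⟨rootCall G, by rw [edsd, allChildren_eq]; simp, rfl⟩
      · obtain ⟨v, hv, hm⟩ := Finset.exists_min_image (Finset.univ \ X) σ hne
        simp only [Finset.mem_sdiff, Finset.mem_univ, true_and] at hv hm
        have hYe : (insert v X).erase v = X := Finset.erase_insert hv
        have hY : IsDominating G (insert v X) := hX.mono (Finset.subset_insert _ _)
        have hlt : (Finset.univ \ insert v X).card < (Finset.univ \ X).card := by
          apply Finset.card_lt_card
          refine ⟨Finset.sdiff_subset_sdiff subset_rfl (Finset.subset_insert _ _), fun h => ?_⟩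
          have := h (show v ∈ Finset.univ \ X by simp [hv])
          simp at this
        obtain ⟨t, ht, htX⟩ := List.mem_map.1 (ih _ hlt hY rfl)
        have hvt : v ∈ t.C := by
          rw [(valid_of_mem_allChildren rootCall_valid t ht).C_eq, htX, mem_cand, hYe]
          refine ⟨by simp, fun w hw => ?_, hX⟩
          simp only [Finset.mem_insert, not_or] at hw
          exact lt_of_le_of_ne (hm w hw.2) fun h => hw.1 (σ.injective h).symm
        refine List.mem_map.2 ⟨_, child_mem_allChildren ht hvt, ?_⟩
        simp [child, htX, hYe]

theorem edsd_length : (edsd G σ).length = (dominatingSets G).card := by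
  rw [← List.length_map (f := Call.X), edsd,
    ← List.toFinset_card_of_nodup (allChildren_nodup (σ := σ) rootCall_valid)]
  congr 1
  ext X
  rw [List.mem_toFinset]
  simp only [dominatingSets, Finset.mem_filter, Finset.mem_univ, true_and]
  exact mem_edsd_iff

end Correctness

/-! ### The lower bound -/

theorem Exec.reported_length_le {W t : ℕ} {p : Cmd} {s s' : State} (h : Exec W p s t s') :
    s'.reported.length ≤ s.reported.length + t := by
  induction h <;> (try simp [State.setReg, State.setMem]) <;> omega

/-- Different solutions are different reports, since `toNatSet` is injective, and a step makes at
most one report. -/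
theorem card_dominatingSets_le_time {n : ℕ} {G : SimpleGraph (Fin n)} [DecidableRel G.Adj]
    {L : AdjLists G} {W t : ℕ} {p : Cmd} {s : State} (h : Exec W p L.init t s)
    (hs : ∀ X : Finset (Fin n), IsDominating G X → toNatSet X ∈ s.reported) :
    (dominatingSets G).card ≤ t := by
  have h1 := h.reported_length_le
  simp only [AdjLists.init, List.length_nil, zero_add] at h1
  refine le_trans ?_ (h1.trans' (List.toFinset_card_le _))
  rw [← Finset.card_image_of_injective (dominatingSets G) (f := toNatSet)
    (Finset.map_injective _)]
  apply Finset.card_le_card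
  intro Y hY
  obtain ⟨X, hX, rfl⟩ := Finset.mem_image.1 hY
  simp only [dominatingSets, Finset.mem_filter, Finset.mem_univ, true_and] at hX
  exact List.mem_toFinset.2 (hs X hX)

/-! ## A small imperative language with named variables and arrays, compiled to machine programs -/

/-- `inp` is the input, `pos` and `ord` are the numbering and its inverse, `ups` and `up` store the
lists of larger neighbours. `nxt` links the candidates; `pr` and `und` record how to undo removals;
`cnt`, `sum` and `mark` serve to find conflicts. `deg` and `lst` belong to the preprocessing only.
`pos` gets register 0, through which the numbering is to be read. -/
inductive Arr where
  | pos | inp | ups | up | nxt | pr | und | cnt | sum | mark | deg | lst | ord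
  deriving DecidableEq

inductive Var where
  | n | cur | top | v | u | w | x | i | h | i' | h' | p | t | d | tail | head | len | ch
  deriving DecidableEq

/-- The register that holds the base address of an array. -/
def Arr.reg : Arr → ℕ
  | pos => 0 | inp => 1 | ups => 2 | up => 3 | nxt => 4 | pr => 5 | und => 6 | cnt => 7
  | sum => 8 | mark => 9 | deg => 10 | lst => 11 | ord => 12

/-- The register that holds the value of a variable. -/
def Var.reg : Var → ℕ
  | n => 13 | cur => 14 | top => 15 | v => 16 | u => 17 | w => 18 | x => 19 | i => 20 | h => 21
  | i' => 22 | h' => 23 | p => 24 | t => 25 | d => 26 | tail => 27 | head => 28 | len => 29 | ch => 30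

/-- Registers from this one on hold intermediate results. -/
def tmp : ℕ := 31

theorem Arr.reg_lt (r : Arr) : r.reg < 13 := by cases r <;> simp [reg]

theorem Var.le_reg (x : Var) : 13 ≤ x.reg := by cases x <;> simp [reg]

theorem Var.reg_lt (x : Var) : x.reg < tmp := by cases x <;> simp [reg, tmp]

theorem Var.reg_injective : Function.Injective Var.reg := by
  intro x y h
  cases x <;> cases y <;> first | rfl | simp [reg] at h

/-- The machine state as seen by a program of the small language, with the elapsed time. -/
structure Ast where
  var : Var → ℕ
  arr : Arr → ℕ → ℕ
  current : Finset ℕ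
  reported : List (Finset ℕ)
  time : ℕ

namespace Ast

def tick (a : Ast) (k : ℕ) : Ast := { a with time := a.time + k }

/-- The last argument is the time charged. -/
def set (a : Ast) (x : Var) (i k : ℕ) : Ast :=
  { a with var := Function.update a.var x i, time := a.time + k }

def put (a : Ast) (r : Arr) (i b k : ℕ) : Ast :=
  { a with arr := Function.update a.arr r (Function.update (a.arr r) i b), time := a.time + k }

def ins (a : Ast) (x : Var) : Ast :=
  { a with current := Insert.insert (a.var x) a.current, time := a.time + 1 }

def rem (a : Ast) (x : Var) : Ast :=
  { a with current := a.current.erase (a.var x), time := a.time + 1 }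

def rep (a : Ast) : Ast :=
  { a with reported := a.reported ++ [a.current], time := a.time + 1 }

variable (a : Ast) (x y : Var) (r r' : Arr) (i b k : ℕ)

@[simp] theorem tick_var : (a.tick k).var = a.var := rfl
@[simp] theorem tick_arr : (a.tick k).arr = a.arr := rfl
@[simp] theorem tick_current : (a.tick k).current = a.current := rfl
@[simp] theorem tick_reported : (a.tick k).reported = a.reported := rfl
@[simp] theorem tick_time : (a.tick k).time = a.time + k := rfl
@[simp] theorem set_var : (a.set x i k).var y = if y = x then i else a.var y := by
  simp [set, Function.update_apply]
@[simp] theorem set_arr : (a.set x i k).arr = a.arr := rfl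
@[simp] theorem set_current : (a.set x i k).current = a.current := rfl
@[simp] theorem set_reported : (a.set x i k).reported = a.reported := rfl
@[simp] theorem set_time : (a.set x i k).time = a.time + k := rfl
@[simp] theorem put_var : (a.put r i b k).var = a.var := rfl
@[simp] theorem put_arr : (a.put r i b k).arr r' =
    if r' = r then Function.update (a.arr r) i b else a.arr r' := by
  by_cases h : r' = r
  · subst h; simp [put]
  · simp [put, h]
@[simp] theorem put_current : (a.put r i b k).current = a.current := rfl
@[simp] theorem put_reported : (a.put r i b k).reported = a.reported := rfl
@[simp] theorem put_time : (a.put r i b k).time = a.time + k := rfl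
@[simp] theorem ins_var : (a.ins x).var = a.var := rfl
@[simp] theorem ins_arr : (a.ins x).arr = a.arr := rfl
@[simp] theorem ins_current : (a.ins x).current = Insert.insert (a.var x) a.current := rfl
@[simp] theorem ins_reported : (a.ins x).reported = a.reported := rfl
@[simp] theorem ins_time : (a.ins x).time = a.time + 1 := rfl
@[simp] theorem rem_var : (a.rem x).var = a.var := rfl
@[simp] theorem rem_arr : (a.rem x).arr = a.arr := rfl
@[simp] theorem rem_current : (a.rem x).current = a.current.erase (a.var x) := rfl
@[simp] theorem rem_reported : (a.rem x).reported = a.reported := rfl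
@[simp] theorem rem_time : (a.rem x).time = a.time + 1 := rfl
@[simp] theorem rep_var : a.rep.var = a.var := rfl
@[simp] theorem rep_arr : a.rep.arr = a.arr := rfl
@[simp] theorem rep_current : a.rep.current = a.current := rfl
@[simp] theorem rep_reported : a.rep.reported = a.reported ++ [a.current] := rfl
@[simp] theorem rep_time : a.rep.time = a.time + 1 := rfl

end Ast

/-- Size and placement of the arrays in a memory of `W` words. -/
structure Layout where
  W : ℕ
  base : Arr → ℕ
  len : Arr → ℕ
  two_lt : 2 < W
  base_add_len_lt : ∀ r, base r + len r < W
  disj : ∀ r r' i i', i < len r → i' < len r' → base r + i = base r' + i' → r = r'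

/-- The machine state `s` represents the abstract state `a`. -/
structure Layout.Repr (Λ : Layout) (a : Ast) (s : State) : Prop where
  base : ∀ r : Arr, s.reg r.reg = Λ.base r
  var : ∀ x : Var, s.reg x.reg = a.var x
  mem : ∀ r i, i < Λ.len r → s.mem (Λ.base r + i) = a.arr r i
  current : s.current = a.current
  reported : s.reported = a.reported

inductive Expr where
  | lit (i : ℕ)
  | var (x : Var)
  | arr (r : Arr) (e : Expr)
  | add (e f : Expr)
  | sub (e f : Expr)

namespace Expr

@[simp] def eval (a : Ast) : Expr → ℕ
  | lit i => i
  | var x => a.var x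
  | arr r e => a.arr r (e.eval a)
  | add e f => e.eval a + f.eval a
  | sub e f => e.eval a - f.eval a

/-- The expression can be evaluated within the bounds of the arrays and of the word size. -/
@[simp] def ok (Λ : Layout) (a : Ast) : Expr → Prop
  | lit i => i ≤ 2
  | var _ => True
  | arr r e => e.ok Λ a ∧ e.eval a < Λ.len r
  | add e f => e.ok Λ a ∧ f.ok Λ a ∧ e.eval a + f.eval a < Λ.W
  | sub e f => e.ok Λ a ∧ f.ok Λ a

@[simp] def cost : Expr → ℕ
  | lit _ => 1
  | var _ => 1
  | arr _ e => e.cost + 2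
  | add e f => e.cost + (f.cost + 1)
  | sub e f => e.cost + (f.cost + 1)

/-- Code that leaves the value of the expression in register `t`. -/
def compile (t : ℕ) : Expr → Cmd
  | lit i => .const t i
  | var x => .copy t x.reg
  | arr r e => .seq (e.compile t) (.seq (.plus t r.reg t) (.load t t))
  | add e f => .seq (e.compile t) (.seq (f.compile (t + 1)) (.plus t t (t + 1)))
  | sub e f => .seq (e.compile t) (.seq (f.compile (t + 1)) (.minus t t (t + 1)))

/-- `s'` differs from `s` at most in registers from `t` on. -/
structure SameBelow (t : ℕ) (s s' : State) : Prop where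
  reg : ∀ x < t, s'.reg x = s.reg x
  mem : s'.mem = s.mem
  current : s'.current = s.current
  reported : s'.reported = s.reported

theorem SameBelow.trans {t t' : ℕ} {s s' s'' : State} (h : SameBelow t s s') (htt : t ≤ t')
    (h' : SameBelow t' s' s'') : SameBelow t s s'' :=
  ⟨fun x hx => (h'.reg x (hx.trans_le htt)).trans (h.reg x hx), h'.mem.trans h.mem,
    h'.current.trans h.current, h'.reported.trans h.reported⟩

theorem SameBelow.setReg (t x : ℕ) (s : State) : SameBelow t s (s.setReg t x) :=
  ⟨fun y hy => by simp [State.setReg, Function.update_of_ne hy.ne], rfl, rfl, rfl⟩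

theorem SameBelow.repr {Λ : Layout} {t : ℕ} {a : Ast} {s s' : State} (h : SameBelow t s s')
    (ht : tmp ≤ t) (hs : Λ.Repr a s) : Λ.Repr a s' where
  base r := by rw [h.reg _ (by have := r.reg_lt; simp only [tmp] at ht; omega), hs.base]
  var x := by rw [h.reg _ (x.reg_lt.trans_le ht), hs.var]
  mem r i hi := by rw [h.mem, hs.mem r i hi]
  current := by rw [h.current, hs.current]
  reported := by rw [h.reported, hs.reported]

/-- Operands are evaluated into consecutive registers, and code for register `t` leaves everything
below `t` alone; so the left operand survives the evaluation of the right one. -/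
theorem exec_compile {Λ : Layout} {a : Ast} (e : Expr) : ∀ {t : ℕ} {s : State}, tmp ≤ t →
    Λ.Repr a s → e.ok Λ a → ∃ s', Exec Λ.W (e.compile t) s e.cost s' ∧
      s'.reg t = e.eval a ∧ SameBelow t s s' := by
  induction e with
  | lit i =>
    intro t s ht hs hok
    exact ⟨_, .const _ _ _ (lt_of_le_of_lt hok Λ.two_lt), by simp [State.setReg],
      SameBelow.setReg _ _ _⟩
  | var x =>
    intro t s ht hs hok
    exact ⟨_, .copy _ _ _, by simp [State.setReg, hs.var], SameBelow.setReg _ _ _⟩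
  | arr r e ih =>
    intro t s ht hs hok
    obtain ⟨s₁, h1, h2, h3⟩ := ih ht hs hok.1
    have hr := (h3.repr ht hs).base r
    have hlt : Λ.base r + e.eval a < Λ.W := by
      have := Λ.base_add_len_lt r; have := hok.2; omega
    refine ⟨_, .seq h1 (.seq (.plus _ _ _ _ (by rw [hr, h2]; exact hlt)) (.load _ _ _ ?_)), ?_, ?_⟩
    · simpa [State.setReg, hr, h2] using hlt
    · simp only [State.setReg, Function.update_self, hr, h2, h3.mem]
      exact hs.mem r _ hok.2
    · exact h3.trans le_rfl ((SameBelow.setReg _ _ _).trans le_rfl (SameBelow.setReg _ _ _))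
  | add e f ihe ihf =>
    intro t s ht hs hok
    obtain ⟨s₁, h1, h2, h3⟩ := ihe ht hs hok.1
    obtain ⟨s₂, k1, k2, k3⟩ := ihf (ht.trans (Nat.le_succ t)) (h3.repr ht hs) hok.2.1
    have hr := k3.reg t (Nat.lt_succ_self t)
    refine ⟨_, .seq h1 (.seq k1 (.plus _ _ _ _ (by rw [hr, h2, k2]; exact hok.2.2))), ?_, ?_⟩
    · simp [State.setReg, hr, h2, k2]
    · exact h3.trans le_rfl ((⟨fun x hx => k3.reg x (hx.trans (Nat.lt_succ_self t)),
        k3.mem, k3.current, k3.reported⟩ : SameBelow t s₁ s₂).trans le_rfl (SameBelow.setReg _ _ _))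
  | sub e f ihe ihf =>
    intro t s ht hs hok
    obtain ⟨s₁, h1, h2, h3⟩ := ihe ht hs hok.1
    obtain ⟨s₂, k1, k2, k3⟩ := ihf (ht.trans (Nat.le_succ t)) (h3.repr ht hs) hok.2
    have hr := k3.reg t (Nat.lt_succ_self t)
    refine ⟨_, .seq h1 (.seq k1 (.minus _ _ _ _)), ?_, ?_⟩
    · simp [State.setReg, hr, h2, k2]
    · exact h3.trans le_rfl ((⟨fun x hx => k3.reg x (hx.trans (Nat.lt_succ_self t)),
        k3.mem, k3.current, k3.reported⟩ : SameBelow t s₁ s₂).trans le_rfl (SameBelow.setReg _ _ _))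

end Expr

inductive Cond where
  | lt (e f : Expr)
  | eq (e f : Expr)

namespace Cond

@[simp] def holds (a : Ast) : Cond → Prop
  | lt e f => e.eval a < f.eval a
  | eq e f => e.eval a = f.eval a

@[simp] def ok (Λ : Layout) (a : Ast) : Cond → Prop
  | lt e f => e.ok Λ a ∧ f.ok Λ a
  | eq e f => e.ok Λ a ∧ f.ok Λ a

/-- The time of evaluating both sides and testing. -/
@[simp] def cost : Cond → ℕ
  | lt e f => e.cost + f.cost + 1
  | eq e f => e.cost + f.cost + 1

def compile : Cond → Cmd
  | lt e f => .seq (e.compile tmp) (f.compile (tmp + 1))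
  | eq e f => .seq (e.compile tmp) (f.compile (tmp + 1))

def test : Cond → Test
  | lt _ _ => .lt tmp (tmp + 1)
  | eq _ _ => .eq tmp (tmp + 1)

theorem exec_compile {Λ : Layout} {a : Ast} {s : State} (c : Cond) (hs : Λ.Repr a s)
    (hok : c.ok Λ a) : ∃ t s', Exec Λ.W c.compile s t s' ∧ t + 1 = c.cost ∧ Λ.Repr a s' ∧
      (c.test.holds s' ↔ c.holds a) := by
  have key : ∀ e f : Expr, e.ok Λ a → f.ok Λ a → ∃ s',
      Exec Λ.W (.seq (e.compile tmp) (f.compile (tmp + 1))) s (e.cost + f.cost) s' ∧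
      Λ.Repr a s' ∧ s'.reg tmp = e.eval a ∧ s'.reg (tmp + 1) = f.eval a := by
    intro e f he hf
    obtain ⟨s₁, h1, h2, h3⟩ := e.exec_compile le_rfl hs he
    obtain ⟨s₂, k1, k2, k3⟩ := f.exec_compile (Nat.le_succ tmp) (h3.repr le_rfl hs) hf
    exact ⟨s₂, .seq h1 k1, k3.repr (Nat.le_succ _) (h3.repr le_rfl hs),
      (k3.reg _ (Nat.lt_succ_self _)).trans h2, k2⟩
  cases c with
  | lt e f =>
    obtain ⟨s', h1, h2, h3, h4⟩ := key e f hok.1 hok.2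
    exact ⟨_, s', h1, rfl, h2, by simp [test, Test.holds, h3, h4]⟩
  | eq e f =>
    obtain ⟨s', h1, h2, h3, h4⟩ := key e f hok.1 hok.2
    exact ⟨_, s', h1, rfl, h2, by simp [test, Test.holds, h3, h4]⟩

end Cond

inductive Prog where
  | skip
  | asg (x : Var) (e : Expr)
  | put (r : Arr) (e f : Expr)
  | ins (x : Var)
  | rem (x : Var)
  | report
  | seq (p q : Prog)
  | ite (c : Cond) (p q : Prog)
  | whl (c : Cond) (p : Prog)

infixr:60 " ;; " => Prog.seq

def Prog.compile : Prog → Cmd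
  | skip => .skip
  | asg x e => .seq (e.compile tmp) (.copy x.reg tmp)
  | put r e f => .seq (e.compile tmp) (.seq (.plus tmp r.reg tmp)
      (.seq (f.compile (tmp + 1)) (.store tmp (tmp + 1))))
  | ins x => .insert x.reg
  | rem x => .remove x.reg
  | report => .report
  | seq p q => .seq p.compile q.compile
  | ite c p q => .seq c.compile (.ite c.test p.compile q.compile)
  | whl c p => .seq c.compile (.while c.test (.seq p.compile c.compile))

namespace Layout

variable (Λ : Layout)

/-- Started in any machine state that represents `a`, the compiled program halts in a state that
represents some `a'` with `Q a'`, and the time spent is accounted for in `a'`. -/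
def wp (p : Prog) (Q : Ast → Prop) (a : Ast) : Prop :=
  ∀ s, Λ.Repr a s → ∃ t s' a', Exec Λ.W p.compile s t s' ∧ Λ.Repr a' s' ∧
    a.time + t ≤ a'.time ∧ Q a'

/-- Weakest precondition, computed along the program up to loops. -/
def vc : Prog → (Ast → Prop) → Ast → Prop
  | .skip, Q, a => Q (a.tick 1)
  | .asg x e, Q, a => e.ok Λ a ∧ Q (a.set x (e.eval a) (e.cost + 1))
  | .put r e f, Q, a => e.ok Λ a ∧ f.ok Λ a ∧ e.eval a < Λ.len r ∧
      Q (a.put r (e.eval a) (f.eval a) (e.cost + f.cost + 2))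
  | .ins x, Q, a => Q (a.ins x)
  | .rem x, Q, a => Q (a.rem x)
  | .report, Q, a => Q a.rep
  | .seq p q, Q, a => vc p (vc q Q) a
  | .ite c p q, Q, a => c.ok Λ a ∧ (c.holds a → vc p Q (a.tick c.cost)) ∧
      (¬ c.holds a → vc q Q (a.tick c.cost))
  | .whl c p, Q, a => Λ.wp (.whl c p) Q a

variable {Λ}

theorem wp_mono {p : Prog} {Q Q' : Ast → Prop} {a : Ast} (h : Λ.wp p Q a)
    (hQ : ∀ a', Q a' → Q' a') : Λ.wp p Q' a := by
  intro s hs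
  obtain ⟨t, s', a', h1, h2, h3, h4⟩ := h s hs
  exact ⟨t, s', a', h1, h2, h3, hQ _ h4⟩

theorem Repr.set {a : Ast} {s : State} (hs : Λ.Repr a s) (x : Var) (i k : ℕ) :
    Λ.Repr (a.set x i k) (s.setReg x.reg i) where
  base r := by
    have h1 := r.reg_lt
    have h2 := x.le_reg
    simp only [State.setReg]
    rw [Function.update_of_ne (by omega), hs.base]
  var y := by
    simp only [State.setReg, Ast.set_var]
    by_cases h : y = x
    · subst h; simp
    · rw [Function.update_of_ne (fun h' => h (Var.reg_injective h')), hs.var, if_neg h]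
  mem := hs.mem
  current := hs.current
  reported := hs.reported

theorem Repr.put {a : Ast} {s : State} (hs : Λ.Repr a s) {r : Arr} {i : ℕ} (hi : i < Λ.len r)
    (b k : ℕ) : Λ.Repr (a.put r i b k) (s.setMem (Λ.base r + i) b) where
  base := hs.base
  var := hs.var
  mem r' i' hi' := by
    simp only [State.setMem, Ast.put_arr]
    by_cases h : r' = r
    · subst h
      by_cases h' : i' = i
      · subst h'; simp
      · rw [Function.update_of_ne (by omega), if_pos rfl, Function.update_of_ne h', hs.mem _ _ hi']
    · rw [Function.update_of_ne (fun h' => h (Λ.disj _ _ _ _ hi' hi h')), if_neg h, hs.mem _ _ hi']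
  current := hs.current
  reported := hs.reported

theorem wp_whl_true {c : Cond} {p : Prog} {Q : Ast → Prop} {a : Ast} (hok : c.ok Λ a)
    (hc : c.holds a) (h : Λ.wp p (Λ.wp (.whl c p) Q) (a.tick c.cost)) :
    Λ.wp (.whl c p) Q a := by
  intro s hs
  obtain ⟨t₁, s₁, h1, h2, h3, h4⟩ := c.exec_compile hs hok
  have h3' : Λ.Repr (a.tick c.cost) s₁ := ⟨h3.1, h3.2, h3.3, h3.4, h3.5⟩
  obtain ⟨t₂, s₂, a₂, k1, k2, k3, k4⟩ := h s₁ h3'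
  obtain ⟨t₃, s₃, a₃, l1, l2, l3, l4⟩ := k4 s₂ k2
  rw [Prog.compile] at l1
  -- The compiled loop evaluates its condition once in front and again at the end of every
  -- iteration. The evaluation that opens the remaining loop is therefore regrouped as the end of
  -- the present iteration.
  cases l1 with
  | seq m1 m2 =>
    refine ⟨_, s₃, a₃, .seq h1 (.whileTrue (h4.2 hc) (.seq k1 m1) m2), l2, ?_, l4⟩
    simp only [Ast.tick_time] at k3
    omega

theorem wp_whl_false {c : Cond} {p : Prog} {Q : Ast → Prop} {a : Ast} (hok : c.ok Λ a)
    (hc : ¬ c.holds a) (h : Q (a.tick c.cost)) : Λ.wp (.whl c p) Q a := by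
  intro s hs
  obtain ⟨t₁, s₁, h1, h2, h3, h4⟩ := c.exec_compile hs hok
  refine ⟨_, s₁, a.tick c.cost, .seq h1 (.whileFalse (mt h4.1 hc)), ⟨h3.1, h3.2, h3.3, h3.4, h3.5⟩, ?_, h⟩
  simp only [Ast.tick_time]
  omega

/-- This is the bridge to the machine: straight-line code is verified by unfolding `vc`, and only
loops need an argument about executions. -/
theorem wp_of_vc {p : Prog} : ∀ {Q : Ast → Prop} {a : Ast}, Λ.vc p Q a → Λ.wp p Q a := by
  induction p with
  | skip => exact fun {Q a} h s hs =>
    ⟨_, s, a.tick 1, .skip s, ⟨hs.1, hs.2, hs.3, hs.4, hs.5⟩, le_rfl, h⟩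
  | asg x e =>
    rintro Q a ⟨h1, h2⟩ s hs
    obtain ⟨s₁, k1, k2, k3⟩ := e.exec_compile le_rfl hs h1
    refine ⟨_, _, _, .seq k1 (.copy _ _ _), ?_, le_rfl, h2⟩
    rw [k2]
    exact (k3.repr le_rfl hs).set _ _ _
  | put r e f =>
    rintro Q a ⟨h1, h2, h3, h4⟩ s hs
    obtain ⟨s₁, k1, k2, k3⟩ := e.exec_compile le_rfl hs h1
    have hr := (k3.repr le_rfl hs).base r
    have hlt : Λ.base r + e.eval a < Λ.W := by
      have := Λ.base_add_len_lt r; omega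
    have h' := Expr.SameBelow.setReg tmp (s₁.reg r.reg + s₁.reg tmp) s₁
    obtain ⟨s₂, l1, l2, l3⟩ :=
      f.exec_compile (Nat.le_succ tmp) (h'.repr le_rfl (k3.repr le_rfl hs)) h2
    have ht : s₂.reg tmp = Λ.base r + e.eval a := by
      rw [l3.reg _ (Nat.lt_succ_self _), hr, k2]; simp [State.setReg]
    refine ⟨_, _, _, .seq k1 (.seq (.plus _ _ _ _ (by rw [hr, k2]; exact hlt))
      (.seq l1 (.store _ _ _ (by rw [ht]; exact hlt)))), ?_, ?_, h4⟩
    · rw [ht, l2]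
      exact (l3.repr (Nat.le_succ _) (h'.repr le_rfl (k3.repr le_rfl hs))).put h3 _ _
    · simp only [Ast.put_time]; omega
  | ins x =>
    intro Q a h s hs
    refine ⟨_, _, a.ins x, .insert s _, ⟨hs.1, hs.2, hs.3, ?_, hs.5⟩, le_rfl, h⟩
    simp [hs.current, hs.var]
  | rem x =>
    intro Q a h s hs
    refine ⟨_, _, a.rem x, .remove s _, ⟨hs.1, hs.2, hs.3, ?_, hs.5⟩, le_rfl, h⟩
    simp [hs.current, hs.var]
  | report =>
    intro Q a h s hs
    refine ⟨_, _, a.rep, .report s, ⟨hs.1, hs.2, hs.3, hs.4, ?_⟩, le_rfl, h⟩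
    simp [hs.current, hs.reported]
  | seq p q ihp ihq =>
    intro Q a h s hs
    obtain ⟨t₁, s₁, a₁, k1, k2, k3, k4⟩ := ihp h s hs
    obtain ⟨t₂, s₂, a₂, l1, l2, l3, l4⟩ := ihq k4 s₁ k2
    exact ⟨_, _, a₂, .seq k1 l1, l2, by omega, l4⟩
  | ite c p q ihp ihq =>
    rintro Q a ⟨hok, h1, h2⟩ s hs
    obtain ⟨t₁, s₁, k1, k2, k3, k4⟩ := c.exec_compile hs hok
    have k3' : Λ.Repr (a.tick c.cost) s₁ := ⟨k3.1, k3.2, k3.3, k3.4, k3.5⟩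
    by_cases hc : c.holds a
    · obtain ⟨t₂, s₂, a₂, l1, l2, l3, l4⟩ := ihp (h1 hc) s₁ k3'
      refine ⟨_, _, a₂, .seq k1 (.iteTrue (k4.2 hc) l1), l2, ?_, l4⟩
      simp only [Ast.tick_time] at l3
      omega
    · obtain ⟨t₂, s₂, a₂, l1, l2, l3, l4⟩ := ihq (h2 hc) s₁ k3'
      refine ⟨_, _, a₂, .seq k1 (.iteFalse (mt k4.1 hc) l1), l2, ?_, l4⟩
      simp only [Ast.tick_time] at l3
      omega
  | whl c p _ => exact fun h => h

theorem vc_mono {p : Prog} : ∀ {Q Q' : Ast → Prop} {a : Ast}, Λ.vc p Q a →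
    (∀ a', Q a' → Q' a') → Λ.vc p Q' a := by
  induction p with
  | seq p q ihp ihq => exact fun h hQ => ihp h fun a' h' => ihq h' hQ
  | ite c p q ihp ihq =>
    exact fun h hQ => ⟨h.1, fun hc => ihp (h.2.1 hc) hQ, fun hc => ihq (h.2.2 hc) hQ⟩
  | whl c p _ => exact fun h hQ => wp_mono h hQ
  | asg x e => exact fun h hQ => ⟨h.1, hQ _ h.2⟩
  | put r e f => exact fun h hQ => ⟨h.1, h.2.1, h.2.2.1, hQ _ h.2.2.2⟩
  | _ => exact fun h hQ => hQ _ h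

/-- A loop with an invariant indexed by the number of completed iterations. -/
theorem wp_whl_index {c : Cond} {p : Prog} {Q : Ast → Prop} {a : Ast} (I : ℕ → Ast → Prop)
    {j m : ℕ} (hjm : j ≤ m) (h0 : I j a)
    (step : ∀ i, j ≤ i → i < m → ∀ b, I i b →
      c.ok Λ b ∧ c.holds b ∧ Λ.vc p (I (i + 1)) (b.tick c.cost))
    (fin : ∀ b, I m b → c.ok Λ b ∧ ¬ c.holds b ∧ Q (b.tick c.cost)) :
    Λ.wp (.whl c p) Q a := by
  induction hd : m - j generalizing j a with
  | zero =>
    obtain rfl : j = m := by omega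
    obtain ⟨h1, h2, h3⟩ := fin a h0
    exact wp_whl_false h1 h2 h3
  | succ d ih =>
    obtain ⟨h1, h2, h3⟩ := step j le_rfl (by omega) a h0
    refine wp_whl_true h1 h2 (wp_of_vc (vc_mono h3 fun b hb => ?_))
    exact ih (by omega) hb (fun i hi => step i (by omega)) (by omega)

end Layout

/-- The list `l` is stored in consecutive places from `lo` on. -/
def Seg {n : ℕ} (A : ℕ → ℕ) (lo : ℕ) (l : List (Fin n)) : Prop :=
  ∀ j (h : j < l.length), A (lo + j) = l[j]

/-- For every entry of an array between the index `i` and the index `h`. -/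
def Prog.each (i h x : Var) (r : Arr) (p : Prog) : Prog :=
  .whl (.lt (.var i) (.var h))
    (.asg x (.arr r (.var i)) ;; p ;; .asg i (.add (.var i) (.lit 1)))

/-- The invariant refers to the part of the list that has been processed. The body must preserve the
counter, the bound and the array that is read. -/
theorem Layout.wp_each {Λ : Layout} {n : ℕ} {i h x : Var} {r : Arr} {p : Prog} {Q : Ast → Prop}
    {a : Ast} (l : List (Fin n)) (I : List (Fin n) → Ast → Prop) (hih : i ≠ h)
    (hi : a.var h = a.var i + l.length) (hl : Seg (a.arr r) (a.var i) l)
    (hlen : a.var i + l.length ≤ Λ.len r) (h0 : I [] a)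
    (step : ∀ (l₁ : List (Fin n)) (y : Fin n) (l₂ : List (Fin n)), l = l₁ ++ y :: l₂ → ∀ b, I l₁ b → b.var i = a.var i + l₁.length →
      Λ.vc p (fun b' => b'.var i = b.var i ∧ b'.var h = b.var h ∧ b'.arr r = b.arr r ∧
        I (l₁ ++ [y]) (b'.set i (a.var i + l₁.length + 1) 4)) ((b.tick 3).set x y 4))
    (fin : ∀ b, I l b → Q (b.tick 3)) : Λ.wp (.each i h x r p) Q a := by
  refine wp_whl_index (m := l.length) (j := 0)
    (fun j b => b.var i = a.var i + j ∧ b.var h = a.var h ∧ b.arr r = a.arr r ∧ I (l.take j) b)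
    (Nat.zero_le _) ⟨rfl, rfl, rfl, by simpa using h0⟩ ?_ ?_
  · rintro j - hj b ⟨h1, h2, h3, h4⟩
    have hsplit : l = l.take j ++ l[j] :: l.drop (j + 1) := by simp
    have hlj : (l.take j).length = j := by simp; omega
    have := step _ _ _ hsplit b h4 (by rw [hlj, h1])
    have hW := Λ.base_add_len_lt r
    refine ⟨by simp, by simp [h1, h2, hi, hj], ?_⟩
    simp only [vc, Expr.ok, Expr.eval, true_and, Ast.tick_var, Ast.tick_arr, Cond.cost, Expr.cost]
    refine ⟨by omega, ?_⟩
    rw [h1, h3, hl j hj]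
    refine vc_mono this ?_
    rintro b' ⟨k1, k2, k3, k4⟩
    refine ⟨⟨by omega, by omega⟩, ?_⟩
    rw [k1, h1]
    refine ⟨by simp [add_assoc], ?_, ?_, ?_⟩
    · simp [hih.symm, k2, h2]
    · simp [k3, h3]
    · rw [hlj] at k4
      rwa [List.take_succ_eq_append_getElem hj]
  · rintro b ⟨h1, h2, h3, h4⟩
    refine ⟨by simp, by simp [h1, h2, hi], ?_⟩
    exact fin b (by simpa using h4)

/-! ## The enumeration program -/

/-- `b` differs from `a` only in the variables `vs` and the arrays `rs`, and at most `k` time units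
have passed. -/
structure Frame (vs : List Var) (rs : List Arr) (k : ℕ) (a b : Ast) : Prop where
  var : ∀ x, x ∉ vs → b.var x = a.var x
  arr : ∀ r, r ∉ rs → b.arr r = a.arr r
  current : b.current = a.current
  reported : b.reported = a.reported
  time : b.time ≤ a.time + k

theorem Frame.trans {vs vs' vs'' : List Var} {rs rs' rs'' : List Arr} {k k' : ℕ} {a b c : Ast}
    (h : Frame vs rs k a b) (h' : Frame vs' rs' k' b c) (hv : ∀ x, x ∈ vs ∨ x ∈ vs' → x ∈ vs'')
    (hr : ∀ r, r ∈ rs ∨ r ∈ rs' → r ∈ rs'') : Frame vs'' rs'' (k + k') a c where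
  var x hx := (h'.var x fun h => hx (hv x (Or.inr h))).trans
    (h.var x fun h => hx (hv x (Or.inl h)))
  arr r hx := (h'.arr r fun h => hx (hr r (Or.inr h))).trans
    (h.arr r fun h => hx (hr r (Or.inl h)))
  current := h'.current.trans h.current
  reported := h'.reported.trans h.reported
  time := by have := h.time; have := h'.time; omega

theorem Frame.mono {vs : List Var} {rs : List Arr} {k k' : ℕ} {a b : Ast}
    (h : Frame vs rs k a b) (hk : k ≤ k') : Frame vs rs k' a b :=
  ⟨h.var, h.arr, h.current, h.reported, h.time.trans (by omega)⟩

namespace Ast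

theorem set_set (a : Ast) (x : Var) (i j k l : ℕ) :
    (a.set x i k).set x j l = a.set x j (k + l) := by
  simp [set, add_assoc]

theorem set_tick (a : Ast) (x : Var) (i k l : ℕ) : (a.set x i k).tick l = a.set x i (k + l) := by
  simp [set, tick, add_assoc]

end Ast

/-- The arrays with one entry for each vertex have space for `n + 1` entries. -/
structure Layout.Fits (Λ : Layout) (n : ℕ) : Prop where
  lt_len : ∀ r, r ≠ .up → n < Λ.len r
  lt_W : 3 * n + 3 < Λ.W

/-- The arrays `cnt` and `sum` hold the sizes and the sums modulo `n` of the sets `A w`. -/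
structure Counts {n : ℕ} (a : Ast) (A : Fin n → Finset (Fin n)) : Prop where
  cnt : ∀ w : Fin n, a.arr .cnt w = (A w).card
  sum : ∀ w : Fin n, a.arr .sum w = (∑ x ∈ A w, (x : ℕ)) % n

theorem Counts.congr {n : ℕ} {a b : Ast} {A : Fin n → Finset (Fin n)} (h : Counts a A)
    (h1 : b.arr .cnt = a.arr .cnt) (h2 : b.arr .sum = a.arr .sum) : Counts b A :=
  ⟨fun w => by rw [h1, h.cnt], fun w => by rw [h2, h.sum]⟩

/-- `t := (sum[y] - v) mod n` -/
def subMod (y : Var) : Prog :=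
  .asg .t (.sub (.add (.arr .sum (.var y)) (.var .n)) (.var .v)) ;;
  .ite (.lt (.var .t) (.var .n)) .skip (.asg .t (.sub (.var .t) (.var .n)))

/-- `t := (sum[y] + v) mod n` -/
def addMod (y : Var) : Prog :=
  .asg .t (.add (.arr .sum (.var y)) (.var .v)) ;;
  .ite (.lt (.var .t) (.var .n)) .skip (.asg .t (.sub (.var .t) (.var .n)))

/-- Remove `v` from the set counted at `y`. -/
def decr (y : Var) : Prog :=
  subMod y ;; .put .cnt (.var y) (.sub (.arr .cnt (.var y)) (.lit 1)) ;; .put .sum (.var y) (.var .t)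

/-- Insert `v` into the set counted at `y`. -/
def incr (y : Var) : Prog :=
  addMod y ;; .put .cnt (.var y) (.add (.arr .cnt (.var y)) (.lit 1)) ;; .put .sum (.var y) (.var .t)

/-- The machine has no division; for a sum of two residues one conditional subtraction is enough. -/
theorem add_mod_eq {n q v : ℕ} (hq : q < n) (hv : v < n) :
    (q + v) % n = if q + v < n then q + v else q + v - n := by
  split_ifs with h
  · exact Nat.mod_eq_of_lt h
  · rw [Nat.mod_eq_sub_mod (by omega), Nat.mod_eq_of_lt (by omega)]

section Blocks

variable {Λ : Layout} {n : ℕ} {a : Ast} {Q : Ast → Prop}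

/-- Adding `n` before subtracting keeps the truncated subtraction exact; the intermediate value is
`q` or `q + n`. -/
theorem vc_subMod {y : Var} {q : ℕ} (hF : Λ.Fits n) (hn : a.var .n = n) (hv : a.var .v < n)
    (hy : a.var y < n) (hq : q < n) (hs : a.arr .sum (a.var y) = (q + a.var .v) % n)
    (hQ : ∀ k ≤ 15, Q (a.set .t q k)) : Λ.vc (subMod y) Q a := by
  have h1 := hF.lt_len .sum (by simp)
  have h2 := hF.lt_W
  have h3 := add_mod_eq hq hv
  have h4 : (q + a.var .v) % n < n := Nat.mod_lt _ (by omega)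
  simp only [subMod, Layout.vc, Expr.ok, Expr.eval, Ast.set_var, Cond.ok, Cond.holds, hn, hs,
    reduceCtorEq, if_true, if_false, Ast.set_tick, Ast.set_set, true_and, and_true]
  refine ⟨by omega, fun h => ?_, fun h => ?_⟩
  · convert hQ _ _ using 2
    · split_ifs at h3 <;> omega
    · simp
  · convert hQ _ _ using 2
    · split_ifs at h3 <;> omega
    · simp

theorem vc_addMod {y : Var} {q : ℕ} (hF : Λ.Fits n) (hn : a.var .n = n) (hv : a.var .v < n)
    (hy : a.var y < n) (hq : q < n) (hs : a.arr .sum (a.var y) = q)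
    (hQ : ∀ k ≤ 15, Q (a.set .t ((q + a.var .v) % n) k)) : Λ.vc (addMod y) Q a := by
  have h1 := hF.lt_len .sum (by simp)
  have h2 := hF.lt_W
  have h3 := add_mod_eq hq hv
  simp only [addMod, Layout.vc, Expr.ok, Expr.eval, Ast.set_var, Cond.ok, Cond.holds, hn, hs,
    reduceCtorEq, if_true, if_false, Ast.set_tick, Ast.set_set, true_and, and_true]
  refine ⟨by omega, fun h => ?_, fun h => ?_⟩
  · convert hQ _ _ using 2
    · split_ifs at h3; omega
    · simp
  · convert hQ _ _ using 2
    · split_ifs at h3; omega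
    · simp

/-- `op` changes the set counted at a vertex by `f`, provided that it satisfies `P`. -/
def IsOp (Λ : Layout) {n : ℕ} (v : Fin n) (op : Var → Prog) (P : Finset (Fin n) → Prop)
    (f : Finset (Fin n) → Finset (Fin n)) : Prop :=
  ∀ (y : Var) (a : Ast) (A : Fin n → Finset (Fin n)) (w : Fin n) (Q : Ast → Prop), y ≠ .t →
    a.var .n = n → a.var .v = v → a.var y = w → Counts a A → P (A w) →
    (∀ b, Frame [.t] [.cnt, .sum] 40 a b → Counts b (Function.update A w (f (A w))) → Q b) →
    Λ.vc (op y) Q a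

theorem isOp_decr (hF : Λ.Fits n) (v : Fin n) :
    IsOp Λ v decr (fun S => v ∈ S) fun S => S.erase v := by
  intro y a A w Q hyt hn hv hy hA hP hQ
  have hn0 : 0 < n := v.pos
  have h1 := hF.lt_len .sum (by simp)
  have h2 := hF.lt_len .cnt (by simp)
  have hw := w.2
  rw [decr, Layout.vc]
  refine vc_subMod (q := (∑ x ∈ (A w).erase v, (x : ℕ)) % n) hF hn (by rw [hv]; exact v.2)
    (by rw [hy]; exact w.2) (Nat.mod_lt _ hn0) ?_ ?_
  · rw [hy, hA.sum, hv, Nat.mod_add_mod, Finset.sum_erase_add _ _ hP]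
  · intro k hk
    simp only [Layout.vc, Expr.ok, Expr.eval, Ast.set_var, Ast.set_arr, Ast.put_var, hyt,
      if_false, hy, if_true]
    refine ⟨trivial, ⟨⟨trivial, by omega⟩, by norm_num⟩, by omega, trivial, trivial, by omega,
      hQ _ ⟨?_, ?_, rfl, rfl, ?_⟩ ⟨?_, ?_⟩⟩
    · intro x hx
      simp only [List.mem_cons, List.not_mem_nil, or_false] at hx
      simp [hx]
    · intro r hr
      simp only [List.mem_cons, List.not_mem_nil, or_false, not_or] at hr
      simp [hr]
    · simp; omega
    · intro w'
      by_cases h : w' = w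
      · subst h; simp [hA.cnt, Finset.card_erase_of_mem hP]
      · simp [Function.update_of_ne (fun h' => h (Fin.ext h')), h, hA.cnt]
    · intro w'
      by_cases h : w' = w
      · subst h; simp
      · simp [Function.update_of_ne (fun h' => h (Fin.ext h')), h, hA.sum]

theorem isOp_incr (hF : Λ.Fits n) (v : Fin n) :
    IsOp Λ v incr (fun S => v ∉ S) fun S => insert v S := by
  intro y a A w Q hyt hn hv hy hA hP hQ
  have hn0 : 0 < n := v.pos
  have h1 := hF.lt_len .sum (by simp)
  have h2 := hF.lt_len .cnt (by simp)
  have h3 := hF.lt_W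
  have hw := w.2
  have hc : (A w).card ≤ n := by simpa using Finset.card_le_univ (A w)
  rw [incr, Layout.vc]
  refine vc_addMod (q := (∑ x ∈ A w, (x : ℕ)) % n) hF hn (by rw [hv]; exact v.2)
    (by rw [hy]; exact w.2) (Nat.mod_lt _ hn0) ?_ ?_
  · rw [hy, hA.sum]
  · intro k hk
    simp only [Layout.vc, Expr.ok, Expr.eval, Ast.set_var, Ast.set_arr, Ast.put_var, hyt,
      if_false, hy, if_true, hA.cnt]
    refine ⟨trivial, ⟨⟨trivial, by omega⟩, by norm_num, by omega⟩, by omega, trivial, trivial,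
      by omega, hQ _ ⟨?_, ?_, rfl, rfl, ?_⟩ ⟨?_, ?_⟩⟩
    · intro x hx
      simp only [List.mem_cons, List.not_mem_nil, or_false] at hx
      simp [hx]
    · intro r hr
      simp only [List.mem_cons, List.not_mem_nil, or_false, not_or] at hr
      simp [hr]
    · simp; omega
    · intro w'
      by_cases h : w' = w
      · subst h; simp [Finset.card_insert_of_notMem hP]
      · simp [Function.update_of_ne (fun h' => h (Fin.ext h')), h, hA.cnt]
    · intro w'
      by_cases h : w' = w
      · subst h; simp [Finset.sum_insert hP, hv, add_comm]
      · simp [Function.update_of_ne (fun h' => h (Fin.ext h')), h, hA.sum]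

end Blocks

/-- The arrays `ups` and `up` hold the lists `U v`. -/
structure Static {n : ℕ} (Λ : Layout) (U : Fin n → List (Fin n)) (a : Ast) : Prop where
  var_n : a.var .n = n
  succ : ∀ v : Fin n, a.arr .ups (v + 1) = a.arr .ups v + (U v).length
  le : ∀ v : Fin n, a.arr .ups v + (U v).length ≤ Λ.len .up
  seg : ∀ v : Fin n, Seg (a.arr .up) (a.arr .ups v) (U v)

theorem Static.congr {n : ℕ} {Λ : Layout} {U : Fin n → List (Fin n)} {a b : Ast}
    (h : Static Λ U a) (h1 : b.var .n = a.var .n) (h2 : b.arr .ups = a.arr .ups)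
    (h3 : b.arr .up = a.arr .up) : Static Λ U b :=
  ⟨h1.trans h.var_n, by rw [h2]; exact h.succ, by rw [h2]; exact h.le, by rw [h2, h3]; exact h.seg⟩

/-- For every entry of the list `U y`. -/
def eachUp (i h x y : Var) (p : Prog) : Prog :=
  .asg i (.arr .ups (.var y)) ;; .asg h (.arr .ups (.add (.var y) (.lit 1))) ;; .each i h x .up p

/-- If `v` occurs in the list `U u`, apply `op` at `u`. -/
def opAt (op : Var → Prog) : Prog :=
  eachUp .i' .h' .x .u (.ite (.eq (.var .x) (.var .v)) (op .u) .skip)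

/-- Apply `op` at all members of `U v`. -/
def opUp (op : Var → Prog) : Prog := eachUp .i .h .w .v (op .w)

/-- Give the mark `k` to each vertex that, together with `v`, forms one of the counted sets of
two elements at the members of `U v`. -/
def markUp (k : ℕ) : Prog :=
  eachUp .i .h .w .v (.ite (.eq (.arr .cnt (.var .w)) (.lit 2))
    (subMod .w ;; .put .mark (.var .t) (.lit k)) .skip)

section Loops

variable {Λ : Layout} {n : ℕ} {a : Ast} {Q : Ast → Prop} {U : Fin n → List (Fin n)}

/-- A version of `Layout.wp_each` with frames: one iteration costs `c` for the body and 11 for test,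
reading and increment. -/
theorem vc_each {i h x : Var} {r : Arr} {p : Prog} {l : List (Fin n)}
    {vs vs' : List Var} {rs : List Arr} {c : ℕ}
    (hvs : ∀ z, z = i ∨ z = x ∨ z ∈ vs' → z ∈ vs) (hi' : i ∉ vs') (hh' : h ∉ vs')
    (hr : r ∉ rs) (hih : i ≠ h) (hxi : x ≠ i) (hxh : x ≠ h)
    (hlo : a.var h = a.var i + l.length) (hseg : Seg (a.arr r) (a.var i) l)
    (hle : a.var i + l.length ≤ Λ.len r)
    (J : List (Fin n) → Ast → Prop) (hJ : ∀ l b b', b'.arr = b.arr →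
      (∀ z, z ≠ i → z ≠ x → b'.var z = b.var z) → J l b → J l b')
    (h0 : J [] a)
    (step : ∀ (l₁ : List (Fin n)) (z : Fin n) (l₂ : List (Fin n)), l = l₁ ++ z :: l₂ →
      ∀ b k, Frame vs rs k a b → J l₁ b → b.var x = z →
      Λ.vc p (fun b' => Frame vs' rs c b b' ∧ J (l₁ ++ [z]) b') b)
    (fin : ∀ b, Frame vs rs (3 + (c + 11) * l.length) a b → J l b → Q b) :
    Λ.vc (.each i h x r p) Q a := by
  have hiv := hvs i (by simp)
  have hxv := hvs x (by simp)
  refine Layout.wp_each l (fun l b => Frame vs rs ((c + 11) * l.length) a b ∧ J l b) hih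
    hlo hseg hle ⟨⟨fun _ _ => rfl, fun _ _ => rfl, rfl, rfl, by simp⟩, h0⟩ ?_ ?_
  · rintro l₁ z l₂ hl b ⟨hb, hJb⟩ hbi
    have hfr : Frame vs rs ((c + 11) * l₁.length + 7) a ((b.tick 3).set x z 4) := by
      refine ⟨fun w hw => ?_, fun r hr => ?_, hb.current, hb.reported, ?_⟩
      · have : w ≠ x := by rintro rfl; exact hw hxv
        simp [this, hb.var w hw]
      · simp [hb.arr r hr]
      · have := hb.time; simp; omega
    refine Layout.vc_mono (step l₁ z l₂ hl _ _ hfr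
      (hJ _ b _ rfl (fun w _ hw => by simp [hw]) hJb) (by simp)) ?_
    rintro b' ⟨hb', hJ'⟩
    refine ⟨?_, ?_, ?_, ?_, hJ _ b' _ rfl (fun w hw _ => by simp [hw]) hJ'⟩
    · rw [hb'.var i hi']; simp [hxi.symm]
    · rw [hb'.var h hh']; simp [hxh.symm]
    · rw [hb'.arr _ hr]; simp
    · have := hfr.trans hb' (vs'' := vs) (rs'' := rs)
        (fun z hz => hz.elim id fun h => hvs z (by simp [h])) (fun r hr => hr.elim id id)
      refine ⟨fun w hw => ?_, fun r hr => ?_, this.current, this.reported, ?_⟩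
      · have hwi : w ≠ i := by rintro rfl; exact hw hiv
        simp [hwi, this.var w hw]
      · simp [this.arr r hr]
      · have := this.time
        simp only [Ast.set_time, List.length_append, List.length_singleton, mul_add]
        omega
  · rintro b ⟨hb, hJb⟩
    refine fin _ ⟨fun w hw => ?_, fun r hr => ?_, hb.current, hb.reported, ?_⟩
      (hJ _ b _ rfl (fun w _ _ => rfl) hJb)
    · simp [hb.var w hw]
    · simp [hb.arr r hr]
    · have := hb.time; simp only [Ast.tick_time]; omega

theorem vc_eachUp (hF : Λ.Fits n) (hS : Static Λ U a) {i h x y : Var} {p : Prog} {v : Fin n}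
    (hy : a.var y = v) {vs vs' : List Var} {rs : List Arr} {c : ℕ}
    (hvs : ∀ z, z = i ∨ z = h ∨ z = x ∨ z ∈ vs' → z ∈ vs) (hi' : i ∉ vs') (hh' : h ∉ vs')
    (hup : Arr.up ∉ rs) (hih : i ≠ h) (hyi : y ≠ i) (hxi : x ≠ i) (hxh : x ≠ h)
    (J : List (Fin n) → Ast → Prop) (hJ : ∀ l b b', b'.arr = b.arr → J l b → J l b')
    (h0 : J [] a)
    (step : ∀ (l₁ : List (Fin n)) (z : Fin n) (l₂ : List (Fin n)), U v = l₁ ++ z :: l₂ →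
      ∀ b k, Frame vs rs k a b → J l₁ b → b.var x = z →
      Λ.vc p (fun b' => Frame vs' rs c b b' ∧ J (l₁ ++ [z]) b') b)
    (fin : ∀ b, Frame vs rs (15 + (c + 11) * (U v).length) a b → J (U v) b → Q b) :
    Λ.vc (eachUp i h x y p) Q a := by
  have h1 := hF.lt_len .ups (by simp)
  have h2 := hF.lt_W
  have hv := v.2
  have hiv := hvs i (by simp)
  have hhv := hvs h (by simp)
  simp only [eachUp, Layout.vc, Expr.ok, Expr.eval, Expr.cost, hy, Ast.set_var, Ast.set_arr, hyi,
    if_false, true_and]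
  refine ⟨by omega, ⟨⟨by omega, by omega⟩, by omega⟩, ?_⟩
  have hfr : Frame vs rs 12 a ((a.set i (a.arr .ups v) (1 + 2 + 1)).set h (a.arr .ups (v + 1))
      (1 + (1 + 1) + 2 + 1)) := by
    refine ⟨fun z hz => ?_, fun r hr => by simp, rfl, rfl, by simp⟩
    have hz1 : z ≠ i := by rintro rfl; exact hz hiv
    have hz2 : z ≠ h := by rintro rfl; exact hz hhv
    simp [hz1, hz2]
  refine vc_each (l := U v) (c := c) (fun z hz => hvs z (by tauto)) hi' hh' hup hih hxi hxh ?_ ?_ ?_ J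
    (fun l b b' hb _ => hJ l b b' hb) (hJ _ a _ rfl h0) ?_ ?_
  · simp [hih, hS.succ]
  · simp only [Ast.set_var, hih, if_false, if_true, Ast.set_arr]
    exact hS.seg v
  · simp only [Ast.set_var, hih, if_false, if_true]
    exact hS.le v
  · exact fun l₁ z l₂ hl b k hb => step l₁ z l₂ hl b _
      (hfr.trans hb (fun _ h => h.elim id id) fun _ h => h.elim id id)
  · intro b hb
    exact fin b ((hfr.trans hb (fun _ h => h.elim id id) fun _ h => h.elim id id).mono (by omega))

theorem vc_opAt (hF : Λ.Fits n) (hS : Static Λ U a) {op : Var → Prog} {P : Finset (Fin n) → Prop}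
    {f : Finset (Fin n) → Finset (Fin n)} {v u : Fin n} (hop : IsOp Λ v op P f)
    {A : Fin n → Finset (Fin n)} (hA : Counts a A) (hu : a.var .u = u) (hv : a.var .v = v)
    (hnd : (U u).Nodup) (hP : v ∈ U u → P (A u))
    (fin : ∀ b, Frame [.i', .h', .x, .t] [.cnt, .sum] (15 + 60 * (U u).length) a b →
      Counts b (if v ∈ U u then Function.update A u (f (A u)) else A) → Q b) :
    Λ.vc (opAt op) Q a := by
  -- 49 for the body and 11 for the loop make up the 60 per list entry.
  refine vc_eachUp hF hS hu (vs' := [.t]) (c := 49) (by simp) (by simp) (by simp)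
    (by simp) (by simp) (by simp) (by simp) (by simp)
    (fun l b => Counts b (if v ∈ l then Function.update A u (f (A u)) else A))
    (fun l b b' h hb => hb.congr (by rw [h]) (by rw [h])) (by simpa using hA) ?_ fin
  intro l₁ z l₂ hl b k hb hJ hz
  have hbv : b.var .v = v := by rw [hb.var _ (by simp), hv]
  have hbu : b.var .u = u := by rw [hb.var _ (by simp), hu]
  simp only [Layout.vc, Cond.ok, Expr.ok, Cond.holds, Expr.eval, hz, hbv, true_and]
  refine ⟨fun h => ?_, fun h => ?_⟩
  · have hzv : z = v := Fin.ext h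
    subst hzv
    have hn : z ∉ l₁ := fun h => by
      rw [hl, List.nodup_append] at hnd
      exact hnd.2.2 _ h _ (by simp) rfl
    rw [if_neg hn] at hJ
    refine hop .u _ A u _ (by simp) (by simp [hb.var, hS.var_n]) (by simp [hbv]) (by simp [hbu])
      (hJ.congr rfl rfl) (hP (by rw [hl]; simp)) ?_
    intro b' hb' hA'
    refine ⟨⟨fun x hx => by simpa using hb'.var x hx, fun r hr => by simpa using hb'.arr r hr,
      hb'.current, hb'.reported, ?_⟩, by simpa using hA'⟩
    have := hb'.time
    simp only [Ast.tick_time, Cond.cost, Expr.cost] at this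
    omega
  · have hzv : v ≠ z := fun h' => h (by rw [h'])
    refine ⟨⟨fun x hx => by simp, fun r hr => by simp, rfl, rfl, by simp⟩, ?_⟩
    refine Counts.congr (a := b) ?_ rfl rfl
    simpa [hzv] using hJ

theorem vc_opUp (hF : Λ.Fits n) (hS : Static Λ U a) {op : Var → Prog} {P : Finset (Fin n) → Prop}
    {f : Finset (Fin n) → Finset (Fin n)} {v : Fin n} (hop : IsOp Λ v op P f)
    {A : Fin n → Finset (Fin n)} (hA : Counts a A) (hv : a.var .v = v)
    (hnd : (U v).Nodup) (hP : ∀ z ∈ U v, P (A z))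
    (fin : ∀ b, Frame [.i, .h, .w, .t] [.cnt, .sum] (15 + 60 * (U v).length) a b →
      Counts b (fun z => if z ∈ U v then f (A z) else A z) → Q b) :
    Λ.vc (opUp op) Q a := by
  refine vc_eachUp hF hS hv (vs' := [.t]) (c := 49) (by simp) (by simp) (by simp)
    (by simp) (by simp) (by simp) (by simp) (by simp)
    (fun l b => Counts b (fun z => if z ∈ l then f (A z) else A z))
    (fun l b b' h hb => hb.congr (by rw [h]) (by rw [h])) (by simpa using hA) ?_ fin
  intro l₁ z l₂ hl b k hb hJ hz
  have hbv : b.var .v = v := by rw [hb.var _ (by simp), hv]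
  have hn : z ∉ l₁ := fun h => by
    rw [hl, List.nodup_append] at hnd
    exact hnd.2.2 _ h _ (by simp) rfl
  refine hop .w _ _ z _ (by simp) (by simp [hb.var, hS.var_n]) hbv hz hJ
    (by simpa [hn] using hP z (by rw [hl]; simp)) ?_
  intro b' hb' hA'
  refine ⟨hb'.mono (by norm_num), ?_⟩
  convert hA' using 1
  ext1 x
  by_cases hx : x = z
  · subst hx; simp [hn]
  · simp [hx]

/-- The counted set `A z` consists of `v` and `o`. -/
def IsPair (A : Fin n → Finset (Fin n)) (v z o : Fin n) : Prop :=
  (A z).card = 2 ∧ (A z).erase v = {o}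

-- If a counted set is `{v, o}`, its sum minus `v` is congruent to `o` modulo `n`, so the partner
-- `o` can be marked without knowing the elements of the set.
open Classical in
theorem vc_markUp (hF : Λ.Fits n) (hS : Static Λ U a) {v : Fin n} {k : ℕ} (hk : k ≤ 2)
    {A : Fin n → Finset (Fin n)} (hA : Counts a A) (hv : a.var .v = v)
    (hP : ∀ z ∈ U v, v ∈ A z)
    (fin : ∀ b, Frame [.i, .h, .w, .t] [.mark] (15 + 60 * (U v).length) a b →
      (∀ o : Fin n, b.arr .mark o = if ∃ z ∈ U v, IsPair A v z o then k else a.arr .mark o) →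
      Q b) :
    Λ.vc (markUp k) Q a := by
  have h1 := hF.lt_len .cnt (by simp)
  have h2 := hF.lt_len .mark (by simp)
  refine vc_eachUp hF hS hv (vs' := [.t]) (c := 49) (rs := [.mark]) (by simp) (by simp)
    (by simp) (by simp) (by simp) (by simp) (by simp) (by simp)
    (fun l b => ∀ o : Fin n, b.arr .mark o =
      if ∃ z ∈ l, IsPair A v z o then k else a.arr .mark o)
    (fun l b b' h hb => by rw [h]; exact hb) (by simp) ?_ fin
  intro l₁ z l₂ hl b j hb hJ hz
  have hbv : b.var .v = v := by rw [hb.var _ (by simp), hv]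
  have hbA : Counts b A := hA.congr (hb.arr _ (by simp)) (hb.arr _ (by simp))
  have hz' := z.2
  have hvz : v ∈ A z := hP z (by rw [hl]; simp)
  simp only [Layout.vc, Cond.ok, Expr.ok, Cond.holds, Expr.eval, hz, true_and, hbA.cnt,
    le_refl, and_true]
  refine ⟨by omega, fun h => ?_, fun h => ?_⟩
  · have hc : ((A z).erase v).card = 1 := by rw [Finset.card_erase_of_mem hvz, h]
    obtain ⟨o, ho⟩ := Finset.card_eq_one.1 hc
    have hsum : (∑ x ∈ A z, (x : ℕ)) = o + v := by
      rw [← Finset.sum_erase_add _ _ hvz, ho, Finset.sum_singleton]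
    refine vc_subMod (q := o) hF (by simp [hb.var, hS.var_n]) (by simp [hbv])
      (by simp [hz]) o.2 ?_ ?_
    · simp [hz, hbv, hbA.sum, hsum]
    · intro k' hk'
      have ho' := o.2
      simp only [Ast.set_var, if_true]
      refine ⟨hk, by omega, ⟨fun x hx => ?_, fun r hr => ?_, rfl, rfl, ?_⟩, ?_⟩
      · simp only [List.mem_cons, List.not_mem_nil, or_false] at hx
        simp [hx]
      · simp only [List.mem_cons, List.not_mem_nil, or_false] at hr
        simp [hr]
      · simp; omega
      · intro o'
        by_cases hoo : o' = o
        · subst hoo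
          have : IsPair A v z o' := ⟨h, ho⟩
          rw [if_pos ⟨z, by simp, this⟩]
          simp
        · have : ¬ IsPair A v z o' := fun h => hoo (by
            have := h.2; rw [ho] at this; exact (Finset.singleton_inj.1 this).symm)
          simp only [Ast.put_arr, if_true, Ast.set_arr, Ast.tick_arr]
          rw [Function.update_of_ne (fun h' => hoo (Fin.ext h')), hJ]
          simp [or_and_right, exists_or, this]
  · refine ⟨⟨fun x hx => by simp, fun r hr => by simp, rfl, rfl, by simp⟩, ?_⟩
    intro o'
    have : ¬ IsPair A v z o' := fun h' => h h'.1
    simp only [Ast.tick_arr, hJ]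
    simp [or_and_right, exists_or, this]

end Loops

/-! ### Linked lists -/

/-- The first element of a list, or the end marker `n`. -/
def hd {n : ℕ} : List (Fin n) → ℕ
  | [] => n
  | u :: _ => u

/-- Following the pointers `nx` from `p` one visits the members of the list, and then `n`. -/
def Path {n : ℕ} (nx : ℕ → ℕ) : ℕ → List (Fin n) → Prop
  | p, [] => nx p = n
  | p, u :: l => nx p = u ∧ Path nx u l

theorem Path.eq_hd {n : ℕ} {nx : ℕ → ℕ} {p : ℕ} {l : List (Fin n)} (h : Path nx p l) :
    nx p = hd l := by
  cases l with
  | nil => exact h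
  | cons u l => exact h.1

theorem Path.congr {n : ℕ} {nx nx' : ℕ → ℕ} {p p' : ℕ} {l : List (Fin n)}
    (h : Path nx p l) (hp : nx' p' = nx p) (hl : ∀ u ∈ l, nx' u = nx u) : Path nx' p' l := by
  induction l generalizing p p' with
  | nil => exact hp.trans h
  | cons u l ih =>
    exact ⟨hp.trans h.1, ih h.2 (hl u (by simp)) fun w hw => hl w (by simp [hw])⟩

/-- Relinking the elements of the list, which is threaded through `und`, behind their former
predecessors `pr` turns the pointers into `nx₀`. -/
def Undo {n : ℕ} (pr und nx₀ : ℕ → ℕ) : List (Fin n) → ℕ → (ℕ → ℕ) → Prop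
  | [], c, nx => c = n ∧ nx = nx₀
  | u :: R, c, nx => c = u ∧ pr u ≤ n ∧ Undo pr und nx₀ R (und u) (Function.update nx (pr u) u)

theorem Undo.congr {n : ℕ} {pr und pr' und' nx₀ : ℕ → ℕ} {R : List (Fin n)} {c : ℕ} {nx : ℕ → ℕ}
    (h : Undo pr und nx₀ R c nx) (h1 : ∀ u ∈ R, pr' u = pr u) (h2 : ∀ u ∈ R, und' u = und u) :
    Undo pr' und' nx₀ R c nx := by
  induction R generalizing c nx with
  | nil => exact h
  | cons u R ih =>
    obtain ⟨k1, k2, k3⟩ := h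
    refine ⟨k1, by rw [h1 u (by simp)]; exact k2, ?_⟩
    rw [h1 u (by simp), h2 u (by simp)]
    exact ih k3 (fun w hw => h1 w (by simp [hw])) fun w hw => h2 w (by simp [hw])

/-- `w := 1` if `u` cannot be removed together with `v`. -/
def conflictTest : Prog :=
  .asg .w (.arr .mark (.var .u)) ;;
  .ite (.eq (.arr .cnt (.var .u)) (.lit 2))
    (.asg .t (.add (.var .u) (.var .v)) ;;
      .ite (.lt (.var .t) (.var .n)) .skip (.asg .t (.sub (.var .t) (.var .n))) ;;
      .ite (.eq (.arr .sum (.var .u)) (.var .t)) (.asg .w (.lit 1)) .skip)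
    .skip

/-- Take `u`, the successor of `p`, out of the list. -/
def unlink : Prog :=
  .put .nxt (.var .p) (.arr .nxt (.var .u)) ;; .put .pr (.var .u) (.var .p) ;;
  .put .und (.var .u) (.var .ch) ;; .asg .ch (.var .u)

/-- Unlink the candidates that cannot be removed together with `v`, and remove `v` from the sets
counted at the others. -/
def sweep : Prog :=
  .whl (.lt (.var .u) (.var .n))
    (conflictTest ;;
      .ite (.eq (.var .w) (.lit 1)) unlink (opAt decr ;; .asg .p (.var .u)) ;;
      .asg .u (.arr .nxt (.var .u)))

/-- Insert `v` into the sets counted at the candidates. -/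
def resweep : Prog :=
  .whl (.lt (.var .u) (.var .n)) (opAt incr ;; .asg .u (.arr .nxt (.var .u)))

def relink : Prog :=
  .whl (.lt (.var .u) (.var .n))
    (.put .nxt (.arr .pr (.var .u)) (.var .u) ;; .asg .u (.arr .und (.var .u)))

section Sweep

variable {Λ : Layout} {n : ℕ} {a : Ast} {Q : Ast → Prop} {U : Fin n → List (Fin n)}

theorem vc_conflictTest (hF : Λ.Fits n) (hn : a.var .n = n) {u v : Fin n} (hu : a.var .u = u)
    (hv : a.var .v = v)
    (hQ : ∀ b, Frame [.w, .t] [] 40 a b → (b.var .w = 1 ↔ (a.arr .mark u = 1 ∨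
      (a.arr .cnt u = 2 ∧ a.arr .sum u = (u + v) % n))) → Q b) :
    Λ.vc conflictTest Q a := by
  have h1 := hF.lt_len .sum (by simp)
  have h2 := hF.lt_len .cnt (by simp)
  have h3 := hF.lt_len .mark (by simp)
  have h4 := hF.lt_W
  have h5 := add_mod_eq u.2 v.2
  have h6 := u.2
  have h7 := v.2
  have fr : ∀ b : Ast, (∀ x, x ≠ .w → x ≠ .t → b.var x = a.var x) → b.arr = a.arr →
      b.current = a.current → b.reported = a.reported → b.time ≤ a.time + 40 →
      Frame [.w, .t] [] 40 a b := fun b k1 k2 k3 k4 k5 =>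
    ⟨fun x hx => k1 x (by simp at hx; tauto) (by simp at hx; tauto), fun r _ => by rw [k2],
      k3, k4, k5⟩
  simp only [conflictTest, Layout.vc, Expr.ok, Expr.eval, Cond.ok, Cond.holds, Ast.set_var,
    Ast.tick_var, Ast.set_arr, Ast.tick_arr, hu, hv, hn, reduceCtorEq, if_false, if_true, true_and,
    and_true, le_refl]
  refine ⟨by omega, by omega, fun hc => ⟨by omega, ⟨fun h => ?_, fun h => ?_⟩⟩, fun hc => ?_⟩
  · rw [if_pos h] at h5
    refine ⟨by omega, fun hs => ⟨by norm_num, ?_⟩, fun hs => ?_⟩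
    · refine hQ _ (fr _ (fun x hx hx' => by simp [hx, hx']) rfl rfl rfl (by simp)) ?_
      simp [hc, hs, h5]
    · refine hQ _ (fr _ (fun x hx hx' => by simp [hx, hx']) rfl rfl rfl (by simp)) ?_
      simp [hs, h5]
  · rw [if_neg h] at h5
    refine ⟨by omega, fun hs => ⟨by norm_num, ?_⟩, fun hs => ?_⟩
    · refine hQ _ (fr _ (fun x hx hx' => by simp [hx, hx']) rfl rfl rfl (by simp)) ?_
      simp [hc, hs, h5]
    · refine hQ _ (fr _ (fun x hx hx' => by simp [hx, hx']) rfl rfl rfl (by simp)) ?_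
      simp [hs, h5]
  · refine hQ _ (fr _ (fun x hx hx' => by simp [hx]) rfl rfl rfl (by simp)) ?_
    simp [hc]

/-- Here `p` is the last element kept so far and `l` the part of the list behind it; `R` is the
chain of unlinked vertices, and undoing it from the current pointers yields `nx₀`. Removing `v` at a
kept candidate changes the set counted there and no other, so the tests at later candidates still
see the sets from before the sweep. An unlinked candidate costs `O(1)`; only the kept ones pay for a
scan of their lists. -/
theorem wp_sweep (hF : Λ.Fits n) {v : Fin n} (hnd : ∀ u, (U u).Nodup) {K : ℕ}
    (hK : ∀ u, (U u).length ≤ K) (del : Fin n → Prop) [DecidablePred del] (nx₀ : ℕ → ℕ)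
    (l : List (Fin n)) :
    ∀ (p : ℕ) (a : Ast) (A : Fin n → Finset (Fin n)) (R : List (Fin n)), Static Λ U a →
      Counts a A → a.var .v = v → a.var .u = hd l → a.var .p = p → p < n → l.Nodup →
      (∀ u ∈ l, p ≠ u) → Path (a.arr .nxt) p l →
      Undo (a.arr .pr) (a.arr .und) nx₀ R (a.var .ch) (a.arr .nxt) → (∀ u ∈ R, u ∉ l) →
      (∀ u ∈ l, (a.arr .mark u = 1 ∨
        (a.arr .cnt u = 2 ∧ a.arr .sum u = (u + v) % n)) ↔ del u) →
      (∀ u ∈ l, v ∈ A u ↔ v ∈ U u) →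
      (∀ b, Frame [.u, .w, .t, .ch, .p, .i', .h', .x] [.nxt, .pr, .und, .cnt, .sum]
          (100 * l.length + 60 * K * (l.filter fun u => ¬ del u).length + 3) a b →
        Counts b (fun w => if w ∈ l ∧ ¬ del w then (A w).erase v else A w) →
        Path (b.arr .nxt) p (l.filter fun u => ¬ del u) →
        (∃ R' : List (Fin n), (∀ u ∈ R', u ∈ R ∨ (u ∈ l ∧ del u)) ∧
          R'.length ≤ R.length + l.length ∧
          Undo (b.arr .pr) (b.arr .und) nx₀ R' (b.var .ch) (b.arr .nxt)) →
        (∀ i : ℕ, (∀ u ∈ l, del u → i ≠ u) →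
          b.arr .pr i = a.arr .pr i ∧ b.arr .und i = a.arr .und i) →
        (∀ i : ℕ, i ≠ p → (∀ u ∈ l, i ≠ u) → b.arr .nxt i = a.arr .nxt i) → Q b) →
      Λ.wp sweep Q a := by
  have l1 := hF.lt_len .nxt (by simp)
  have l2 := hF.lt_len .pr (by simp)
  have l3 := hF.lt_len .und (by simp)
  induction l with
  | nil =>
    intro p a A R hS hA hv hu hp hpn hl hpl hpath hundo hR hdel hAU hQ
    refine Layout.wp_whl_false (by simp) (by simp [hu, hS.var_n, hd]) ?_
    refine hQ _ ⟨by simp, by simp, rfl, rfl, by simp⟩ (Counts.congr (a := a) (by simpa using hA)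
      rfl rfl) (by simpa using hpath) ⟨R, by simp, by simp, by simpa using hundo⟩ (by simp)
      (by simp)
  | cons u l ih =>
    intro p a A R hS hA hv hu hp hpn hl hpl hpath hundo hR hdel hAU hQ
    have hu' : a.var .u = u := hu
    have hun := u.2
    obtain ⟨hul, hl'⟩ := List.nodup_cons.1 hl
    refine Layout.wp_whl_true (by simp) (by simp [hu', hS.var_n]) (Layout.wp_of_vc ?_)
    simp only [Layout.vc]
    refine vc_conflictTest hF (by simp [hS.var_n]) (u := u) (v := v) (by simp [hu'])
      (by simp [hv]) fun b hb hw => ?_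
    have hbu : b.var .u = u := by rw [hb.var _ (by simp)]; exact hu'
    have hbp : b.var .p = p := by rw [hb.var _ (by simp)]; exact hp
    have hbv : b.var .v = v := by rw [hb.var _ (by simp)]; exact hv
    have hbn : b.var .n = a.var .n := hb.var _ (by simp)
    have hbc : b.var .ch = a.var .ch := hb.var _ (by simp)
    have hbarr : b.arr = a.arr := funext fun r => hb.arr r (by simp)
    have hbS : Static Λ U b := hS.congr hbn (by rw [hbarr]) (by rw [hbarr])
    have hbA : Counts b A := hA.congr (by rw [hbarr]) (by rw [hbarr])
    have hbt := hb.time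
    simp only [Ast.tick_time, Cond.cost, Expr.cost, Ast.tick_arr] at hbt hw
    rw [hdel u (by simp)] at hw
    refine ⟨by simp, fun h => ?_, fun h => ?_⟩
    · have hd : del u := hw.1 (by simpa using h)
      simp only [unlink, Layout.vc, Expr.ok, Expr.eval, Ast.tick_var, Ast.put_var, Ast.set_var,
        Ast.tick_arr, Ast.put_arr, Ast.set_arr, hbu, hbp, hbarr, hbc, reduceCtorEq, if_false,
        if_true, true_and]
      refine ⟨by omega, by omega, by omega, by omega, by omega, ?_⟩
      have hne : (u : ℕ) ≠ p := fun h => hpl u (by simp) h.symm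
      have hnu : a.arr .nxt u = DomEnum.hd l := hpath.2.eq_hd
      have hR' : ∀ w ∈ R, (w : ℕ) ≠ u := fun w hw h => hR w hw (by simp [Fin.ext h])
      have hlu : ∀ w ∈ l, (w : ℕ) ≠ u := fun w hw h => hul (Fin.ext h ▸ hw)
      refine ih p _ A (u :: R) ?_ ?_ ?_ ?_ ?_ hpn hl' (fun w hw => hpl w (by simp [hw])) ?_ ?_ ?_
        ?_ (fun w hw => hAU w (by simp [hw])) ?_
      · exact hbS.congr (by simp) (by simp) (by simp)
      · exact hbA.congr (by simp) (by simp)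
      · simp [hbv]
      · simp [Function.update_of_ne hne, hnu]
      · simp [hbp]
      · simp only [Ast.set_arr, Ast.put_arr, reduceCtorEq, if_true, if_false, Ast.tick_arr, hbarr]
        exact hpath.2.congr (by simp) fun w hw =>
          Function.update_of_ne (fun h => hpl w (by simp [hw]) h.symm) _ _
      · simp only [Ast.set_arr, Ast.put_arr, reduceCtorEq, if_true, if_false, Ast.tick_arr, hbarr,
          Ast.set_var, Ast.put_var, Ast.tick_var]
        refine ⟨rfl, by simp; omega, ?_⟩
        simp only [Function.update_self]
        -- Linking `u` again behind `p` restores the pointers, since `p` pointed to `u`.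
        have : Function.update (Function.update (a.arr .nxt) p (a.arr .nxt u)) p u =
            a.arr .nxt := by
          rw [Function.update_idem, ← hpath.1, Function.update_eq_self]
        rw [this]
        exact hundo.congr (fun w hw => by simp [Function.update_of_ne (hR' w hw)])
          (fun w hw => by simp [Function.update_of_ne (hR' w hw)])
      · intro w hw
        rcases List.mem_cons.1 hw with rfl | hw
        · exact hul
        · exact fun h => hR w hw (by simp [h])
      · intro w hw
        simpa [hbarr] using hdel w (by simp [hw])
      · intro c hc hcA hcp hcR hcu hcn
        refine hQ c ⟨fun x hx => ?_, fun r hr => ?_, ?_, ?_, ?_⟩ ?_ ?_ ?_ ?_ ?_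
        · rw [hc.var x hx]
          simp only [List.mem_cons, List.not_mem_nil, or_false, not_or] at hx
          simp [hx, hb.var]
        · rw [hc.arr r hr]
          simp only [List.mem_cons, List.not_mem_nil, or_false, not_or] at hr
          simp [hr, hbarr]
        · rw [hc.current]; simp [hb.current]
        · rw [hc.reported]; simp [hb.reported]
        · have := hc.time
          simp [hd] at this ⊢
          omega
        · convert hcA using 1
          ext1 w
          by_cases hwu : w = u
          · subst hwu; simp [hd, hul]
          · simp [hwu]
        · simpa [hd] using hcp
        · obtain ⟨R', k1, k2, k3⟩ := hcR
          refine ⟨R', fun w hw => ?_, by simp at k2 ⊢; omega, k3⟩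
          rcases k1 w hw with h | h
          · rcases List.mem_cons.1 h with rfl | h
            · exact Or.inr ⟨by simp, hd⟩
            · exact Or.inl h
          · exact Or.inr ⟨by simp [h.1], h.2⟩
        · intro i hi
          have h1 := hi u (by simp) hd
          have h2 := hcu i fun w hw hdw => hi w (by simp [hw]) hdw
          simpa [h1, hbarr, Function.update_of_ne] using h2
        · intro i hip hi
          have := hcn i hip fun w hw => hi w (by simp [hw])
          simpa [hbarr, Function.update_of_ne hip] using this
    · have hd : ¬ del u := fun hd => h (by simpa using hw.2 hd)
      refine vc_opAt (a := b.tick _) hF (hbS.congr rfl rfl rfl) (isOp_decr hF v) (hbA.congr rfl rfl) (u := u)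
        (by simp [hbu]) (by simp [hbv]) (hnd u) (hAU u (by simp)).2 ?_
      intro b' hb' hA'
      have hb'u : b'.var .u = u := by rw [hb'.var _ (by simp)]; exact hbu
      have hb'nxt : b'.arr .nxt = a.arr .nxt := by rw [hb'.arr _ (by simp)]; simp [hbarr]
      have hb'pr : b'.arr .pr = a.arr .pr := by rw [hb'.arr _ (by simp)]; simp [hbarr]
      have hb'und : b'.arr .und = a.arr .und := by rw [hb'.arr _ (by simp)]; simp [hbarr]
      have hb'mark : b'.arr .mark = a.arr .mark := by rw [hb'.arr _ (by simp)]; simp [hbarr]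
      have hb'ch : b'.var .ch = a.var .ch := by rw [hb'.var _ (by simp)]; exact hbc
      have hb't := hb'.time
      have hA'' : Counts b' (Function.update A u (if v ∈ U u then (A u).erase v else A u)) := by
        split_ifs at hA' ⊢ with hvu
        · exact hA'
        · simpa using hA'
      have hlu : ∀ w ∈ l, w ≠ u := fun w hw h => hul (h ▸ hw)
      simp only [Expr.ok, Expr.eval, Ast.set_var, Ast.set_arr, hb'u, reduceCtorEq,
        if_false, true_and]
      refine ⟨by omega, ?_⟩
      refine ih u _ _ R ?_ (hA''.congr rfl rfl) ?_ ?_ ?_ u.2 hl'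
        (fun w hw h => hlu w hw (Fin.ext h.symm)) ?_ ?_ (fun w hw h => hR w hw (by simp [h])) ?_
        ?_ ?_
      · refine hS.congr ?_ ?_ ?_
        · simp [hb'.var, hbn]
        · simp [hb'.arr, hbarr]
        · simp [hb'.arr, hbarr]
      · simp [hb'.var, hbv]
      · simp [hb'nxt, hpath.2.eq_hd]
      · simp
      · simpa [hb'nxt] using hpath.2
      · simpa [hb'nxt, hb'pr, hb'und, hb'ch] using hundo
      · intro w hw
        have h1 := hdel w (by simp [hw])
        have h2 := hA.cnt w
        have h3 := hA.sum w
        have h4 := hA''.cnt w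
        have h5 := hA''.sum w
        rw [Function.update_of_ne (hlu w hw)] at h4 h5
        simpa [hb'mark, h4, h5, ← h2, ← h3] using h1
      · intro w hw
        rw [Function.update_of_ne (hlu w hw)]
        exact hAU w (by simp [hw])
      · intro c hc hcA hcp hcR hcu hcn
        -- The rest of the sweep writes `nxt` at `u` and at later candidates only, so `p` keeps its
        -- successor.
        have hcn' : c.arr .nxt p = u := by
          have := hcn p (hpl u (by simp)) fun w hw => hpl w (by simp [hw])
          rw [this]; simp [hb'nxt, hpath.1]
        refine hQ c ⟨fun x hx => ?_, fun r hr => ?_, ?_, ?_, ?_⟩ ?_ ?_ ?_ ?_ ?_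
        · rw [hc.var x hx]
          simp only [List.mem_cons, List.not_mem_nil, or_false, not_or] at hx
          simp [hx, hb.var, hb'.var]
        · rw [hc.arr r hr]
          simp only [List.mem_cons, List.not_mem_nil, or_false, not_or] at hr
          simp [hr, hb'.arr, hbarr]
        · rw [hc.current]; simp [hb.current, hb'.current]
        · rw [hc.reported]; simp [hb.reported, hb'.reported]
        · have := hc.time
          have := Nat.mul_le_mul_left 60 (hK u)
          simp [hd, mul_add] at *
          omega
        · convert hcA using 1
          ext1 w
          by_cases hwu : w = u
          · subst hwu
            have := hAU w (by simp)
            by_cases hvw : v ∈ U w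
            · simp [hd, hul, hvw]
            · simp [hd, hul, hvw, this]
          · simp [hwu]
        · simpa [hd, hcn', Path] using hcp
        · obtain ⟨R', k1, k2, k3⟩ := hcR
          refine ⟨R', fun w hw => ?_, by simp at k2 ⊢; omega, k3⟩
          rcases k1 w hw with h | h
          · exact Or.inl h
          · exact Or.inr ⟨by simp [h.1], h.2⟩
        · intro i hi
          have h2 := hcu i fun w hw hdw => hi w (by simp [hw]) hdw
          simpa [hb'pr, hb'und] using h2
        · intro i hip hi
          have := hcn i (hi u (by simp)) fun w hw => hi w (by simp [hw])
          simpa [hb'nxt] using this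

theorem wp_resweep (hF : Λ.Fits n) {v : Fin n} (hnd : ∀ u, (U u).Nodup) {K : ℕ}
    (hK : ∀ u, (U u).length ≤ K) (l : List (Fin n)) :
    ∀ (a : Ast) (A : Fin n → Finset (Fin n)), Static Λ U a → Counts a A → a.var .v = v →
      a.var .u = hd l → l.Nodup → (∃ p, Path (a.arr .nxt) p l) →
      (∀ u ∈ l, v ∈ U u → v ∉ A u) →
      (∀ b, Frame [.u, .t, .i', .h', .x] [.cnt, .sum] ((40 + 60 * K) * l.length + 3) a b →
        Counts b (fun w => if w ∈ l ∧ v ∈ U w then insert v (A w) else A w) → Q b) →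
      Λ.wp resweep Q a := by
  have l1 := hF.lt_len .nxt (by simp)
  induction l with
  | nil =>
    intro a A hS hA hv hu hl hpath hAU hQ
    refine Layout.wp_whl_false (by simp) (by simp [hu, hS.var_n, hd]) ?_
    exact hQ _ ⟨by simp, by simp, rfl, rfl, by simp⟩ (Counts.congr (a := a) (by simpa using hA)
      rfl rfl)
  | cons u l ih =>
    rintro a A hS hA hv hu hl ⟨p, hpath⟩ hAU hQ
    have hu' : a.var .u = u := hu
    have hun := u.2
    obtain ⟨hul, hl'⟩ := List.nodup_cons.1 hl
    have hlu : ∀ w ∈ l, w ≠ u := fun w hw h => hul (h ▸ hw)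
    refine Layout.wp_whl_true (by simp) (by simp [hu', hS.var_n]) (Layout.wp_of_vc ?_)
    simp only [Layout.vc]
    refine vc_opAt (a := a.tick _) hF (hS.congr rfl rfl rfl) (isOp_incr hF v) (hA.congr rfl rfl)
      (u := u) (by simp [hu']) (by simp [hv]) (hnd u) (hAU u (by simp)) ?_
    intro b hb hbA
    have hbu : b.var .u = u := by rw [hb.var _ (by simp)]; exact hu'
    have hbnxt : b.arr .nxt = a.arr .nxt := by rw [hb.arr _ (by simp)]; simp
    simp only [Expr.ok, Expr.eval, hbu, true_and]
    refine ⟨by omega, ih _ _ ?_ (hbA.congr rfl rfl) ?_ ?_ hl' ⟨u, ?_⟩ ?_ ?_⟩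
    · exact hS.congr (by simp [hb.var]) (by simp [hb.arr]) (by simp [hb.arr])
    · simp [hb.var, hv]
    · simp [hbnxt, hpath.2.eq_hd]
    · simpa [hbnxt] using hpath.2
    · intro w hw hvw
      split_ifs
      · rw [Function.update_of_ne (hlu w hw)]
        exact hAU w (by simp [hw]) hvw
      · exact hAU w (by simp [hw]) hvw
    · intro c hc hcA
      refine hQ c ⟨fun x hx => ?_, fun r hr => ?_, ?_, ?_, ?_⟩ ?_
      · rw [hc.var x hx]
        simp only [List.mem_cons, List.not_mem_nil, or_false, not_or] at hx
        simp [hx, hb.var]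
      · rw [hc.arr r hr]
        simp only [List.mem_cons, List.not_mem_nil, or_false, not_or] at hr
        simp [hr, hb.arr]
      · rw [hc.current]; simp [hb.current]
      · rw [hc.reported]; simp [hb.reported]
      · have h1 := hc.time
        have h2 := hb.time
        have := Nat.mul_le_mul_left 60 (hK u)
        simp [mul_add] at *
        omega
      · convert hcA using 1
        ext1 w
        by_cases hwu : w = u
        · subst hwu
          by_cases hvw : v ∈ U w <;> simp [hul, hvw]
        · by_cases hvu : v ∈ U u <;> simp [hwu, hvu]

/-- The chain starts with the vertex unlinked last. In this order each recorded predecessor is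
correct again at the moment when it is used. -/
theorem wp_relink (hF : Λ.Fits n) (nx₀ : ℕ → ℕ) (R : List (Fin n)) :
    ∀ a : Ast, a.var .n = n → Undo (a.arr .pr) (a.arr .und) nx₀ R (a.var .u) (a.arr .nxt) →
      (∀ b, Frame [.u] [.nxt] (30 * R.length + 3) a b → b.arr .nxt = nx₀ → Q b) →
      Λ.wp relink Q a := by
  have l1 := hF.lt_len .nxt (by simp)
  have l2 := hF.lt_len .pr (by simp)
  have l3 := hF.lt_len .und (by simp)
  induction R with
  | nil =>
    intro a hn hU hQ
    exact Layout.wp_whl_false (by simp) (by simp [hU.1, hn])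
      (hQ _ ⟨by simp, by simp, rfl, rfl, by simp⟩ hU.2)
  | cons u R ih =>
    intro a hn hU hQ
    have hu := u.2
    have h1 : a.var .u = u := hU.1
    have h2 := hU.2.1
    refine Layout.wp_whl_true (by simp) (by simp [h1, hn]) (Layout.wp_of_vc ?_)
    simp only [Layout.vc, Expr.ok, Expr.eval, Ast.tick_var, Ast.tick_arr, Ast.put_var, h1,
      Ast.put_arr, reduceCtorEq, if_false, true_and]
    refine ⟨by omega, by omega, by omega, ih _ (by simp [hn]) ?_ ?_⟩
    · simpa using hU.2.2
    · intro b hb hbn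
      refine hQ b ⟨fun x hx => ?_, fun r hr => ?_, by simp [hb.current], by simp [hb.reported],
        ?_⟩ hbn
      · rw [hb.var x hx]; simp at hx; simp [hx]
      · rw [hb.arr r hr]; simp at hr; simp [hr]
      · have := hb.time
        simp [mul_add] at this ⊢
        omega

end Sweep

/-! ### Conflicts in terms of the counted sets -/

section Combinatorics

variable {n : ℕ} {G : SimpleGraph (Fin n)} [DecidableRel G.Adj] {σ : Equiv.Perm (Fin n)}

/-- `U v` lists `v` and its larger neighbours. -/
structure UpLists (G : SimpleGraph (Fin n)) (σ : Equiv.Perm (Fin n))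
    (U : Fin n → List (Fin n)) : Prop where
  nodup : ∀ v, (U v).Nodup
  mem_iff : ∀ v w, w ∈ U v ↔ w = v ∨ (G.Adj v w ∧ σ v < σ w)

theorem mem_of_descending_eq {C : Finset (Fin n)} {v : Fin n} {l₀ l : List (Fin n)}
    (h : descending σ C = l₀ ++ v :: l) {u : Fin n} : u ∈ l ↔ u ∈ C ∧ σ u < σ v := by
  have hp := descending_pairwise (σ := σ) C
  have hm : u ∈ C ↔ u ∈ l₀ ++ v :: l := by rw [← h, mem_descending]
  rw [h, List.pairwise_append, List.pairwise_cons] at hp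
  rw [hm, List.mem_append, List.mem_cons]
  constructor
  · exact fun hu => ⟨Or.inr (Or.inr hu), hp.2.1.1 u hu⟩
  · rintro ⟨h1 | rfl | h1, h2⟩
    · exact absurd (hp.2.2 u h1 v (by simp)) (not_lt.2 h2.le)
    · exact absurd h2 (lt_irrefl _)
    · exact h1

theorem mem_of_descending_eq' {C : Finset (Fin n)} {v : Fin n} {l₀ l : List (Fin n)}
    (h : descending σ C = l₀ ++ v :: l) : v ∈ C := by
  rw [← mem_descending (σ := σ), h]; simp

theorem nodup_of_descending_eq {C : Finset (Fin n)} {v : Fin n} {l₀ l : List (Fin n)}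
    (h : descending σ C = l₀ ++ v :: l) : l.Nodup := by
  have := descending_nodup (σ := σ) C
  rw [h, List.nodup_append, List.nodup_cons] at this
  exact this.2.1.2

theorem length_of_descending_eq {C : Finset (Fin n)} {v : Fin n} {l₀ l : List (Fin n)}
    (h : descending σ C = l₀ ++ v :: l) : l.length = (below σ C v).card := by
  rw [← List.toFinset_card_of_nodup (nodup_of_descending_eq h)]
  congr 1
  ext u
  rw [List.mem_toFinset, mem_of_descending_eq h]
  simp [below]

-- The order is inherited, so the list of the child is obtained inside the list of its parent by
-- unlinking, without copying.
open Classical in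
theorem descending_child {s : Call n} {v : Fin n} {l₀ l : List (Fin n)}
    (h : descending σ s.C = l₀ ++ v :: l) :
    descending σ (child G σ s v).C = l.filter fun u => ¬ Conflict G s.X u v := by
  have h1 : descending σ (child G σ s v).C =
      (descending σ s.C).filter fun u => u ∈ (child G σ s v).C := by
    unfold descending
    rw [List.filter_filter]
    apply List.filter_congr
    intro u _
    have : u ∈ (child G σ s v).C → u ∈ s.C := fun h => (mem_child_C.1 h).1
    by_cases hu : u ∈ (child G σ s v).C <;> simp [hu, this]
  have hp := descending_pairwise (σ := σ) s.C
  rw [h, List.pairwise_append] at hp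
  rw [h1, h, List.filter_append, List.filter_cons]
  have h2 : l₀.filter (fun u => u ∈ (child G σ s v).C) = [] := by
    rw [List.filter_eq_nil_iff]
    intro u hu hc
    exact absurd (mem_child_C.1 (by simpa using hc)).2.1 (not_lt.2 (hp.2.2 u hu v (by simp)).le)
  have h3 : v ∉ (child G σ s v).C := fun hc => lt_irrefl _ (mem_child_C.1 hc).2.1
  rw [h2, if_neg (by simpa using h3), List.nil_append]
  apply List.filter_congr
  intro u hu
  have := (mem_of_descending_eq h).1 hu
  simp [mem_child_C, this]

/-- The set `A w` contains the dominators of `w`; it is the set of dominators if `w` is missing in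
the current solution or may be removed from it. -/
structure Approx (G : SimpleGraph (Fin n)) [DecidableRel G.Adj] (s : Call n)
    (A : Fin n → Finset (Fin n)) : Prop where
  sub : ∀ w, closedNbhd G w ∩ s.X ⊆ A w
  eq : ∀ w, w ∉ s.X ∨ w ∈ s.C → A w = closedNbhd G w ∩ s.X

variable {s : Call n} {A : Fin n → Finset (Fin n)} {U : Fin n → List (Fin n)}

theorem Call.Valid.mem_C (hs : s.Valid G σ) {v : Fin n} (hv : v ∈ s.C) :
    v ∈ s.X ∧ (∀ w, w ∉ s.X → σ v < σ w) ∧ IsDominating G (s.X.erase v) := by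
  rw [hs.C_eq] at hv
  exact mem_cand.1 hv

theorem Approx.mem_of_mem_up (hA : Approx G s A) (hU : UpLists G σ U) {v z : Fin n}
    (hv : v ∈ s.X) (hz : z ∈ U v) : v ∈ A z := by
  apply hA.sub
  rw [hU.mem_iff] at hz
  rw [Finset.mem_inter, mem_closedNbhd]
  exact ⟨hz.imp Eq.symm fun h => h.1.symm, hv⟩

/-- As `v` is larger than `u`, whether `v` dominates `u` can be read off the short list of `u`. -/
theorem Approx.mem_iff_mem_up (hA : Approx G s A) (hs : s.Valid G σ) (hU : UpLists G σ U)
    {u v : Fin n} (hv : v ∈ s.C) (hu : u ∈ s.C) (huv : σ u < σ v) : v ∈ A u ↔ v ∈ U u := by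
  rw [hA.eq u (Or.inr hu), hU.mem_iff, Finset.mem_inter, mem_closedNbhd]
  have := (hs.mem_C hv).1
  tauto

theorem isPair_iff {v z u : Fin n} (hvz : v ∈ A z) (huv : u ≠ v) :
    IsPair A v z u ↔ A z = {u, v} := by
  unfold IsPair
  constructor
  · rintro ⟨-, h⟩
    rw [← Finset.insert_erase hvz, h, Finset.pair_comm]
  · intro h
    rw [h, Finset.card_pair huv]
    refine ⟨rfl, ?_⟩
    rw [Finset.pair_comm, Finset.erase_insert (by simpa using huv.symm)]

/-- Vertices are less than `n`, so the residue of the sum determines the second element. -/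
theorem pair_iff_sum {u v : Fin n} {S : Finset (Fin n)} (hu : u ∈ S) (huv : u ≠ v) :
    S = {u, v} ↔ S.card = 2 ∧ (∑ x ∈ S, (x : ℕ)) % n = (u + v) % n := by
  constructor
  · rintro rfl
    exact ⟨Finset.card_pair huv, by rw [Finset.sum_pair huv]⟩
  · rintro ⟨h1, h2⟩
    obtain ⟨o, ho⟩ := Finset.card_eq_one.1 (show (S.erase u).card = 1 by
      rw [Finset.card_erase_of_mem hu, h1])
    have hS : S = insert u {o} := by rw [← ho, Finset.insert_erase hu]
    rw [← Finset.add_sum_erase _ _ hu, ho, Finset.sum_singleton] at h2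
    have h3 : (o : ℕ) ≡ v [MOD n] := Nat.ModEq.add_left_cancel' (u : ℕ) h2
    have : o = v := Fin.ext (h3.eq_of_lt_of_lt o.2 v.2)
    rw [hS, this]

/-- A witness of a conflict in `X` is `u` or `v`; a missing witness is a neighbour of `v`, larger
than `v` because `v` is a candidate, and so lies in `U v`. Conversely, an inexact set cannot feign a
conflict: if `A z = {u, v}` with `z` in `X`, then `z` dominates itself, hence is one of the
candidates `u`, `v`, where the sets are exact. -/
theorem Approx.conflict_iff (hA : Approx G s A) (hs : s.Valid G σ) (hU : UpLists G σ U)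
    {u v : Fin n} (hv : v ∈ s.C) (hu : u ∈ s.C) (huv : σ u < σ v) :
    ((∃ z ∈ U v, IsPair A v z u) ∨
      ((A u).card = 2 ∧ (∑ x ∈ A u, (x : ℕ)) % n = (u + v) % n)) ↔ Conflict G s.X u v := by
  have hne : u ≠ v := by rintro rfl; exact lt_irrefl _ huv
  have hvC := hs.mem_C hv
  have huC := hs.mem_C hu
  have huA : u ∈ A u := hA.mem_of_mem_up hU huC.1 ((hU.mem_iff _ _).2 (Or.inl rfl))
  rw [← pair_iff_sum huA hne]
  constructor
  · rintro (⟨z, hz, hp⟩ | h)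
    · rw [isPair_iff (hA.mem_of_mem_up hU hvC.1 hz) hne] at hp
      refine ⟨z, ?_⟩
      rw [← hp]
      refine (hA.eq z ?_).symm
      by_cases hzX : z ∈ s.X
      · right
        have : z ∈ A z := hA.sub z (by simp [mem_closedNbhd, hzX])
        rw [hp, Finset.mem_insert, Finset.mem_singleton] at this
        rcases this with rfl | rfl
        · exact hu
        · exact hv
      · exact Or.inl hzX
    · exact ⟨u, by rw [← hA.eq u (Or.inr hu), h]⟩
  · rintro ⟨w, hw⟩
    have hvw : v ∈ closedNbhd G w ∩ s.X := by rw [hw]; simp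
    rw [Finset.mem_inter, mem_closedNbhd] at hvw
    by_cases hwX : w ∈ s.X
    · have : w ∈ ({u, v} : Finset (Fin n)) := by rw [← hw]; simp [mem_closedNbhd, hwX]
      rw [Finset.mem_insert, Finset.mem_singleton] at this
      rcases this with rfl | rfl
      · right
        rw [hA.eq w (Or.inr hu), hw]
      · left
        have hwU : w ∈ U w := (hU.mem_iff _ _).2 (Or.inl rfl)
        exact ⟨w, hwU, (isPair_iff (hA.mem_of_mem_up hU hwX hwU) hne).2
          (by rw [hA.eq w (Or.inr hv), hw])⟩
    · left
      have hwv : v ≠ w := by rintro rfl; exact hwX hvC.1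
      have hwU : w ∈ U v := (hU.mem_iff _ _).2
        (Or.inr ⟨(hvw.1.resolve_left hwv).symm, hvC.2.1 w hwX⟩)
      exact ⟨w, hwU, (isPair_iff (hA.mem_of_mem_up hU hvC.1 hwU) hne).2
        (by rw [hA.eq w (Or.inl hwX), hw])⟩

/-- The counted sets after the removal of `v`. -/
def childSets (U : Fin n → List (Fin n)) (C : Finset (Fin n)) (v : Fin n)
    (A : Fin n → Finset (Fin n)) (w : Fin n) : Finset (Fin n) :=
  if w ∈ C ∨ w ∈ U v then (A w).erase v else A w

/-- Sets have to be exact only at missing vertices and remaining candidates. The missing vertices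
dominated by `v`, and `v` itself, are in `U v`; the remaining candidates are all treated. Elsewhere
`v` may stay in the set, which then is a proper superset. -/
theorem Approx.child (hA : Approx G s A) (hs : s.Valid G σ) (hU : UpLists G σ U) {v : Fin n}
    (hv : v ∈ s.C) : Approx G (child G σ s v) (childSets U (child G σ s v).C v A) := by
  have hvC := hs.mem_C hv
  have hX : (DomEnum.child G σ s v).X = s.X.erase v := rfl
  have hin : ∀ w, closedNbhd G w ∩ s.X.erase v = (closedNbhd G w ∩ s.X).erase v := fun w => by
    rw [Finset.inter_erase]
  constructor
  · intro w
    rw [hX, hin, childSets]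
    split_ifs
    · exact Finset.erase_subset_erase _ (hA.sub w)
    · exact (Finset.erase_subset _ _).trans (hA.sub w)
  · intro w hw
    rw [hX] at hw
    rw [hX, hin, childSets]
    rcases hw with hw | hw
    · by_cases hwv : w = v
      · subst hwv
        rw [if_pos (Or.inr ((hU.mem_iff _ _).2 (Or.inl rfl))), hA.eq w (Or.inr hv)]
      · have hwX : w ∉ s.X := fun h => hw (Finset.mem_erase.2 ⟨hwv, h⟩)
        rw [hA.eq w (Or.inl hwX)]
        split_ifs with h
        · rfl
        · rw [Finset.erase_eq_of_notMem]
          rw [Finset.mem_inter, mem_closedNbhd]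
          rintro ⟨h1 | h1, -⟩
          · exact hwv h1.symm
          · exact h (Or.inr ((hU.mem_iff _ _).2 (Or.inr ⟨h1.symm, hvC.2.1 w hwX⟩)))
    · rw [if_pos (Or.inl hw), hA.eq w (Or.inr (mem_child_C.1 hw).1)]

end Combinatorics

/-- Remove the candidate `v` from the current solution and report the result. -/
def enter : Prog :=
  .asg .v (.var .cur) ;; markUp 1 ;; .asg .p (.var .v) ;; .asg .u (.arr .nxt (.var .v)) ;;
  .asg .ch (.var .n) ;; sweep ;; markUp 0 ;; opUp decr ;; .put .und (.var .v) (.var .ch) ;;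
  .put .pr (.var .v) (.var .top) ;; .asg .top (.var .v) ;; .rem .v ;; .report ;;
  .asg .cur (.arr .nxt (.var .v))

/-- Undo the last removal and go on to the next candidate. -/
def leave : Prog :=
  .asg .v (.var .top) ;; opUp incr ;; .asg .u (.arr .nxt (.var .v)) ;; resweep ;;
  .asg .u (.arr .und (.var .v)) ;; relink ;; .ins .v ;; .asg .top (.arr .pr (.var .v)) ;;
  .asg .cur (.arr .nxt (.var .v))

/-- Traverse the tree of all dominating sets. -/
def search : Prog :=
  .whl (.lt (.add (.var .cur) (.var .top)) (.add (.var .n) (.var .n)))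
    (.ite (.lt (.var .cur) (.var .n)) enter leave)

theorem Frame.static {n : ℕ} {Λ : Layout} {U : Fin n → List (Fin n)} {vs : List Var}
    {rs : List Arr} {k : ℕ} {a b : Ast} (h : Frame vs rs k a b) (hS : Static Λ U a)
    (h1 : Var.n ∉ vs) (h2 : Arr.ups ∉ rs) (h3 : Arr.up ∉ rs) : Static Λ U b :=
  hS.congr (h.var _ h1) (h.arr _ h2) (h.arr _ h3)

/-- The state in which the candidates of `s` are processed. -/
structure Node {n : ℕ} (Λ : Layout) (G : SimpleGraph (Fin n)) [DecidableRel G.Adj]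
    (U : Fin n → List (Fin n)) (s : Call n) (A : Fin n → Finset (Fin n)) (a : Ast) : Prop where
  static : Static Λ U a
  counts : Counts a A
  mark : ∀ o : Fin n, a.arr .mark o = 0
  approx : Approx G s A
  current : a.current = toNatSet s.X

theorem toNatSet_erase {n : ℕ} (X : Finset (Fin n)) (v : Fin n) :
    (toNatSet X).erase v = toNatSet (X.erase v) := by
  simp only [toNatSet, Finset.map_erase]; rfl

/-! ### Verification of the tree traversal -/

section Search

variable {Λ : Layout} {n : ℕ} {Q : Ast → Prop} {U : Fin n → List (Fin n)}
  {G : SimpleGraph (Fin n)} [DecidableRel G.Adj] {σ : Equiv.Perm (Fin n)}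

/-- The effect of `enter` at the candidate `v` of `s`. -/
structure Entered (Λ : Layout) (G : SimpleGraph (Fin n)) [DecidableRel G.Adj]
    (σ : Equiv.Perm (Fin n)) (U : Fin n → List (Fin n)) (s : Call n)
    (A : Fin n → Finset (Fin n)) (v : Fin n) (a b : Ast) : Prop where
  node : Node Λ G U (child G σ s v) (childSets U (child G σ s v).C v A) b
  path : Path (b.arr .nxt) v (descending σ (child G σ s v).C)
  cur : b.var .cur = hd (descending σ (child G σ s v).C)
  top : b.var .top = v
  pr : b.arr .pr v = a.var .top
  undo : ∃ R : List (Fin n), (∀ u ∈ R, u ∉ (child G σ s v).C) ∧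
    R.length ≤ (below σ s.C v).card ∧
    Undo (b.arr .pr) (b.arr .und) (a.arr .nxt) R (b.arr .und v) (b.arr .nxt)
  links : ∀ i : ℕ, (∀ u ∈ s.C, i ≠ u) → b.arr .pr i = a.arr .pr i ∧ b.arr .und i = a.arr .und i
  ups : b.arr .ups = a.arr .ups
  up : b.arr .up = a.arr .up
  reported : b.reported = a.reported ++ [toNatSet (child G σ s v).X]

/-- The entries of `pr` and `und` at `v` become a stack frame: the previous top, and the head of the
chain of candidates unlinked on behalf of `v`. Since `v` is no candidate of the child, these entries
are free for that use. -/
theorem vc_enter (hF : Λ.Fits n) (hU : UpLists G σ U) {K : ℕ} (hK : ∀ u, (U u).length ≤ K)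
    {s : Call n} (hs : s.Valid G σ) {A : Fin n → Finset (Fin n)} {a : Ast}
    (hN : Node Λ G U s A a) {v : Fin n} {l₀ l : List (Fin n)}
    (hl : descending σ s.C = l₀ ++ v :: l) (hcur : a.var .cur = v) (hp : Path (a.arr .nxt) v l)
    (hQ : ∀ b, Entered Λ G σ U s A v a b → b.time ≤ a.time + (100 + 180 * K) +
      100 * (below σ s.C v).card + 60 * K * (child G σ s v).C.card → Q b) :
    Λ.vc enter Q a := by
  classical
  have l1 := hF.lt_len .nxt (by simp)
  have l2 := hF.lt_len .pr (by simp)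
  have l3 := hF.lt_len .und (by simp)
  have hv := v.2
  have hvC := mem_of_descending_eq' hl
  have hvX := (hs.mem_C hvC).1
  have hml := fun u => mem_of_descending_eq hl (u := u)
  have hPup : ∀ z ∈ U v, v ∈ A z := fun z hz => hN.approx.mem_of_mem_up hU hvX hz
  have hkept := descending_child (G := G) hl
  -- The sweep thus leaves the sets counted at `U v` alone. The second marking finds the same
  -- partners as the first one and clears precisely their marks.
  have hlU : ∀ u ∈ l, u ∉ U v := fun u hu hc => by
    have h1 := ((hml u).1 hu).2
    rcases (hU.mem_iff _ _).1 hc with rfl | h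
    · exact lt_irrefl _ h1
    · exact lt_asymm h.2 h1
  simp only [enter, Layout.vc, Expr.ok, Expr.eval]
  refine ⟨trivial, ?_⟩
  refine vc_markUp (a := a.set .v (a.var .cur) _) hF (hN.static.congr (by simp) rfl rfl)
    (k := 1) (by norm_num) (hN.counts.congr rfl rfl) (v := v) (by simp [hcur]) hPup fun b hb hbm => ?_
  have hbS := hb.static (hN.static.congr (by simp) rfl rfl) (by simp) (by simp) (by simp)
  have hbarr : ∀ r, r ≠ .mark → b.arr r = a.arr r := fun r hr => hb.arr r (by simpa using hr)
  have hbA : Counts b A := hN.counts.congr (hbarr _ (by simp)) (hbarr _ (by simp))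
  have hbv : b.var .v = v := by rw [hb.var _ (by simp)]; simp [hcur]
  have hbn : b.var .n = n := hbS.var_n
  have hbtop : b.var .top = a.var .top := by rw [hb.var _ (by simp)]; simp
  simp only [Ast.set_arr, hN.mark] at hbm
  simp only [Ast.set_var, Ast.set_arr, hbv, reduceCtorEq, if_false, true_and]
  refine ⟨by omega, ?_⟩
  refine wp_sweep hF (v := v) hU.nodup hK (fun u => Conflict G s.X u v) (a.arr .nxt) l v _ A []
    (hbS.congr (by simp) rfl rfl) (hbA.congr rfl rfl) (by simp [hbv]) ?_ (by simp) hv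
    (nodup_of_descending_eq hl) ?_ ?_ ?_ (by simp) ?_ ?_ ?_
  · simp [hbarr, hp.eq_hd]
  · intro u hu h
    rw [← Fin.ext h] at hu
    exact lt_irrefl _ ((hml v).1 hu).2
  · simpa [hbarr] using hp
  · simp [hbarr, hbn, Undo]
  · intro u hu
    rw [← hN.approx.conflict_iff hs hU hvC ((hml u).1 hu).1 ((hml u).1 hu).2, ← hbA.cnt,
      ← hbA.sum]
    simp only [Ast.set_arr, hbm]
    by_cases h : ∃ z ∈ U v, IsPair A v z u <;> simp [h]
  · exact fun u hu => hN.approx.mem_iff_mem_up hs hU hvC ((hml u).1 hu).1 ((hml u).1 hu).2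
  intro c hc hcA hcp hcR hcu _
  rw [← hkept] at hcp
  have hcS := hc.static (hbS.congr (by simp) rfl rfl) (by simp) (by simp) (by simp)
  have hcv : c.var .v = v := by rw [hc.var _ (by simp)]; simp [hbv]
  set A₁ : Fin n → Finset (Fin n) :=
    fun w => if w ∈ l ∧ ¬ Conflict G s.X w v then (A w).erase v else A w with hA₁
  have hA₁U : ∀ z ∈ U v, A₁ z = A z := fun z hz =>
    if_neg fun h => hlU z h.1 hz
  refine vc_markUp hF hcS (k := 0) (by norm_num) hcA hcv (fun z hz => by rw [hA₁U z hz]; exact hPup z hz)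
    fun d hd hdm => ?_
  have hdS := hd.static hcS (by simp) (by simp) (by simp)
  have hdm' : ∀ o : Fin n, d.arr .mark o = 0 := fun o => by
    rw [hdm, hc.arr _ (by simp)]
    simp only [Ast.set_arr, hbm]
    have : (∃ z ∈ U v, IsPair A₁ v z o) ↔ ∃ z ∈ U v, IsPair A v z o := by
      refine exists_congr fun z => and_congr_right fun hz => ?_
      simp only [IsPair, hA₁U z hz]
    by_cases h : ∃ z ∈ U v, IsPair A v z o
    · rw [if_pos (this.2 h)]
    · rw [if_neg (mt this.1 h), if_neg h]
  refine vc_opUp hF hdS (isOp_decr hF v) (A := A₁)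
    (hcA.congr (hd.arr _ (by simp)) (hd.arr _ (by simp))) (by rw [hd.var _ (by simp), hcv])
    (hU.nodup v) (fun z hz => by rw [hA₁U z hz]; exact hPup z hz) fun e he heA => ?_
  have heS := he.static hdS (by simp) (by simp) (by simp)
  have hev : e.var .v = v := by rw [he.var _ (by simp), hd.var _ (by simp), hcv]
  have hech : e.var .ch = c.var .ch := by rw [he.var _ (by simp), hd.var _ (by simp)]
  have hetop : e.var .top = a.var .top := by
    rw [he.var _ (by simp), hd.var _ (by simp), hc.var _ (by simp)]; simp [hbtop]
  have hearr : ∀ r, r ≠ .cnt → r ≠ .sum → r ≠ .mark → e.arr r = c.arr r := fun r h1 h2 h3 => by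
    rw [he.arr r (by simp [h1, h2]), hd.arr r (by simp [h3])]
  have hcarr : ∀ r, r ≠ .cnt → r ≠ .sum → r ≠ .mark → r ≠ .nxt → r ≠ .pr → r ≠ .und →
      c.arr r = a.arr r := fun r h1 h2 h3 h4 h5 h6 => by
    rw [hc.arr r (by simp [h1, h2, h4, h5, h6])]
    simp [hbarr, h3]
  simp only [hev, hetop, Ast.put_var, Ast.set_var, Ast.rem_var, Ast.rep_var, Ast.rep_arr,
    Ast.rem_arr, Ast.set_arr, Ast.put_arr, reduceCtorEq, if_false]
  refine ⟨by omega, by omega, by omega, ?_⟩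
  have hcur' : e.current = toNatSet s.X := by
    rw [he.current, hd.current, hc.current]
    simp [hb.current, hN.current]
  have hrep' : e.reported = a.reported := by
    rw [he.reported, hd.reported, hc.reported]
    simp [hb.reported]
  have hsets : (fun z => if z ∈ U v then (A₁ z).erase v else A₁ z) =
      childSets U (child G σ s v).C v A := by
    ext1 z
    have : z ∈ (child G σ s v).C ↔ z ∈ l ∧ ¬ Conflict G s.X z v := by
      rw [mem_child_C, hml]; tauto
    unfold childSets
    by_cases hzU : z ∈ U v
    · rw [if_pos hzU, if_pos (Or.inr hzU), hA₁U z hzU]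
    · simp only [hzU, if_false, or_false, this, hA₁]
  rw [hsets] at heA
  have hRv : ∀ R' : List (Fin n), (∀ u ∈ R', u ∈ ([] : List (Fin n)) ∨
      (u ∈ l ∧ Conflict G s.X u v)) → ∀ u ∈ R', (u : ℕ) ≠ v := by
    rintro R' h u hu h'
    have := (h u hu).resolve_left (by simp)
    rw [Fin.ext h'] at this
    exact lt_irrefl _ ((hml v).1 this.1).2
  refine hQ _ ⟨⟨heS.congr (by simp) (by simp) (by simp), heA.congr (by simp) (by simp), ?_,
    hN.approx.child hs hU hvC, ?_⟩, ?_, ?_, ?_, ?_, ?_, ?_, ?_, ?_, ?_⟩ ?_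
  · intro o
    simp [he.arr, hdm']
  · simp [hcur', hev, toNatSet_erase, child]
  · simpa [hearr] using hcp
  · simp [hearr, hcp.eq_hd]
  · simp
  · simp
  · obtain ⟨R', k1, k2, k3⟩ := hcR
    refine ⟨R', fun u hu hc => ?_, ?_, ?_⟩
    · exact (mem_child_C.1 hc).2.2 ((k1 u hu).resolve_left (by simp)).2
    · rw [← length_of_descending_eq hl]; simpa using k2
    · have := hRv R' k1
      simp only [Ast.set_arr, Ast.rep_arr, Ast.rem_arr, Ast.put_arr, reduceCtorEq, if_true,
        if_false, Function.update_self, hech]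
      rw [hearr .nxt (by simp) (by simp) (by simp)]
      refine k3.congr (fun u hu => ?_) fun u hu => ?_
      · rw [Function.update_of_ne (this u hu), hearr _ (by simp) (by simp) (by simp)]
      · rw [Function.update_of_ne (this u hu), hearr _ (by simp) (by simp) (by simp)]
  · intro i hi
    have h1 := hi v hvC
    have h2 := hcu i fun u hu _ => hi u ((hml u).1 hu).1
    simpa [h1, hearr, hbarr, Function.update_of_ne] using h2
  · simp [hearr, hcarr]
  · simp [hearr, hcarr]
  · simp [hrep', hcur', hev, toNatSet_erase, child]
  · have t1 := hb.time
    have t2 := hc.time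
    have t3 := hd.time
    have t4 := he.time
    have t5 := hK v
    have t6 : (child G σ s v).C.card = (l.filter fun u => ¬ Conflict G s.X u v).length := by
      rw [← hkept, ← List.toFinset_card_of_nodup (descending_nodup _)]
      congr 1
      ext u
      rw [List.mem_toFinset, mem_descending]
    have t7 := length_of_descending_eq hl
    rw [← t6] at t2
    simp only [Ast.set_time, Ast.rep_time, Ast.rem_time, Ast.put_time, Expr.cost] at t1 t2 t3 t4 ⊢
    omega

end Search

section Search

variable {Λ : Layout} {n : ℕ} {Q : Ast → Prop} {U : Fin n → List (Fin n)}
  {G : SimpleGraph (Fin n)} [DecidableRel G.Adj] {σ : Equiv.Perm (Fin n)}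

/-- `A` and `B` are the counted sets before and after the removal of `v`. The sets at the kept
candidates are restored before relinking, while the list still consists of these candidates. -/
theorem vc_leave (hF : Λ.Fits n) (hnd : ∀ u, (U u).Nodup) {K : ℕ} (hK : ∀ u, (U u).length ≤ K)
    {v : Fin n} {l : List (Fin n)} (hl : l.Nodup) {A B : Fin n → Finset (Fin n)}
    (hAB : ∀ w, A w = if w ∈ U v ∨ (w ∈ l ∧ v ∈ U w) then insert v (B w) else B w)
    (hBv : ∀ z ∈ U v, v ∉ B z) (hlv : ∀ u ∈ l, u ∉ U v) (hBl : ∀ u ∈ l, v ∈ U u → v ∉ B u)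
    {a : Ast} (hS : Static Λ U a) (hB : Counts a B) (htop : a.var .top = v)
    (hp : Path (a.arr .nxt) v l) {nx₀ : ℕ → ℕ} {R : List (Fin n)}
    (hR : Undo (a.arr .pr) (a.arr .und) nx₀ R (a.arr .und v) (a.arr .nxt))
    (hQ : ∀ b : Ast, Static Λ U b → Counts b A → b.arr .nxt = nx₀ → b.arr .mark = a.arr .mark →
      b.arr .pr = a.arr .pr → b.arr .und = a.arr .und → b.var .cur = nx₀ v →
      b.var .top = a.arr .pr v → b.current = insert (v : ℕ) a.current →
      b.reported = a.reported →
      b.time ≤ a.time + (60 + 60 * K + 30 * R.length + (40 + 60 * K) * l.length) → Q b) :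
    Λ.vc leave Q a := by
  have l1 := hF.lt_len .nxt (by simp)
  have l2 := hF.lt_len .pr (by simp)
  have l3 := hF.lt_len .und (by simp)
  have hv := v.2
  simp only [leave, Layout.vc, Expr.ok, Expr.eval]
  refine ⟨trivial, ?_⟩
  refine vc_opUp (a := a.set .v (a.var .top) _) hF (hS.congr (by simp) rfl rfl) (isOp_incr hF v)
    (hB.congr rfl rfl) (by simp [htop]) (hnd v) hBv fun b hb hbB => ?_
  have hbS := hb.static (hS.congr (by simp) rfl rfl) (by simp) (by simp) (by simp)
  have hbv : b.var .v = v := by rw [hb.var _ (by simp)]; simp [htop]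
  have hbarr : ∀ r, r ≠ .cnt → r ≠ .sum → b.arr r = a.arr r := fun r h1 h2 =>
    hb.arr r (by simp [h1, h2])
  refine ⟨⟨trivial, by omega⟩, ?_⟩
  refine wp_resweep (v := v) hF hnd hK l _ _ (hbS.congr (by simp) rfl rfl) (hbB.congr rfl rfl)
    (by simp [hbv]) (by simp [hbarr, hbv, hp.eq_hd]) hl ⟨v, by simpa [hbarr] using hp⟩
    (fun u hu hvu => by rw [if_neg (hlv u hu)]; exact hBl u hu hvu) fun c hc hcA => ?_
  have hcS := hc.static (hbS.congr (by simp) rfl rfl) (by simp) (by simp) (by simp)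
  have hcv : c.var .v = v := by rw [hc.var _ (by simp)]; simp [hbv]
  have hcarr : ∀ r, r ≠ .cnt → r ≠ .sum → c.arr r = a.arr r := fun r h1 h2 => by
    rw [hc.arr r (by simp [h1, h2])]; simp [hbarr, h1, h2]
  refine ⟨⟨trivial, by omega⟩, ?_⟩
  refine wp_relink hF nx₀ R _ (by simp [hcS.var_n]) (by simpa [hcarr, hcv] using hR)
    fun d hd hdn => ?_
  have hdv : d.var .v = v := by rw [hd.var _ (by simp)]; simp [hcv]
  have hdarr : ∀ r, r ≠ .cnt → r ≠ .sum → r ≠ .nxt → d.arr r = a.arr r := fun r h1 h2 h3 => by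
    rw [hd.arr r (by simp [h3])]; simp [hcarr, h1, h2]
  have hdS := hd.static (hcS.congr (by simp) rfl rfl) (by simp) (by simp) (by simp)
  simp only [Ast.ins_var, Ast.set_var, Ast.ins_arr, Ast.set_arr, hdv, reduceCtorEq, if_false]
  refine ⟨⟨trivial, by omega⟩, ⟨trivial, by omega⟩, ?_⟩
  refine hQ _ (hdS.congr (by simp) rfl rfl) (Counts.congr (a := c) ?_ ?_ ?_) (by simpa using hdn)
    ?_ ?_ ?_ ?_ ?_ ?_ ?_ ?_
  · convert hcA using 1
    ext1 w
    rw [hAB]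
    by_cases h1 : w ∈ U v
    · have : w ∉ l := fun h => hlv w h h1
      simp [h1, this]
    · by_cases h2 : w ∈ l ∧ v ∈ U w <;> simp [h1, h2]
  · simp [hd.arr]
  · simp [hd.arr]
  · simp [hdarr]
  · simp [hdarr]
  · simp [hdarr]
  · simp [hdn]
  · simp [hdarr]
  · simp [hd.current, hc.current, hb.current, hdv]
  · simp [hd.reported, hc.reported, hb.reported]
  · have t1 := hb.time
    have t2 := hc.time
    have t3 := hd.time
    have t5 := hK v
    simp only [Ast.set_time, Ast.ins_time, Expr.cost] at t1 t2 t3 ⊢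
    omega

/-- A bound for the time between the moment when `v` is removed from the solution of `s` and the
moment when it is inserted again, apart from the time spent on the subtree below. -/
def stepCost (G : SimpleGraph (Fin n)) [DecidableRel G.Adj] (σ : Equiv.Perm (Fin n)) (K : ℕ)
    (s : Call n) (v : Fin n) : ℕ :=
  200 + 240 * K + 130 * (below σ s.C v).card + (40 + 120 * K) * (child G σ s v).C.card

/-- A bound for the time spent on the subtree below `s`. -/
def treeCost (G : SimpleGraph (Fin n)) [DecidableRel G.Adj] (σ : Equiv.Perm (Fin n)) (K : ℕ)
    (s : Call n) : ℕ :=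
  ((allChildren G σ s).map fun t => ((descending σ t.C).map (stepCost G σ K t)).sum).sum

theorem treeCost_eq (K : ℕ) (s : Call n) :
    treeCost G σ K s = ((descending σ s.C).map fun v =>
      stepCost G σ K s v + treeCost G σ K (child G σ s v)).sum := by
  rw [treeCost, allChildren_eq, List.map_cons, List.sum_cons, List.sum_map_add, List.map_flatMap,
    List.flatMap_def, List.sum_flatten, List.map_map]
  rfl

/-- A single loop simulates the recursion, so the claim is in continuation form: from the state in
which the tail `l` of the candidates of `s` is still to be processed, the loop reaches a state with
everything needed restored and the reports of these subtrees added. The outer induction runs over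
the tree of calls, the inner one over `l`. Below `s`, the arrays `pr` and `und` are written only at
candidates of `s`; this protects the stack frames of the ancestors and the chains of candidates
unlinked by them. -/
theorem wp_search (hF : Λ.Fits n) (hU : UpLists G σ U) {K : ℕ} (hK : ∀ u, (U u).length ≤ K)
    (s : Call n) : s.Valid G σ → ∀ (l l₀ : List (Fin n)) (A : Fin n → Finset (Fin n)) (a : Ast)
      (Q : Ast → Prop), descending σ s.C = l₀ ++ l → Node Λ G U s A a → a.var .cur = hd l →
      (∃ p, Path (a.arr .nxt) p l) → a.var .top ≤ n →
      (∀ b, Node Λ G U s A b → b.var .cur = n → b.var .top = a.var .top →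
        b.arr .nxt = a.arr .nxt →
        (∀ i : ℕ, (∀ u ∈ s.C, i ≠ u) →
          b.arr .pr i = a.arr .pr i ∧ b.arr .und i = a.arr .und i) →
        b.reported = a.reported ++ l.flatMap (fun v =>
          (allChildren G σ (child G σ s v)).map fun t => toNatSet t.X) →
        b.time ≤ a.time +
          (l.map fun v => stepCost G σ K s v + treeCost G σ K (child G σ s v)).sum →
        Λ.wp search Q b) →
      Λ.wp search Q a := by
  have hW := hF.lt_W
  induction s using allChildren_induction (G := G) (σ := σ) with
  | h s ih =>
    intro hs l
    induction l with
    | nil =>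
      intro l₀ A a Q hl hN hcur hp htop hQ
      exact hQ a hN hcur rfl rfl (fun i _ => ⟨rfl, rfl⟩) (by simp) (by simp)
    | cons v l ihl =>
      rintro l₀ A a Q hl hN hcur ⟨p, hp⟩ htop hQ
      have hv := v.2
      have hcur' : a.var .cur = v := hcur
      have hvC := mem_of_descending_eq' hl
      have hvX := (hs.mem_C hvC).1
      have hmem : ∀ u, u ∈ descending σ (child G σ s v).C ↔ u ∈ (child G σ s v).C :=
        fun u => mem_descending
      -- `n` marks the end of the candidate list as well as the bottom of the stack. Both `cur` and
      -- `top` are at most `n`, so their sum is below `2n` unless both have reached the marker.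
      refine Layout.wp_whl_true (by simp [hcur', hN.static.var_n]; omega)
        (by simp [hcur', hN.static.var_n]; omega) (Layout.wp_of_vc ?_)
      simp only [Layout.vc, Cond.ok, Expr.ok, Cond.holds, Expr.eval, Ast.tick_var, hcur',
        hN.static.var_n]
      refine ⟨⟨trivial, trivial⟩, fun _ => ?_, fun h => absurd hv h⟩
      refine vc_enter hF hU hK hs ⟨hN.static.congr rfl rfl rfl, hN.counts.congr rfl rfl, hN.mark,
        hN.approx, hN.current⟩ hl hcur' (by simpa using hp.2) fun b hb hbt => ?_
      simp only [Ast.tick_time, Cond.cost, Expr.cost] at hbt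
      refine ih v hvC (hs.child hvC) (descending σ (child G σ s v).C) [] _ b Q rfl hb.node hb.cur ⟨v, hb.path⟩
        (by rw [hb.top]; omega) fun c hc hccur hctop hcnxt hclinks hcrep hct => ?_
      rw [← treeCost_eq] at hct
      have hvC' : ∀ u ∈ (child G σ s v).C, (v : ℕ) ≠ u := fun u hu h => by
        rw [← Fin.ext h] at hu
        exact lt_irrefl _ (mem_child_C.1 hu).2.1
      obtain ⟨R, hR1, hR2, hR3⟩ := hb.undo
      refine Layout.wp_whl_true (by simp [hccur, hctop, hb.top, hc.static.var_n]; omega)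
        (by simp [hccur, hctop, hb.top, hc.static.var_n]) (Layout.wp_of_vc ?_)
      simp only [Layout.vc, Cond.ok, Expr.ok, Cond.holds, Expr.eval, Ast.tick_var, hccur,
        hc.static.var_n]
      refine ⟨⟨trivial, trivial⟩, fun h => absurd h (lt_irrefl _), fun _ => ?_⟩
      have hCU : ∀ u ∈ (child G σ s v).C, u ∉ U v := fun u hu hc => by
        have h1 := (mem_child_C.1 hu).2.1
        rcases (hU.mem_iff _ _).1 hc with rfl | h
        · exact lt_irrefl _ h1
        · exact lt_asymm h.2 h1
      have hAup : ∀ z ∈ U v, v ∈ A z := fun z hz => hN.approx.mem_of_mem_up hU hvX hz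
      refine vc_leave (v := v) (l := descending σ (child G σ s v).C) (A := A) (R := R)
        (nx₀ := a.arr .nxt) hF hU.nodup hK (descending_nodup _) ?_ ?_ ?_ ?_
        (hc.static.congr rfl rfl rfl) (hc.counts.congr rfl rfl) (by simp [hctop, hb.top]) ?_ ?_ ?_
      · intro w
        have h1 := hAup w
        have h2 : w ∈ (child G σ s v).C → (v ∈ A w ↔ v ∈ U w) := fun hw =>
          hN.approx.mem_iff_mem_up hs hU hvC (mem_child_C.1 hw).1 (mem_child_C.1 hw).2.1
        simp only [childSets, hmem]
        by_cases hw : w ∈ U v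
        · simp [hw, h1 hw]
        · by_cases hw' : w ∈ (child G σ s v).C
          · by_cases hvw : v ∈ U w
            · simp [hw, hw', hvw, (h2 hw').2 hvw]
            · simp [hw, hw', hvw, mt (h2 hw').1 hvw]
          · simp [hw, hw']
      · intro z hz
        simp [childSets, hz]
      · exact fun u hu => hCU u ((hmem u).1 hu)
      · intro u hu _
        simp [childSets, (hmem u).1 hu]
      · simpa [hcnxt] using hb.path
      · simp only [Ast.tick_arr, hcnxt]
        rw [(hclinks v hvC').2]
        refine hR3.congr (fun u hu => ?_) fun u hu => ?_
        -- Unlinked vertices are not candidates of the child, so the traversal of its subtree did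
        -- not overwrite their undo records.
        · exact (hclinks u fun w hw h => hR1 u hu (by rwa [Fin.ext h])).1
        · exact (hclinks u fun w hw h => hR1 u hu (by rwa [Fin.ext h])).2
      · intro d hdS hdA hdnxt hdmark hdpr hdund hdcur hdtop hdc hdrep hdt
        simp only [Ast.tick_arr, Ast.tick_current, Ast.tick_reported, Ast.tick_time, Cond.cost,
          Expr.cost] at hdmark hdpr hdund hdtop hdc hdrep hdt
        have hdtop' : d.var .top = a.var .top := by
          rw [hdtop, (hclinks v hvC').1, hb.pr]; simp
        have hlinks : ∀ i : ℕ, (∀ u ∈ s.C, i ≠ u) →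
            d.arr .pr i = a.arr .pr i ∧ d.arr .und i = a.arr .und i := fun i hi => by
          have h1 := hclinks i fun u hu => hi u (mem_child_C.1 hu).1
          have h2 := hb.links i hi
          rw [hdpr, hdund, h1.1, h1.2, h2.1, h2.2]
          simp
        refine ihl (l₀ ++ [v]) A d Q (by simp [hl]) ⟨hdS, hdA, ?_, hN.approx, ?_⟩ ?_ ⟨v, ?_⟩
          (by rw [hdtop']; exact htop) ?_
        · intro o
          rw [hdmark, hc.mark]
        · rw [hdc, hc.current]
          simp only [child]
          rw [← toNatSet_erase, Finset.insert_erase]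
          exact Finset.mem_map.2 ⟨v, hvX, rfl⟩
        · rw [hdcur]; exact hp.2.eq_hd
        · rw [hdnxt]; exact hp.2
        · intro e heN hecur hetop henxt helinks herep het
          refine hQ e heN hecur (hetop.trans hdtop') (henxt.trans hdnxt) (fun i hi => ?_) ?_ ?_
          · rw [(helinks i hi).1, (helinks i hi).2]
            exact hlinks i hi
          · rw [herep, hdrep, hcrep, hb.reported, List.flatMap_cons,
              allChildren_eq (child G σ s v), List.map_cons, List.map_flatMap]
            simp
          · have hkept : (descending σ (child G σ s v).C).length = (child G σ s v).C.card := by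
              rw [← List.toFinset_card_of_nodup (descending_nodup _)]
              congr 1
              ext u
              rw [List.mem_toFinset, mem_descending]
            rw [hkept] at hdt
            rw [List.map_cons, List.sum_cons]
            have hm : (40 + 120 * K) * (child G σ s v).C.card =
              60 * K * (child G σ s v).C.card + (40 + 60 * K) * (child G σ s v).C.card := by ring
            have hs : stepCost G σ K s v = 200 + 240 * K + 130 * (below σ s.C v).card +
              (40 + 120 * K) * (child G σ s v).C.card := rfl
            omega

end Search

/-! ### Amortized cost over the tree of solutions -/

section Cost

variable {n : ℕ} {G : SimpleGraph (Fin n)} [DecidableRel G.Adj] {σ : Equiv.Perm (Fin n)}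
  {U : Fin n → List (Fin n)}

theorem sum_map_descending (C : Finset (Fin n)) (f : Fin n → ℕ) :
    ((descending σ C).map f).sum = ∑ v ∈ C, f v := by
  rw [← List.sum_toFinset _ (descending_nodup C)]
  congr 1
  ext u
  rw [List.mem_toFinset, mem_descending]

/-- A witness is `v` or a missing neighbour of `v`, which is larger than `v`; so it lies in `U v`.
Each witness determines `u`. -/
theorem card_del2_le (hU : UpLists G σ U) {s : Call n} (hs : s.Valid G σ) {v : Fin n}
    (hv : v ∈ s.C) : (del2 G σ s v).card ≤ (U v).length := by
  have hsub : del2 G σ s v ⊆ (U v).toFinset.biUnion fun w =>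
      Finset.univ.filter fun u => u ≠ v ∧ closedNbhd G w ∩ s.X = {u, v} := by
    intro u hu
    simp only [del2, below, Finset.mem_filter] at hu
    obtain ⟨⟨-, huv⟩, w, hw, h⟩ := hu
    simp only [Finset.mem_biUnion, List.mem_toFinset, Finset.mem_filter, Finset.mem_univ,
      true_and]
    refine ⟨w, (hU.mem_iff _ _).2 ?_, by rintro rfl; exact lt_irrefl _ huv, h⟩
    by_cases hwv : w = v
    · exact Or.inl hwv
    · right
      have h1 : v ∈ closedNbhd G w ∩ s.X := by rw [h]; simp
      rw [Finset.mem_inter, mem_closedNbhd] at h1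
      exact ⟨(h1.1.resolve_left fun h => hwv h.symm).symm,
        (hs.mem_C hv).2.1 w fun hX => hw (Finset.mem_erase.2 ⟨hwv, hX⟩)⟩
  refine (Finset.card_le_card hsub).trans ((Finset.card_biUnion_le_card_mul _ _ 1 ?_).trans ?_)
  · intro w _
    rw [Finset.card_le_one]
    intro u hu u' hu'
    simp only [Finset.mem_filter, Finset.mem_univ, true_and] at hu hu'
    have : u ∈ ({u', v} : Finset (Fin n)) := by rw [← hu'.2, hu.2]; simp
    simpa [hu.1] using this
  · rw [mul_one]
    exact List.toFinset_card_le _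

/-- The equation `N[u] ∩ X = {u, v}` determines `v` from `u`, so every candidate is deleted by this
rule for at most one `v`. A single `v` may delete many, whence the sum over all `v`. -/
theorem sum_card_del1_le (s : Call n) : ∑ v ∈ s.C, (del1 G σ s v).card ≤ s.C.card := by
  rw [← Finset.card_biUnion]
  · apply Finset.card_le_card
    intro u hu
    simp only [Finset.mem_biUnion, del1, below, Finset.mem_filter] at hu
    obtain ⟨v, -, h⟩ := hu
    exact h.1.1
  · intro v _ v' _ hvv'
    rw [Function.onFun, Finset.disjoint_left]
    intro u hu hu'
    simp only [del1, below, Finset.mem_filter] at hu hu'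
    have : v ∈ ({u, v'} : Finset (Fin n)) := by rw [← hu'.2, hu.2]; simp
    simp only [Finset.mem_insert, Finset.mem_singleton, hvv', or_false] at this
    rw [this] at hu
    exact lt_irrefl _ hu.1.2

theorem card_below_le (s : Call n) (v : Fin n) : (below σ s.C v).card ≤
    (child G σ s v).C.card + (del1 G σ s v).card + (del2 G σ s v).card := by
  have : below σ s.C v ⊆ (child G σ s v).C ∪ (del1 G σ s v ∪ del2 G σ s v) := by
    intro u hu
    simp only [below, Finset.mem_filter] at hu
    rw [Finset.mem_union, mem_del1_or_del2, mem_child_C]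
    tauto
  have h1 := Finset.card_le_card this
  have h2 := Finset.card_union_le (child G σ s v).C (del1 G σ s v ∪ del2 G σ s v)
  have h3 := Finset.card_union_le (del1 G σ s v) (del2 G σ s v)
  omega

theorem sum_stepCost_le (hU : UpLists G σ U) {K : ℕ} (hK : ∀ u, (U u).length ≤ K) {s : Call n}
    (hs : s.Valid G σ) : ∑ v ∈ s.C, stepCost G σ K s v ≤
      (330 + 370 * K) * s.C.card + (170 + 120 * K) * ∑ v ∈ s.C, (child G σ s v).C.card := by
  -- The 130 units for each smaller candidate are passed on to its class: `370 = 240 + 130` by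
  -- `card_del2_le`, and `170 = 40 + 130` for those that remain.
  have h1 : ∀ v ∈ s.C, stepCost G σ K s v ≤ (200 + 370 * K) + 130 * (del1 G σ s v).card +
      (170 + 120 * K) * (child G σ s v).C.card := by
    intro v hv
    have h2 := card_below_le (G := G) (σ := σ) s v
    have h3 := card_del2_le hU hs hv
    have h4 := hK v
    unfold stepCost
    nlinarith
  refine (Finset.sum_le_sum h1).trans ?_
  rw [Finset.sum_add_distrib, Finset.sum_add_distrib, Finset.sum_const, ← Finset.mul_sum,
    ← Finset.mul_sum, smul_eq_mul]
  have := sum_card_del1_le (G := G) (σ := σ) s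
  nlinarith

/-- Every call in the tree except the first is the child of one call for one of its candidates. -/
theorem sum_allChildren (f : Call n → ℕ) (s : Call n) :
    ((allChildren G σ s).map fun t => ∑ v ∈ t.C, f (child G σ t v)).sum + f s =
      ((allChildren G σ s).map f).sum := by
  induction s using allChildren_induction (G := G) (σ := σ) with
  | h s ih =>
    have key : ∀ g : Call n → ℕ, ((allChildren G σ s).map g).sum =
        g s + ∑ v ∈ s.C, ((allChildren G σ (child G σ s v)).map g).sum := fun g => by
      rw [allChildren_eq, List.map_cons, List.sum_cons, List.map_flatMap, List.flatMap_def,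
        List.sum_flatten, List.map_map, ← sum_map_descending (σ := σ)]
      rfl
    rw [key, key, ← Finset.sum_congr rfl ih, Finset.sum_add_distrib]
    omega

/-- By `sum_allChildren` with `f = 1`, the numbers of candidates add up to the number of calls minus
one. With `f = |C|`, the candidates of all children add up to no more than that. -/
theorem treeCost_le (hU : UpLists G σ U) {K : ℕ} (hK : ∀ u, (U u).length ≤ K) {s : Call n}
    (hs : s.Valid G σ) :
    treeCost G σ K s ≤ (500 + 490 * K) * ((allChildren G σ s).length - 1) := by
  have h1 : treeCost G σ K s ≤
      ((allChildren G σ s).map fun t => (330 + 370 * K) * t.C.card +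
        (170 + 120 * K) * ∑ v ∈ t.C, (child G σ t v).C.card).sum := by
    unfold treeCost
    refine List.sum_le_sum fun t ht => ?_
    rw [sum_map_descending]
    exact sum_stepCost_le hU hK (valid_of_mem_allChildren hs t ht)
  rw [List.sum_map_add, List.sum_map_mul_left, List.sum_map_mul_left] at h1
  have h2 := sum_allChildren (G := G) (σ := σ) (fun _ => 1) s
  have h3 := sum_allChildren (G := G) (σ := σ) (fun t => t.C.card) s
  simp only [Finset.sum_const, smul_eq_mul, mul_one, List.map_const', List.sum_replicate] at h2
  have h4 : ((allChildren G σ s).map fun t => t.C.card).sum =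
    (allChildren G σ s).length - 1 := by omega
  rw [h4] at h1 h3
  have h5 : ((allChildren G σ s).map fun t => ∑ v ∈ t.C, (child G σ t v).C.card).sum ≤
    (allChildren G σ s).length - 1 := by omega
  refine h1.trans ?_
  have := Nat.mul_le_mul_left (170 + 120 * K) h5
  calc _ ≤ (330 + 370 * K) * ((allChildren G σ s).length - 1) +
        (170 + 120 * K) * ((allChildren G σ s).length - 1) := by omega
    _ = _ := by ring

theorem UpLists.length_le (hU : UpLists G σ U) {k : ℕ} (hk : IsDegeneracyOrdering G σ k)
    (v : Fin n) : (U v).length ≤ k + 1 := by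
  rw [← List.toFinset_card_of_nodup (hU.nodup v)]
  have : (U v).toFinset ⊆ insert v (above σ (G.neighborFinset v) v) := by
    intro w hw
    rw [List.mem_toFinset, hU.mem_iff] at hw
    simpa [above] using hw
  exact (Finset.card_le_card this).trans ((Finset.card_insert_le _ _).trans
    (Nat.add_le_add_right (hk v) 1))

/-- For `k = 0` there are no edges, so no candidates and no cost. For `k ≥ 1`, the factor `500 + 490
(k + 1)` is at most `1480 k`. -/
theorem treeCost_rootCall_le (hU : UpLists G σ U) {k : ℕ} (hk : IsDegeneracyOrdering G σ k) :
    treeCost G σ (k + 1) (rootCall G) ≤ 1480 * (k * (dominatingSets G).card) := by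
  have h1 := treeCost_le hU (hU.length_le hk) (rootCall_valid (G := G) (σ := σ))
  have h2 := edsd_length (G := G) (σ := σ)
  rw [edsd] at h2
  rw [h2] at h1
  rcases Nat.eq_zero_or_pos k with rfl | hpos
  · have hC : (rootCall G).C = ∅ := by
      rw [Finset.eq_empty_iff_forall_notMem]
      intro v hv
      simp only [rootCall, Finset.mem_filter, Finset.mem_univ, true_and] at hv
      obtain ⟨u, hu⟩ := hv
      have hnone : ∀ x y, G.Adj x y → ¬ σ x < σ y := fun x y hxy hlt => by
        have := hk x
        rw [Nat.le_zero, Finset.card_eq_zero] at this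
        have hy : y ∈ above σ (G.neighborFinset x) x := by simp [above, hxy, hlt]
        simp [this] at hy
      rw [SimpleGraph.mem_neighborFinset] at hu
      rcases lt_trichotomy (σ u) (σ v) with h | h | h
      · exact hnone u v hu.symm h
      · exact hu.ne (σ.injective h).symm
      · exact hnone v u hu h
    rw [treeCost, allChildren_eq, hC]
    simp [descending, hC]
  · refine h1.trans ?_
    have h3 : (dominatingSets G).card - 1 ≤ (dominatingSets G).card := Nat.sub_le _ _
    calc (500 + 490 * (k + 1)) * ((dominatingSets G).card - 1)
        ≤ (1480 * k) * (dominatingSets G).card := Nat.mul_le_mul (by omega) h3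
      _ = _ := by ring

end Cost

/-- Report all dominating sets. -/
def enumerate : Prog :=
  .report ;; .asg .cur (.arr .nxt (.var .n)) ;; .asg .top (.var .n) ;; search

theorem vc_enumerate {Λ : Layout} {n : ℕ} {G : SimpleGraph (Fin n)} [DecidableRel G.Adj]
    {σ : Equiv.Perm (Fin n)} {U : Fin n → List (Fin n)} (hF : Λ.Fits n) (hU : UpLists G σ U)
    {K : ℕ} (hK : ∀ u, (U u).length ≤ K) {A : Fin n → Finset (Fin n)} {a : Ast} {Q : Ast → Prop}
    (hN : Node Λ G U (rootCall G) A a)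
    (hp : Path (a.arr .nxt) n (descending σ (rootCall G).C))
    (hQ : ∀ b : Ast, b.reported = a.reported ++ (edsd G σ).map (fun s => toNatSet s.X) →
      b.time ≤ a.time + treeCost G σ K (rootCall G) + 20 → Q b) :
    Λ.vc enumerate Q a := by
  have l1 := hF.lt_len .nxt (by simp)
  have hW := hF.lt_W
  have hn := hN.static.var_n
  simp only [enumerate, Layout.vc, Expr.ok, Expr.eval, Ast.rep_var, Ast.rep_arr, hn]
  refine ⟨⟨trivial, l1⟩, trivial, ?_⟩
  refine wp_search hF hU hK (rootCall G) rootCall_valid (descending σ (rootCall G).C) [] A _ _ rfl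
    ⟨hN.static.congr (by simp) rfl rfl, hN.counts.congr rfl rfl, hN.mark, hN.approx, hN.current⟩
    (by simp [hp.eq_hd]) ⟨n, by simpa using hp⟩ (by simp [hn]) fun b hb hbcur hbtop _ _ hbr hbt => ?_
  have hbn := hb.static.var_n
  have hbtop' : b.var .top = n := by rw [hbtop]; simp [hn]
  refine Layout.wp_whl_false (by simp [hbcur, hbtop', hbn]; omega)
    (by simp [hbcur, hbtop', hbn]) (hQ _ ?_ ?_)
  · rw [edsd, allChildren_eq, List.map_cons, List.map_flatMap]
    simp [hbr, hN.current]
  · rw [← treeCost_eq] at hbt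
    simp only [Ast.tick_time, Ast.set_time, Ast.rep_time, Cond.cost, Expr.cost] at hbt ⊢
    omega

/-! ## The preprocessing program -/

/-- For every neighbour `u` of `v`. -/
def eachNbr (p : Prog) : Prog :=
  .asg .i (.arr .inp (.add (.var .v) (.lit 1))) ;; .asg .h (.arr .inp (.add (.var .v) (.lit 2))) ;;
  .each .i .h .u .inp p

/-- Give the next number to `u`. -/
def enqueue : Prog :=
  .put .ord (.var .tail) (.var .u) ;; .put .pos (.var .u) (.var .tail) ;;
  .asg .tail (.add (.var .tail) (.lit 1))

/-- Degrees of vertices already in the queue are lowered too. These are at most `d`, so after the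
decrement equality holds exactly for a vertex that drops from `d + 1`, and no vertex enters twice.
-/
def relax : Prog :=
  .put .deg (.var .u) (.sub (.arr .deg (.var .u)) (.lit 1)) ;;
  .ite (.eq (.arr .deg (.var .u)) (.var .d)) enqueue .skip

/-- Remove the next vertex of the queue from the graph. -/
def expand : Prog :=
  .asg .v (.arr .ord (.var .head)) ;; .asg .head (.add (.var .head) (.lit 1)) ;; eachNbr relax

def exhaust : Prog := .whl (.lt (.var .head) (.var .tail)) expand

/-- Enqueue the vertices of degree `d`, and keep those of larger degree in the list. -/
def scan : Prog :=
  .asg .i (.lit 0) ;; .asg .p (.lit 0) ;;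
  .whl (.lt (.var .i) (.var .len))
    (.asg .u (.arr .lst (.var .i)) ;;
      .ite (.lt (.var .d) (.arr .deg (.var .u)))
        (.put .lst (.var .p) (.var .u) ;; .asg .p (.add (.var .p) (.lit 1)))
        (.ite (.eq (.arr .deg (.var .u)) (.var .d)) enqueue .skip) ;;
      .asg .i (.add (.var .i) (.lit 1))) ;;
  .asg .len (.var .p)

def peel : Prog :=
  .whl (.lt (.var .tail) (.var .n))
    (scan ;; exhaust ;; .asg .d (.add (.var .d) (.lit 1)))

/-! ### Degeneracy ordering by peeling -/

section Peel

variable {Λ : Layout} {n : ℕ} {a : Ast} {Q : Ast → Prop} {G : SimpleGraph (Fin n)}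
  {L : AdjLists G}

/-- The array `inp` holds the adjacency lists. -/
structure Input (Λ : Layout) (L : AdjLists G) (a : Ast) : Prop where
  var_n : a.var .n = n
  lo : ∀ v : Fin n, a.arr .inp (v + 1) = L.offset v
  hi : ∀ v : Fin n, a.arr .inp (v + 2) = L.offset v + (L.list v).length
  seg : ∀ v : Fin n, Seg (a.arr .inp) (L.offset v) (L.list v)
  le : ∀ v : Fin n, L.offset v + (L.list v).length ≤ Λ.len .inp
  lt : n + 1 < Λ.len .inp

theorem Input.congr {a b : Ast} (h : Input Λ L a) (h1 : b.var .n = a.var .n)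
    (h2 : b.arr .inp = a.arr .inp) : Input Λ L b :=
  ⟨h1.trans h.var_n, by rw [h2]; exact h.lo, by rw [h2]; exact h.hi, by rw [h2]; exact h.seg,
    h.le, h.lt⟩

theorem vc_eachNbr (hF : Λ.Fits n) (hI : Input Λ L a) {p : Prog} {v : Fin n}
    (hv : a.var .v = v) {vs vs' : List Var} {rs : List Arr} {c : ℕ}
    (hvs : ∀ z, z = .i ∨ z = .h ∨ z = .u ∨ z ∈ vs' → z ∈ vs) (hi' : Var.i ∉ vs') (hh' : Var.h ∉ vs')
    (hr : Arr.inp ∉ rs)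
    (J : List (Fin n) → Ast → Prop) (hJ : ∀ l b b', b'.arr = b.arr →
      (∀ z, z ≠ .i → z ≠ .h → z ≠ .u → b'.var z = b.var z) → J l b → J l b')
    (h0 : J [] a)
    (step : ∀ (l₁ : List (Fin n)) (z : Fin n) (l₂ : List (Fin n)), L.list v = l₁ ++ z :: l₂ →
      ∀ b k, Frame vs rs k a b → J l₁ b → b.var .u = z →
      Λ.vc p (fun b' => Frame vs' rs c b b' ∧ J (l₁ ++ [z]) b') b)
    (fin : ∀ b, Frame vs rs (20 + (c + 11) * (L.list v).length) a b → J (L.list v) b → Q b) :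
    Λ.vc (eachNbr p) Q a := by
  have h1 := hI.lt
  have h2 := hF.lt_W
  have h3 := v.2
  have hiv := hvs .i (by simp)
  have hhv := hvs .h (by simp)
  simp only [eachNbr, Layout.vc, Expr.ok, Expr.eval, Expr.cost, hv, Ast.set_var, Ast.set_arr,
    reduceCtorEq, if_false, true_and]
  refine ⟨⟨⟨by norm_num, by omega⟩, by omega⟩, ⟨⟨le_rfl, by omega⟩, by omega⟩, ?_⟩
  rw [hI.lo, hI.hi]
  generalize hb₀ : (a.set .i (L.offset v) _).set .h _ _ = b₀
  have hfr : Frame vs rs 14 a b₀ := by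
    subst hb₀
    refine ⟨fun z hz => ?_, fun r hr => by simp, rfl, rfl, by simp⟩
    have hz1 : z ≠ .i := by rintro rfl; exact hz hiv
    have hz2 : z ≠ .h := by rintro rfl; exact hz hhv
    simp [hz1, hz2]
  have hi0 : b₀.var .i = L.offset v := by subst hb₀; simp
  have hh0 : b₀.var .h = L.offset v + (L.list v).length := by subst hb₀; simp
  have harr : b₀.arr = a.arr := by subst hb₀; simp
  have hvar : ∀ z, z ≠ .i → z ≠ .h → b₀.var z = a.var z := by
    subst hb₀; intro z h1 h2; simp [h1, h2]
  refine vc_each (l := L.list v) (c := c) (fun z hz => hvs z (by tauto)) hi' hh' hr (by simp)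
    (by simp) (by simp) (by rw [hh0, hi0]) (by rw [hi0, harr]; exact hI.seg v)
    (by rw [hi0]; exact hI.le v) J
    (fun l b b' hb hb' => hJ l b b' hb fun z h1 _ h3 => hb' z h1 h3)
    (hJ _ a _ harr (fun z h1 h2 _ => hvar z h1 h2) h0) ?_ ?_
  · exact fun l₁ z l₂ hl b k hb => step l₁ z l₂ hl b _
      (hfr.trans hb (fun _ h => h.elim id id) fun _ h => h.elim id id)
  · intro b hb
    exact fin b ((hfr.trans hb (fun _ h => h.elim id id) fun _ h => h.elim id id).mono (by omega))

/-- The list `q` holds the vertices that have been numbered so far. -/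
structure Queue (q : List (Fin n)) (a : Ast) : Prop where
  tail : a.var .tail = q.length
  nodup : q.Nodup
  ord : ∀ i (h : i < q.length), a.arr .ord i = q[i]
  pos : ∀ i (h : i < q.length), a.arr .pos q[i] = i

theorem Queue.congr {q : List (Fin n)} {a b : Ast} (h : Queue q a)
    (h1 : b.var .tail = a.var .tail) (h2 : b.arr .ord = a.arr .ord)
    (h3 : b.arr .pos = a.arr .pos) : Queue q b :=
  ⟨h1.trans h.tail, h.nodup, by rw [h2]; exact h.ord, by rw [h3]; exact h.pos⟩

theorem Queue.length_le {q : List (Fin n)} (h : Queue q a) : q.length ≤ n := by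
  simpa using h.nodup.length_le_card

theorem vc_enqueue (hF : Λ.Fits n) {q : List (Fin n)} (hq : Queue q a) {u : Fin n}
    (hu : a.var .u = u) (huq : u ∉ q)
    (hQ : ∀ b, Frame [.tail] [.ord, .pos] 12 a b → Queue (q ++ [u]) b → Q b) :
    Λ.vc enqueue Q a := by
  have h1 := hF.lt_len .ord (by simp)
  have h2 := hF.lt_len .pos (by simp)
  have h3 := hF.lt_W
  have h4 := hq.length_le
  have h5 := u.2
  simp only [enqueue, Layout.vc, Expr.ok, Expr.eval, Ast.put_var, hu, hq.tail, true_and]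
  refine ⟨by omega, by omega, ⟨by norm_num, by omega⟩, hQ _ ⟨fun x hx => ?_, fun r hr => ?_, rfl,
    rfl, by simp⟩ ⟨by simp, ?_, ?_, ?_⟩⟩
  · simp only [List.mem_cons, List.not_mem_nil, or_false] at hx
    simp [hx]
  · simp only [List.mem_cons, List.not_mem_nil, or_false, not_or] at hr
    simp [hr]
  · rw [List.nodup_append]
    refine ⟨hq.nodup, by simp, ?_⟩
    rintro x hx y hy rfl
    exact huq (by simpa using List.mem_singleton.1 hy ▸ hx)
  · intro i hi
    rw [List.length_append, List.length_singleton] at hi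
    rcases Nat.lt_succ_iff_lt_or_eq.1 hi with hi' | rfl
    · rw [List.getElem_append_left hi']
      simp [Function.update_of_ne hi'.ne, hq.ord i hi']
    · simp
  · intro i hi
    rw [List.length_append, List.length_singleton] at hi
    rcases Nat.lt_succ_iff_lt_or_eq.1 hi with hi' | rfl
    · rw [List.getElem_append_left hi']
      have : (q[i] : ℕ) ≠ u := fun h => huq (by rw [← Fin.ext h]; exact List.getElem_mem hi')
      simp [Function.update_of_ne this, hq.pos i hi']
    · simp

variable [DecidableRel G.Adj]

/-- The number of neighbours of `u` outside `P`. -/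
def left (G : SimpleGraph (Fin n)) [DecidableRel G.Adj] (P : List (Fin n)) (u : Fin n) : ℕ :=
  (G.neighborFinset u \ P.toFinset).card

theorem left_append_of_adj {P : List (Fin n)} {u v : Fin n} (hv : v ∉ P) (h : G.Adj v u) :
    left G P u = left G (P ++ [v]) u + 1 := by
  have hm : v ∈ G.neighborFinset u \ P.toFinset := by simp [h.symm, hv]
  rw [left, left, ← Finset.card_erase_add_one hm]
  congr 2
  ext w
  simp only [Finset.mem_erase, Finset.mem_sdiff, List.mem_toFinset, List.mem_append,
    List.mem_singleton]
  tauto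

theorem left_append_of_not_adj {P : List (Fin n)} {u v : Fin n} (h : ¬ G.Adj v u) :
    left G (P ++ [v]) u = left G P u := by
  unfold left
  congr 1
  ext w
  simp only [Finset.mem_sdiff, List.mem_toFinset, List.mem_append, List.mem_singleton,
    SimpleGraph.mem_neighborFinset, not_or]
  constructor
  · tauto
  · rintro ⟨h1, h2⟩
    exact ⟨h1, h2, by rintro rfl; exact h h1.symm⟩

/-- The neighbours of the first `h` members of `q` have been relaxed. -/
structure Peeling (Λ : Layout) (L : AdjLists G) (d : ℕ) (q : List (Fin n)) (h : ℕ) (a : Ast) :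
    Prop where
  input : Input Λ L a
  queue : Queue q a
  head : a.var .head = h
  le : h ≤ q.length
  var_d : a.var .d = d
  deg : ∀ u : Fin n, a.arr .deg u = left G (q.take h) u
  optimal : ∀ i (hi : i < q.length), i < h → ∀ k, IsDegenerate G k → left G (q.take i) q[i] ≤ k

theorem take_of_prefix {q q' : List (Fin n)} (h : q <+: q') {i : ℕ} (hi : i ≤ q.length) :
    q'.take i = q.take i := by
  obtain ⟨r, rfl⟩ := h
  rw [List.take_append_of_le_length hi]

/-- The queue consists of exactly the vertices with at most `d` neighbours outside its expanded
part. Expanding `q[h]` lowers this count by one at its neighbours, and those that reach `d` are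
appended. A vertex is expanded while its count is at most `d`, hence at most every `k` for which `G`
is `k`-degenerate. -/
theorem vc_expand (hF : Λ.Fits n) {d h : ℕ} {q : List (Fin n)} (hP : Peeling Λ L d q h a)
    (hq : ∀ u, u ∈ q ↔ left G (q.take h) u ≤ d) (hd : ∀ k, IsDegenerate G k → d ≤ k)
    (hh : h < q.length)
    (hQ : ∀ b q', q <+: q' → Peeling Λ L d q' (h + 1) b →
      (∀ u, u ∈ q' ↔ left G (q'.take (h + 1)) u ≤ d) →
      Frame [.v, .head, .i, .h, .u, .tail] [.deg, .ord, .pos]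
        (60 * ((L.list q[h]).length + 1)) a b → Q b) :
    Λ.vc expand Q a := by
  have h1 := hF.lt_len .ord (by simp)
  have h2 := hF.lt_len .deg (by simp)
  have h3 := hF.lt_W
  have h4 := hP.queue.length_le
  have hnd := hP.queue.nodup
  have hvP : q[h] ∉ q.take h := by
    rw [List.mem_take_iff_getElem]
    rintro ⟨i, hi, he⟩
    have := (List.Nodup.getElem_inj_iff hnd).1 he
    omega
  simp only [expand, Layout.vc, Expr.ok, Expr.eval, Ast.set_var, hP.head, reduceCtorEq,
    if_false, true_and]
  refine ⟨by omega, ⟨by norm_num, by omega⟩, ?_⟩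
  rw [hP.queue.ord h hh]
  generalize hb₀ : (a.set .v q[h] _).set .head _ _ = b₀
  have harr : b₀.arr = a.arr := by subst hb₀; simp
  have hvar : ∀ z, z ≠ .v → z ≠ .head → b₀.var z = a.var z := by
    subst hb₀; intro z h1 h2; simp [h1, h2]
  have hvv : b₀.var .v = q[h] := by subst hb₀; simp
  have hhead : b₀.var .head = h + 1 := by subst hb₀; simp
  have hfr : Frame [.v, .head, .i, .h, .u, .tail] [.deg, .ord, .pos] 12 a b₀ := by
    subst hb₀
    refine ⟨fun z hz => ?_, fun r hr => by simp, rfl, rfl, by simp⟩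
    simp only [List.mem_cons, List.not_mem_nil, or_false, not_or] at hz
    simp [hz]
  have hI : Input Λ L b₀ := hP.input.congr (hvar _ (by simp) (by simp)) (by rw [harr])
  refine vc_eachNbr (vs := [.i, .h, .u, .tail]) (vs' := [.tail]) (rs := [.deg, .ord, .pos])
    (c := 40) hF hI hvv (by simp) (by simp) (by simp) (by simp)
    (fun l b => b.var .d = d ∧ (∃ q', q <+: q' ∧ Queue q' b ∧
        ∀ u : Fin n, u ∈ q' ↔ b.arr .deg u ≤ d) ∧
      (∀ u : Fin n, b.arr .deg u =
        if u ∈ l then left G (q.take h) u - 1 else left G (q.take h) u)) ?_ ?_ ?_ ?_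
  · rintro l b b' hb hv ⟨k1, ⟨q', k2, k3, k4⟩, k5⟩
    refine ⟨by rw [hv _ (by simp) (by simp) (by simp), k1], ⟨q', k2, ?_, by rw [hb]; exact k4⟩,
      by rw [hb]; exact k5⟩
    exact k3.congr (hv _ (by simp) (by simp) (by simp)) (by rw [hb]) (by rw [hb])
  · refine ⟨?_, ⟨q, List.prefix_rfl, hP.queue.congr ?_ ?_ ?_, fun u => ?_⟩, fun u => ?_⟩
    · rw [hvar _ (by simp) (by simp), hP.var_d]
    · rw [hvar _ (by simp) (by simp)]
    · rw [harr]
    · rw [harr]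
    · rw [harr, hP.deg, hq]
    · rw [harr, hP.deg]; simp
  · rintro l₁ z l₂ hl b k hb ⟨k1, ⟨q', k2, k3, k4⟩, k5⟩ hz
    have hzn := z.2
    have hadj : G.Adj q[h] z := by rw [← L.mem_iff, hl]; simp
    have hleft := left_append_of_adj hvP hadj
    have hzl : z ∉ l₁ := fun hc => by
      have := L.nodup q[h]
      rw [hl, List.nodup_append] at this
      exact this.2.2 _ hc _ (by simp) rfl
    have hdz := k5 z
    rw [if_neg hzl] at hdz
    have hdegs : ∀ u : Fin n, Function.update (b.arr .deg) z (left G (q.take h) z - 1) u =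
        if u ∈ l₁ ++ [z] then left G (q.take h) u - 1 else left G (q.take h) u := fun u => by
      by_cases huz : u = z
      · subst huz; simp
      · rw [Function.update_of_ne (fun h => huz (Fin.ext h)), k5]
        simp [huz]
    simp only [relax, Layout.vc, Expr.ok, Expr.eval, Cond.ok, Cond.holds, Ast.put_var,
      Ast.put_arr, hz, hdz, k1, if_true, Function.update_self, true_and, and_true]
    refine ⟨⟨by omega, by norm_num⟩, by omega, by omega, fun he => ?_, fun he => ?_⟩
    · refine vc_enqueue hF (q := q') (u := z) (k3.congr rfl (by simp) (by simp)) (by simp [hz])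
        (by rw [k4, hdz]; omega) fun c hc hcq => ?_
      refine ⟨⟨fun x hx => ?_, fun r hr => ?_, ?_, ?_, ?_⟩, ?_, ⟨q' ++ [z], ?_, hcq, ?_⟩, ?_⟩
      · rw [hc.var x hx]; simp
      · simp only [List.mem_cons, List.not_mem_nil, or_false, not_or] at hr
        rw [hc.arr r (by simp [hr])]
        simp [hr]
      · rw [hc.current]; simp
      · rw [hc.reported]; simp
      · have := hc.time
        simp at this ⊢
        omega
      · rw [hc.var _ (by simp)]; simp [k1]
      · exact k2.trans (List.prefix_append _ _)
      · intro u
        rw [hc.arr _ (by simp)]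
        simp only [Ast.tick_arr, Ast.put_arr, if_true, List.mem_append, List.mem_singleton]
        by_cases huz : u = z
        · subst huz; simp; omega
        · simp [huz, k4, Function.update_of_ne (fun h => huz (Fin.ext h))]
      · rw [hc.arr _ (by simp)]
        simpa using hdegs
    · refine ⟨⟨fun x hx => by simp, fun r hr => ?_, rfl, rfl, by simp⟩, by simp [k1],
        ⟨q', k2, k3.congr rfl (by simp) (by simp), fun u => ?_⟩, by simpa using hdegs⟩
      · simp only [List.mem_cons, List.not_mem_nil, or_false, not_or] at hr
        simp [hr]
      · simp only [Ast.tick_arr, Ast.put_arr, if_true]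
        by_cases huz : u = z
        · subst huz; rw [k4, hdz]; simp; omega
        · simp [k4, Function.update_of_ne (fun h => huz (Fin.ext h))]
  · rintro b hb ⟨k1, ⟨q', k2, k3, k4⟩, k5⟩
    have hlen := k2.length_le
    have htake : q'.take (h + 1) = q.take h ++ [q[h]] := by
      rw [take_of_prefix k2 hh, List.take_succ_eq_append_getElem hh]
    have hdeg : ∀ u : Fin n, b.arr .deg u = left G (q'.take (h + 1)) u := fun u => by
      rw [htake, k5]
      split_ifs with hadj
      · rw [left_append_of_adj hvP ((L.mem_iff _ _).1 hadj)]; rfl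
      · rw [left_append_of_not_adj (mt (L.mem_iff _ _).2 hadj)]
    refine hQ b q' k2 ⟨?_, k3, ?_, by omega, k1, hdeg, ?_⟩ (fun u => by rw [k4, hdeg]) ?_
    · exact hI.congr (hb.var _ (by simp)) (hb.arr _ (by simp))
    · rw [hb.var _ (by simp), hhead]
    · intro i hi hih k hk
      have hiq : i < q.length := by omega
      have hget : q'[i] = q[i] := by
        obtain ⟨r, rfl⟩ := k2
        rw [List.getElem_append_left hiq]
      rw [hget, take_of_prefix k2 hiq.le]
      by_cases hih' : i < h
      · exact hP.optimal i hiq hih' k hk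
      · obtain rfl : i = h := by omega
        exact ((hq _).1 (List.getElem_mem hiq)).trans (hd k hk)
    · refine (hfr.trans hb (by simp; tauto) (by simp)).mono ?_
      omega

theorem wp_exhaust (hF : Λ.Fits n) {d h : ℕ} {q : List (Fin n)} (hP : Peeling Λ L d q h a)
    (hq : ∀ u, u ∈ q ↔ left G (q.take h) u ≤ d) (hd : ∀ k, IsDegenerate G k → d ≤ k)
    (hQ : ∀ b q', q <+: q' → Peeling Λ L d q' q'.length b → (∀ u, u ∈ q' ↔ left G q' u ≤ d) →
      Frame [.v, .head, .i, .h, .u, .tail] [.deg, .ord, .pos]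
        (63 * ((q'.drop h).map fun u => (L.list u).length + 1).sum + 3) a b → Q b) :
    Λ.wp exhaust Q a := by
  induction hm : n - h generalizing h q a with
  | zero =>
    have h1 := hP.queue.length_le
    have h2 := hP.le
    have hh : h = q.length := by omega
    subst hh
    refine Layout.wp_whl_false (by simp) (by simp [hP.head, hP.queue.tail]) ?_
    refine hQ _ q List.prefix_rfl ⟨hP.input.congr rfl rfl, hP.queue.congr rfl rfl rfl, hP.head, le_rfl,
      hP.var_d, hP.deg, hP.optimal⟩ (by simpa using hq)
      ⟨fun _ _ => rfl, fun _ _ => rfl, rfl, rfl, by simp⟩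
  | succ m ih =>
    by_cases hh : h < q.length
    · refine Layout.wp_whl_true (by simp) (by simpa [hP.head, hP.queue.tail]) ?_
      refine Layout.wp_of_vc (vc_expand hF (d := d) (h := h) (q := q) ⟨hP.input.congr rfl rfl,
        hP.queue.congr rfl rfl rfl, hP.head, hP.le, hP.var_d, hP.deg, hP.optimal⟩ hq hd hh ?_)
      intro b q₁ hpre hP₁ hq₁ hb
      refine ih hP₁ hq₁ ?_ (by omega)
      intro c q' hpre' hP' hq' hc
      refine hQ c q' (hpre.trans hpre') hP' hq' ?_
      have h0 : Frame [.v, .head, .i, .h, .u, .tail] [.deg, .ord, .pos] 3 a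
          (a.tick (Cond.lt (Expr.var Var.head) (Expr.var Var.tail)).cost) :=
        ⟨fun _ _ => rfl, fun _ _ => rfl, rfl, rfl, by simp⟩
      have hlt : h < q'.length := hh.trans_le (hpre.trans hpre').length_le
      have hget : q'[h] = q[h] := by
        obtain ⟨r, rfl⟩ := hpre.trans hpre'
        rw [List.getElem_append_left hh]
      refine ((h0.trans hb (fun _ h => h.elim id id) fun _ h => h.elim id id).trans hc
        (fun _ h => h.elim id id) fun _ h => h.elim id id).mono ?_
      rw [List.drop_eq_getElem_cons hlt, List.map_cons, List.sum_cons, hget]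
      omega
    · have h2 := hP.le
      have hh : h = q.length := by omega
      subst hh
      refine Layout.wp_whl_false (by simp) (by simp [hP.head, hP.queue.tail]) ?_
      refine hQ _ q List.prefix_rfl ⟨hP.input.congr rfl rfl, hP.queue.congr rfl rfl rfl, hP.head,
        le_rfl, hP.var_d, hP.deg, hP.optimal⟩ (by simpa using hq)
        ⟨fun _ _ => rfl, fun _ _ => rfl, rfl, rfl, by simp⟩

end Peel

section Peel

variable {Λ : Layout} {n : ℕ} {a : Ast} {Q : Ast → Prop} {G : SimpleGraph (Fin n)}
  {L : AdjLists G}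

/-- The list is filtered in place: the writing position never overtakes the reading position.
Entries of degree below `d` are dropped; in `wp_peel` these are already in the queue. -/
theorem vc_scan (hF : Λ.Fits n) {d : ℕ} {q la : List (Fin n)}
    (hq : Queue q a) (hd : a.var .d = d) (hlen : a.var .len = la.length) (hla : la.Nodup)
    (hseg : Seg (a.arr .lst) 0 la) (hD : ∀ u ∈ la, a.arr .deg u = d → u ∉ q)
    (hQ : ∀ b q', q <+: q' → Queue q' b → (∀ u, u ∈ q' ↔ u ∈ q ∨ u ∈ la ∧ a.arr .deg u = d) →
      b.var .len = (la.filter fun u : Fin n => d < a.arr .deg u).length →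
      Seg (b.arr .lst) 0 (la.filter fun u : Fin n => d < a.arr .deg u) →
      Frame [.i, .p, .u, .tail, .len] [.lst, .ord, .pos] (50 * la.length + 10) a b → Q b) :
    Λ.vc scan Q a := by
  have h1 := hF.lt_len .lst (by simp)
  have h2 := hF.lt_len .deg (by simp)
  have h3 := hF.lt_W
  have h4 : la.length ≤ n := by simpa using hla.length_le_card
  simp only [scan, Layout.vc, Expr.ok, Expr.eval, Expr.cost, Nat.zero_le, true_and]
  refine Layout.wp_whl_index (j := 0) (m := la.length)
    (fun j b => Frame [.i, .p, .u, .tail] [.lst, .ord, .pos] (50 * j + 4) a b ∧ b.var .i = j ∧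
      b.var .p = ((la.take j).filter fun u : Fin n => d < a.arr .deg u).length ∧
      Seg (b.arr .lst) 0 ((la.take j).filter fun u : Fin n => d < a.arr .deg u) ∧
      (∀ k (hk : k < la.length), j ≤ k → b.arr .lst k = la[k]) ∧
      ∃ q', q <+: q' ∧ Queue q' b ∧
        ∀ u, u ∈ q' ↔ u ∈ q ∨ u ∈ la.take j ∧ a.arr .deg u = d) (Nat.zero_le _) ?_ ?_ ?_
  · refine ⟨⟨fun x hx => ?_, fun _ _ => rfl, rfl, rfl, by simp⟩, by simp, by simp,
      fun j h => by simp at h, fun k hk _ => by simpa using hseg k hk, q, List.prefix_rfl,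
      hq.congr (by simp) rfl rfl, by simp⟩
    simp only [List.mem_cons, List.not_mem_nil, or_false, not_or] at hx
    simp [hx]
  · rintro j - hj b ⟨hb, hi, hp, hs, hrest, q', hpre, hq', hmem⟩
    have hlj := (la[j]).2
    have hK : ((la.take j).filter fun u : Fin n => d < a.arr .deg u).length ≤ j :=
      (List.length_filter_le _ _).trans (by simp)
    have htake : la.take (j + 1) = la.take j ++ [la[j]] := List.take_succ_eq_append_getElem hj
    have hbd : b.var .d = d := by rw [hb.var _ (by simp), hd]
    have hbdeg : b.arr .deg = a.arr .deg := hb.arr _ (by simp)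
    have hblen : b.var .len = la.length := by rw [hb.var _ (by simp), hlen]
    have hfr := hb.time
    simp only [Layout.vc, Expr.ok, Expr.eval, Cond.ok, Cond.holds, Ast.set_var, Ast.set_arr,
      Ast.tick_var, Ast.tick_arr, hi, hp, hblen, hbd, hbdeg, hrest j hj le_rfl, reduceCtorEq,
      if_true, if_false, true_and, and_true, Ast.put_var, Ast.put_arr]
    refine ⟨hj, by omega, by omega, fun hlt => ?_, fun hlt => ⟨by omega, fun he => ?_, fun he => ?_⟩⟩
    · refine ⟨by omega, ⟨by norm_num, by omega⟩, ⟨by norm_num, by omega⟩, ⟨fun x hx => ?_,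
        fun r hr => ?_, hb.current, hb.reported, ?_⟩, ?_, ?_, ?_, q', hpre,
        hq'.congr (by simp) (by simp) (by simp), ?_⟩
      · have := hb.var x hx
        simp only [List.mem_cons, List.not_mem_nil, or_false, not_or] at hx
        simp [hx, this]
      · have := hb.arr r hr
        simp only [List.mem_cons, List.not_mem_nil, or_false, not_or] at hr
        simp [hr, this]
      · simp; omega
      · rw [htake, List.filter_append]; simp [hlt]
      · rw [htake, List.filter_append]
        intro k hk
        simp only [List.filter_cons, List.filter_nil, hlt, decide_true, if_true] at hk ⊢
        rw [List.length_append, List.length_singleton] at hk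
        rcases Nat.lt_succ_iff_lt_or_eq.1 hk with hk' | rfl
        · rw [List.getElem_append_left hk', Nat.zero_add, Function.update_of_ne hk'.ne]
          simpa using hs k hk'
        · simp
      · intro k hk hjk
        rw [Function.update_of_ne (by omega)]
        exact hrest k hk (by omega)
      · intro u
        rw [hmem, htake]
        simp only [List.mem_append, List.mem_singleton]
        have : u = la[j] → a.arr .deg u ≠ d := by rintro rfl; omega
        tauto
    · have hlq : la[j] ∉ q' := by
        rw [hmem]
        rintro (h | ⟨h, -⟩)
        · exact hD _ (List.getElem_mem hj) he h
        · rw [List.mem_take_iff_getElem] at h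
          obtain ⟨i, hi, he⟩ := h
          have := (List.Nodup.getElem_inj_iff hla).1 he
          omega
      refine vc_enqueue hF (q := q') (u := la[j]) (hq'.congr (by simp) rfl rfl) (by simp) hlq
        fun c hc hcq => ?_
      have hct := hc.time
      have hci : c.var .i = j := by rw [hc.var _ (by simp)]; simp [hi]
      have hcp : c.var .p = b.var .p := by rw [hc.var _ (by simp)]; simp
      have hcl : c.arr .lst = b.arr .lst := by rw [hc.arr _ (by simp)]; simp
      rw [hci]
      refine ⟨⟨by norm_num, by omega⟩, ⟨fun x hx => ?_, fun r hr => ?_, ?_, ?_, ?_⟩, rfl, ?_, ?_, ?_,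
        q' ++ [la[j]], hpre.trans (List.prefix_append _ _), hcq.congr (by simp) rfl rfl, ?_⟩
      · have := hb.var x hx
        simp only [List.mem_cons, List.not_mem_nil, or_false, not_or] at hx
        simp [hx, this, hc.var]
      · have := hb.arr r hr
        simp only [List.mem_cons, List.not_mem_nil, or_false, not_or] at hr
        rw [Ast.set_arr, hc.arr r (by simp [hr])]
        simp [this]
      · simp [hc.current, hb.current]
      · simp [hc.reported, hb.reported]
      · simp at hct ⊢; omega
      · rw [htake, List.filter_append]; simp [hlt, hcp, hp]
      · rw [htake, List.filter_append]
        simpa [hlt, hcl] using hs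
      · intro k hk hjk
        rw [hcl]
        exact hrest k hk (by omega)
      · intro u
        rw [List.mem_append, hmem, htake]
        simp only [List.mem_append, List.mem_singleton]
        have : u = la[j] → a.arr .deg u = d := by rintro rfl; exact he
        tauto
    · refine ⟨⟨by norm_num, by omega⟩, ⟨fun x hx => ?_, fun r hr => ?_, hb.current, hb.reported, ?_⟩,
        ?_, ?_, ?_, q', hpre, hq'.congr (by simp) rfl rfl, ?_⟩
      · have := hb.var x hx
        simp only [List.mem_cons, List.not_mem_nil, or_false, not_or] at hx
        simp [hx, this]
      · simpa using hb.arr r hr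
      · simp; omega
      · rw [htake, List.filter_append]; simp [hlt]
      · rw [htake, List.filter_append]
        simpa [hlt] using hs
      · exact fun k hk hjk => hrest k hk (by omega)
      · intro u
        rw [hmem, htake]
        simp only [List.mem_append, List.mem_singleton]
        have : u = la[j] → a.arr .deg u ≠ d := by rintro rfl; exact he
        tauto
  · rintro b ⟨hb, hi, hp, hs, hrest, q', hpre, hq', hmem⟩
    rw [List.take_length] at hp hs hmem
    have hblen : b.var .len = la.length := by rw [hb.var _ (by simp), hlen]
    refine ⟨by simp, by simp [hi, hblen], hQ _ q' hpre (hq'.congr (by simp) rfl rfl) hmem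
      (by simp [hp]) hs ⟨fun x hx => ?_, fun r hr => hb.arr r hr, hb.current, hb.reported, ?_⟩⟩
    · simp only [List.mem_cons, List.not_mem_nil, or_false, not_or] at hx
      simp [hx, hb.var]
    · have := hb.time
      simp; omega

variable [DecidableRel G.Adj]

/-- The order in which the vertices are enumerated shows that `G` has no small degeneracy. -/
theorem le_of_isDegenerate {q : List (Fin n)} {d k : ℕ} (hq : q.length < n)
    (h : ∀ u, u ∉ q → d ≤ left G q u) (hk : IsDegenerate G k) : d ≤ k := by
  -- Degeneracy is applied to the subgraph induced by the vertices outside the queue.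
  have hne : (Finset.univ \ q.toFinset : Finset (Fin n)).Nonempty := by
    rw [Finset.sdiff_nonempty]
    intro hs
    have := (Finset.card_le_card hs).trans q.toFinset_card_le
    simp at this
    omega
  obtain ⟨u, hu, hk'⟩ := hk _ hne
  refine (h u (by simpa using hu)).trans (le_of_eq_of_le ?_ hk')
  unfold left
  congr 1
  ext w
  simp

theorem left_le (P : List (Fin n)) (u : Fin n) : left G P u ≤ (L.list u).length := by
  have h : (G.neighborFinset u).card = (L.list u).length := by
    rw [← List.toFinset_card_of_nodup (L.nodup u)]
    congr 1
    ext w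
    simp [L.mem_iff]
  rw [← h]
  exact Finset.card_le_card Finset.sdiff_subset

theorem left_nil (u : Fin n) : left G [] u = (L.list u).length := by
  rw [← List.toFinset_card_of_nodup (L.nodup u)]
  unfold left
  congr 1
  ext w
  simp [L.mem_iff]

/-- The time is kept in two accounts. Expanding a vertex is charged to its degree, once. Scanning is
charged to the sum of `min d (degree + 1)`: the vertices listed in round `d` have degree at least
`d`, so the sum grows in that round by at least the length of the list. -/
theorem wp_peel (hF : Λ.Fits n) {d : ℕ} {q la : List (Fin n)} (hP : Peeling Λ L d q q.length a)
    (hq : ∀ u, u ∈ q ↔ left G q u < d) (hlen : a.var .len = la.length) (hla : la.Nodup)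
    (hseg : Seg (a.arr .lst) 0 la) (hqla : ∀ u, u ∉ q → u ∈ la)
    (hge : ∀ u ∈ la, d ≤ (L.list u).length) {T : ℕ}
    (hT : a.time ≤ T + 63 * (q.map fun u => (L.list u).length + 1).sum +
      70 * ∑ u, min d ((L.list u).length + 1))
    (hQ : ∀ b q', q'.length = n → Queue q' b →
      (∀ i (hi : i < q'.length) k, IsDegenerate G k → left G (q'.take i) q'[i] ≤ k) →
      (∀ r, r ≠ .deg → r ≠ .lst → r ≠ .ord → r ≠ .pos → b.arr r = a.arr r) →
      b.var .n = a.var .n → b.current = a.current → b.reported = a.reported →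
      b.time ≤ T + 133 * (∑ u, ((L.list u).length + 1)) + 3 → Q b) :
    Λ.wp peel Q a := by
  induction hm : n - d using Nat.strong_induction_on generalizing d q la a with
  | _ m ih =>
  have hqn := hP.queue.length_le
  have hok : (Cond.lt (Expr.var Var.tail) (Expr.var Var.n)).ok Λ a := by simp
  by_cases hlt : q.length < n
  · have hle : ∀ u, u ∉ q → d ≤ left G q u := fun u hu => by
      by_contra h
      exact hu ((hq u).2 (by omega))
    obtain ⟨u₀, hu₀⟩ : ∃ u, u ∉ q := by
      by_contra h
      push Not at h
      have h1 : (Finset.univ : Finset (Fin n)) ⊆ q.toFinset := fun u _ => by simpa using h u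
      have h2 := (Finset.card_le_card h1).trans q.toFinset_card_le
      simp at h2
      omega
    have hd : ∀ k, IsDegenerate G k → d ≤ k := fun k hk => le_of_isDegenerate hlt hle hk
    -- The rounds come to an end because a vertex not yet in the queue has at least `d`, but fewer
    -- than `n`, neighbours.
    have hdn : d < n := by
      have h1 := hge u₀ (hqla u₀ hu₀)
      have h2 : (L.list u₀).length < (u₀ :: L.list u₀).length := by simp
      have h3 : (u₀ :: L.list u₀).length ≤ n := by
        have hnd : (u₀ :: L.list u₀).Nodup := by simp [L.nodup, L.mem_iff]
        simpa using hnd.length_le_card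
      omega
    -- The constant expense of a round is 20, and each entry is charged 70 although its scan takes
    -- 50; so a nonempty list covers it.
    have hla0 : 1 ≤ la.length := List.length_pos_of_mem (hqla u₀ hu₀)
    have hdeg : ∀ u : Fin n, a.arr .deg u = left G q u := fun u => by rw [hP.deg]; simp
    refine Layout.wp_whl_true hok (by simpa [hP.queue.tail, hP.input.var_n]) (Layout.wp_of_vc ?_)
    rw [Layout.vc]
    refine vc_scan hF (q := q) (la := la) (d := d) (hP.queue.congr rfl rfl rfl)
      hP.var_d hlen hla hseg (fun u _ he => ?_) ?_
    · rw [hq]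
      rw [Ast.tick_arr, hdeg] at he
      omega
    intro b₁ q₁ hpre₁ hq₁ hmem₁ hlen₁ hseg₁ hb₁
    simp only [Ast.tick_arr, hdeg] at hmem₁ hlen₁ hseg₁
    rw [Layout.vc]
    have hmem₁' : ∀ u, u ∈ q₁ ↔ left G q u ≤ d := fun u => by
      rw [hmem₁, hq]
      refine ⟨by omega, fun h => ?_⟩
      rcases h.lt_or_eq with h | h
      · exact Or.inl h
      · exact Or.inr ⟨hqla u (by rw [hq]; omega), h⟩
    have htake₁ : q₁.take q.length = q := by rw [take_of_prefix hpre₁ le_rfl]; simp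
    refine wp_exhaust hF (d := d) (h := q.length) (q := q₁) ⟨hP.input.congr ?_ ?_, hq₁, ?_,
      hpre₁.length_le, ?_, ?_, ?_⟩ (by rw [htake₁]; exact hmem₁') hd ?_
    · rw [hb₁.var _ (by simp)]; simp
    · rw [hb₁.arr _ (by simp)]; simp
    · rw [hb₁.var _ (by simp)]; simp [hP.head]
    · rw [hb₁.var _ (by simp)]; simp [hP.var_d]
    · intro u
      rw [hb₁.arr _ (by simp), htake₁]
      exact hdeg u
    · intro i hi hih k hk
      have hget : q₁[i] = q[i] := by
        obtain ⟨r, rfl⟩ := hpre₁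
        rw [List.getElem_append_left hih]
      rw [hget, take_of_prefix hpre₁ hih.le]
      exact hP.optimal i hih hih k hk
    intro b₂ q₂ hpre₂ hP₂ hmem₂ hb₂
    have hsum : (q₂.map fun u => (L.list u).length + 1).sum =
        (q.map fun u => (L.list u).length + 1).sum +
          ((q₂.drop q.length).map fun u => (L.list u).length + 1).sum := by
      have h1 : q₂.take q.length = q := by
        rw [take_of_prefix (hpre₁.trans hpre₂) le_rfl]; simp
      conv_lhs => rw [← List.take_append_drop q.length q₂, h1, List.map_append, List.sum_append]
    have hmin : ∑ u, min d ((L.list u).length + 1) + la.length ≤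
        ∑ u, min (d + 1) ((L.list u).length + 1) := by
      have h1 : la.length = ∑ u : Fin n, if u ∈ la then 1 else 0 := by
        rw [← List.toFinset_card_of_nodup hla, Finset.sum_boole]
        rw [Nat.cast_id]
        congr 1
        ext u
        simp
      rw [h1, ← Finset.sum_add_distrib]
      refine Finset.sum_le_sum fun u _ => ?_
      split_ifs with hu
      · have := hge u hu
        omega
      · omega
    simp only [Layout.vc, Expr.ok, Expr.eval, hP₂.var_d, Nat.reduceLeDiff, true_and]
    have hW := hF.lt_W
    refine ⟨by omega, ?_⟩
    refine ih (n - (d + 1)) (by omega) (d := d + 1) (q := q₂) (la := la.filter fun u => d < left G q u)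
      ⟨hP₂.input.congr (by simp) rfl, hP₂.queue.congr (by simp) rfl rfl, by simp [hP₂.head], le_rfl, by simp,
        hP₂.deg, hP₂.optimal⟩ (fun u => by rw [hmem₂]; omega) ?_ (hla.filter _) ?_ ?_ ?_ ?_ ?_ rfl
    · simp only [Ast.set_var, reduceCtorEq, if_false]
      rw [hb₂.var _ (by simp), hlen₁]
    · rw [Ast.set_arr, hb₂.arr _ (by simp)]
      exact hseg₁
    · intro u hu
      have h1 : u ∉ q₁ := fun h => hu (hpre₂.subset h)
      have h2 : u ∉ q := fun h => h1 (hpre₁.subset h)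
      rw [hmem₁'] at h1
      exact List.mem_filter.2 ⟨hqla u h2, by simpa using h1⟩
    · intro u hu
      have h1 : d < left G q u := by simpa using (List.mem_filter.1 hu).2
      exact Nat.lt_of_lt_of_le h1 (left_le q u)
    · have h1 := hb₁.time
      have h2 := hb₂.time
      simp only [Ast.tick_time, Cond.cost, Expr.cost] at h1
      simp only [Ast.set_time, Expr.cost, hsum]
      omega
    · intro c q' k1 k2 k3 k4 k5 k6 k7 k8
      refine hQ c q' k1 k2 k3 (fun r h1 h2 h3 h4 => ?_) ?_ ?_ ?_ k8
      · rw [k4 r h1 h2 h3 h4, Ast.set_arr, hb₂.arr r (by simp [h1, h3, h4]),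
          hb₁.arr r (by simp [h2, h3, h4])]
        simp
      · rw [k5, Ast.set_var, if_neg (by simp), hb₂.var _ (by simp), hb₁.var _ (by simp)]; simp
      · rw [k6, Ast.set_current, hb₂.current, hb₁.current]; simp
      · rw [k7, Ast.set_reported, hb₂.reported, hb₁.reported]; simp
  · have hqn' : q.length = n := by omega
    refine Layout.wp_whl_false hok (by simp [hP.queue.tail, hP.input.var_n, hqn']) ?_
    refine hQ _ q hqn' (hP.queue.congr rfl rfl rfl) (fun i hi => hP.optimal i hi hi)
      (fun _ _ _ _ _ => rfl) rfl rfl rfl ?_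
    have h1 : (q.map fun u => (L.list u).length + 1).sum ≤ ∑ u, ((L.list u).length + 1) := by
      rw [← List.sum_toFinset _ hP.queue.nodup]
      exact Finset.sum_le_sum_of_subset (Finset.subset_univ _)
    have h2 : ∑ u, min d ((L.list u).length + 1) ≤ ∑ u, ((L.list u).length + 1) :=
      Finset.sum_le_sum fun u _ => min_le_right _ _
    simp only [Ast.tick_time, Cond.cost, Expr.cost]
    omega

end Peel

/-- Record the degrees, and start with the set of all vertices. -/
def setup : Prog :=
  .asg .v (.lit 0) ;;
  .whl (.lt (.var .v) (.var .n))
    (.put .deg (.var .v) (.sub (.arr .inp (.add (.var .v) (.lit 2)))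
        (.arr .inp (.add (.var .v) (.lit 1)))) ;;
      .put .lst (.var .v) (.var .v) ;; .ins .v ;; .asg .v (.add (.var .v) (.lit 1))) ;;
  .asg .len (.var .n) ;; .asg .d (.lit 0) ;; .asg .tail (.lit 0) ;; .asg .head (.lit 0)

/-- Append `u` to the array of the lists of larger neighbours. -/
def append (x : Var) : Prog :=
  .put .up (.var .p) (.var x) ;; .asg .p (.add (.var .p) (.lit 1))

/-- Write down the larger neighbours of `v`, and count `v` at all its neighbours. -/
def collect : Prog :=
  .put .ups (.var .v) (.var .p) ;; append .v ;; incr .v ;;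
  eachNbr (incr .u ;; .ite (.lt (.arr .pos (.var .v)) (.arr .pos (.var .u))) (append .u) .skip)

def build : Prog :=
  .asg .v (.lit 0) ;; .asg .p (.lit 0) ;;
  .whl (.lt (.var .v) (.var .n)) (collect ;; .asg .v (.add (.var .v) (.lit 1))) ;;
  .put .ups (.var .n) (.var .p)

/-- Link the vertices that are not isolated, by decreasing numbers. -/
def link : Prog :=
  .asg .i (.lit 0) ;; .asg .p (.var .n) ;;
  .whl (.lt (.var .i) (.var .n))
    (.asg .v (.arr .ord (.var .i)) ;;
      .ite (.lt (.arr .inp (.add (.var .v) (.lit 1))) (.arr .inp (.add (.var .v) (.lit 2))))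
        (.put .nxt (.var .v) (.var .p) ;; .asg .p (.var .v)) .skip ;;
      .asg .i (.add (.var .i) (.lit 1))) ;;
  .put .nxt (.var .n) (.var .p)

def preprocess : Prog := setup ;; peel ;; build ;; link

/-- The sum of the values of `f` at the vertices before `j`. -/
def psum {n : ℕ} (f : Fin n → ℕ) (j : ℕ) : ℕ := ∑ v ∈ Finset.univ.filter fun v : Fin n => (v : ℕ) < j, f v

section Psum

variable {n : ℕ} (f : Fin n → ℕ)

theorem psum_zero : psum f 0 = 0 := by simp [psum]

theorem psum_succ (v : Fin n) : psum f (v + 1) = psum f v + f v := by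
  unfold psum
  have h : (Finset.univ.filter fun w : Fin n => (w : ℕ) < v + 1) =
      insert v (Finset.univ.filter fun w : Fin n => (w : ℕ) < v) := by
    ext w
    simp [Fin.ext_iff]
    omega
  rw [h, Finset.sum_insert (by simp), add_comm]

theorem psum_self : psum f n = ∑ v, f v := by
  unfold psum
  congr 1
  ext w
  simp

theorem psum_mono {i j : ℕ} (h : i ≤ j) : psum f i ≤ psum f j :=
  Finset.sum_le_sum_of_subset fun w hw => by
    simp only [Finset.mem_filter, Finset.mem_univ, true_and] at hw ⊢
    omega

end Psum

theorem toNatSet_univ (n : ℕ) : toNatSet (Finset.univ : Finset (Fin n)) = Finset.range n := by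
  ext i
  simp only [toNatSet, Finset.mem_map, Finset.mem_univ, true_and, Fin.valEmbedding_apply,
    Finset.mem_range]
  exact ⟨fun ⟨v, hv⟩ => hv ▸ v.2, fun h => ⟨⟨i, h⟩, rfl⟩⟩

/-- The members of `U v`: `v` itself and its larger neighbours. -/
def upList {n : ℕ} {G : SimpleGraph (Fin n)} (L : AdjLists G) (σ : Equiv.Perm (Fin n))
    (v : Fin n) : List (Fin n) :=
  v :: (L.list v).filter fun u => σ v < σ u

theorem upLists_upList {n : ℕ} {G : SimpleGraph (Fin n)} (L : AdjLists G)
    (σ : Equiv.Perm (Fin n)) : UpLists G σ (upList L σ) where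
  nodup v := by
    rw [upList, List.nodup_cons]
    exact ⟨by simp, (L.nodup v).filter _⟩
  mem_iff v w := by simp [upList, L.mem_iff]

theorem length_upList_le {n : ℕ} {G : SimpleGraph (Fin n)} (L : AdjLists G)
    (σ : Equiv.Perm (Fin n)) (v : Fin n) : (upList L σ v).length ≤ (L.list v).length + 1 := by
  rw [upList, List.length_cons]
  exact Nat.add_le_add_right (List.length_filter_le _ _) 1

/-! ### Building the data structures of the search -/

section Preprocess

variable {Λ : Layout} {n : ℕ} {a : Ast} {Q : Ast → Prop} {G : SimpleGraph (Fin n)}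
  {L : AdjLists G}

theorem vc_setup (hF : Λ.Fits n) (hI : Input Λ L a) (hcur : a.current = ∅)
    (hQ : ∀ b, Input Λ L b → (∀ v : Fin n, b.arr .deg v = (L.list v).length) →
      Seg (b.arr .lst) 0 (List.finRange n) → b.var .len = n → b.var .d = 0 → b.var .tail = 0 →
      b.var .head = 0 → b.current = Finset.range n → b.reported = a.reported →
      (∀ r, r ≠ .deg → r ≠ .lst → b.arr r = a.arr r) → b.time ≤ a.time + 30 * n + 20 → Q b) :
    Λ.vc setup Q a := by
  have h1 := hF.lt_len .deg (by simp)
  have h2 := hF.lt_len .lst (by simp)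
  have h3 := hF.lt_W
  have h4 := hI.lt
  simp only [setup, Layout.vc, Expr.ok, Expr.eval, Expr.cost, Nat.zero_le, true_and]
  refine Layout.wp_whl_index (j := 0) (m := n)
    (fun j b => b.var .n = n ∧ b.var .v = j ∧
      (∀ v : Fin n, (v : ℕ) < j → b.arr .deg v = (L.list v).length ∧ b.arr .lst v = v) ∧
      b.current = Finset.range j ∧ b.reported = a.reported ∧
      (∀ r, r ≠ .deg → r ≠ .lst → b.arr r = a.arr r) ∧ b.time ≤ a.time + 30 * j + 2)
    (Nat.zero_le _) ?_ ?_ ?_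
  · exact ⟨by simp [hI.var_n], by simp, by simp, by simp [hcur], rfl, fun _ _ _ => rfl, by simp⟩
  · rintro j - hj b ⟨k1, k2, k3, k4, k5, k6, k7⟩
    have hlo := hI.lo ⟨j, hj⟩
    have hhi := hI.hi ⟨j, hj⟩
    simp only at hlo hhi
    simp only [Cond.ok, Cond.holds, Expr.ok, Expr.eval, Layout.vc, Ast.tick_var, Ast.put_var,
      Ast.ins_var, Ast.tick_arr, k1, k2, k6 .inp (by simp) (by simp), hlo, hhi,
      true_and]
    refine ⟨hj, ⟨⟨⟨le_rfl, by omega⟩, by omega⟩, ⟨by norm_num, by omega⟩, by omega⟩, by omega,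
      by omega, ⟨by norm_num, by omega⟩, by simp [k1], by simp, ?_, ?_, by simp [k5], ?_, ?_⟩
    · intro v hv
      rcases Nat.lt_succ_iff_lt_or_eq.1 hv with hv' | hv'
      · simp [Function.update_of_ne hv'.ne, k3 v hv']
      · subst hv'
        simp
    · simp [k4, k2, Finset.range_add_one]
    · intro r hr hr'
      simp [hr, hr', k6]
    · simp
      omega
  · rintro b ⟨k1, k2, k3, k4, k5, k6, k7⟩
    simp only [Cond.ok, Expr.ok, Cond.holds, Expr.eval, Ast.tick_var, k1, k2]
    refine ⟨by simp, by simp, hQ _ ((hI.congr (b := b) (by rw [k1, hI.var_n])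
      (k6 _ (by simp) (by simp))).congr (by simp) rfl) (fun v => (k3 v v.2).1) ?_ (by simp)
      (by simp) (by simp) (by simp) k4 k5 k6 ?_⟩
    · intro j hj
      rw [List.length_finRange] at hj
      simpa using (k3 ⟨j, hj⟩ hj).2
    · simp
      omega

theorem vc_append {x : Var} {k : ℕ} {l : List (Fin n)} {z : Fin n} (hp : a.var .p = k + l.length)
    (hseg : Seg (a.arr .up) k l) (hx : a.var x = z) (hlen : k + l.length < Λ.len .up)
    (hQ : ∀ b, Frame [.p] [.up] 10 a b → b.var .p = k + (l ++ [z]).length →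
      Seg (b.arr .up) k (l ++ [z]) → (∀ j < k, b.arr .up j = a.arr .up j) → Q b) :
    Λ.vc (append x) Q a := by
  have hW := Λ.base_add_len_lt .up
  simp only [append, Layout.vc, Expr.ok, Expr.eval, Ast.put_var, hp, hx, true_and]
  refine ⟨hlen, ⟨by norm_num, by omega⟩, hQ _ ⟨fun y hy => ?_, fun r hr => ?_, rfl, rfl, by simp⟩
    (by simp [add_assoc]) ?_ ?_⟩
  · simp only [List.mem_cons, List.not_mem_nil, or_false] at hy
    simp [hy]
  · simp only [List.mem_cons, List.not_mem_nil, or_false] at hr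
    simp [hr]
  · intro j hj
    rw [List.length_append, List.length_singleton] at hj
    rcases Nat.lt_succ_iff_lt_or_eq.1 hj with hj' | rfl
    · rw [List.getElem_append_left hj']
      simp [Function.update_of_ne (show k + j ≠ k + l.length by omega), hseg j hj']
    · simp
  · intro j hj
    simp [Function.update_of_ne (show j ≠ k + l.length by omega)]

/-- `v` is inserted at its neighbours instead of the neighbours at `v`, so that the operation `incr`
of the search, which inserts `v`, can be used here as well. -/
theorem vc_collect (hF : Λ.Fits n) (hI : Input Λ L a) {σ : Equiv.Perm (Fin n)}
    (hpos : ∀ v : Fin n, a.arr .pos v = σ v) {v : Fin n} (hv : a.var .v = v) {k : ℕ}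
    (hp : a.var .p = k) (hk : k + (L.list v).length < Λ.len .up) {A : Fin n → Finset (Fin n)}
    (hA : Counts a A) (hvA : ∀ w, v ∉ A w)
    (hQ : ∀ b, Frame [.i, .h, .u, .p, .t] [.ups, .up, .cnt, .sum]
        (100 * ((L.list v).length + 1)) a b →
      b.var .p = k + (upList L σ v).length → Seg (b.arr .up) k (upList L σ v) →
      (∀ j < k, b.arr .up j = a.arr .up j) → b.arr .ups = Function.update (a.arr .ups) v k →
      Counts b (fun w => if w = v ∨ w ∈ L.list v then insert v (A w) else A w) → Q b) :
    Λ.vc collect Q a := by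
  have h1 := hF.lt_len .ups (by simp)
  have h2 := hF.lt_len .pos (by simp)
  have hvn := v.2
  simp only [collect, Layout.vc, Expr.ok, Expr.eval, hv, hp, true_and]
  refine ⟨by omega, vc_append (k := k) (l := []) (z := v) (by simp [hp]) (fun j h => by simp at h)
    (by simp [hv]) (by simp; omega) fun b hb hbp hbs hbu => ?_⟩
  have hfr : Frame [.p] [.ups, .up] 14 a b := by
    refine ⟨fun y hy => ?_, fun r hr => ?_, hb.current, hb.reported, ?_⟩
    · rw [hb.var y hy]; simp
    · simp only [List.mem_cons, List.not_mem_nil, or_false, not_or] at hr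
      rw [hb.arr r (by simp [hr])]; simp [hr]
    · have := hb.time
      simp at this
      omega
  have hbups : b.arr .ups = Function.update (a.arr .ups) v k := by
    rw [hb.arr _ (by simp)]; simp
  refine isOp_incr hF v .v b A v _ (by simp) (by rw [hfr.var _ (by simp), hI.var_n])
    (by rw [hfr.var _ (by simp), hv]) (by rw [hfr.var _ (by simp), hv])
    (hA.congr (hfr.arr _ (by simp)) (hfr.arr _ (by simp))) (hvA v) fun c hc hcA => ?_
  have hfr' : Frame [.i, .h, .u, .p, .t] [.ups, .up, .cnt, .sum] 54 a c :=
    hfr.trans hc (by simp) (by simp; tauto)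
  refine vc_eachNbr (c := 70) (vs := [.i, .h, .u, .p, .t]) (vs' := [.p, .t])
    (rs := [.up, .cnt, .sum]) hF (hI.congr (hfr'.var _ (by simp)) (hfr'.arr _ (by simp)))
    (v := v) (by rw [hfr'.var _ (by simp), hv]) (by simp) (by simp) (by simp) (by simp)
    (fun l b => b.var .p = k + (v :: l.filter fun u => σ v < σ u).length ∧
      Seg (b.arr .up) k (v :: l.filter fun u => σ v < σ u) ∧
      (∀ j < k, b.arr .up j = a.arr .up j) ∧
      Counts b (fun w => if w = v ∨ w ∈ l then insert v (A w) else A w)) ?_ ?_ ?_ ?_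
  · rintro l b b' hb hv ⟨k1, k2, k3, k4⟩
    exact ⟨by rw [hv _ (by simp) (by simp) (by simp), k1], by rw [hb]; exact k2, by rw [hb]; exact k3,
      k4.congr (by rw [hb]) (by rw [hb])⟩
  · refine ⟨?_, ?_, ?_, ?_⟩
    · rw [hc.var _ (by simp), hbp]; simp
    · rw [hc.arr _ (by simp)]; simpa using hbs
    · rw [hc.arr _ (by simp)]; simpa using hbu
    · convert hcA using 1
      ext1 w
      by_cases hw : w = v
      · subst hw; simp
      · simp [hw]
  · rintro l₁ z l₂ hl e m he ⟨k1, k2, k3, k4⟩ hz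
    have hzn := z.2
    have hzv : z ≠ v := by
      rintro rfl
      have : z ∈ L.list z := by rw [hl]; simp
      rw [L.mem_iff] at this
      exact this.ne rfl
    have hzl : z ∉ l₁ := fun hc => by
      have := L.nodup v
      rw [hl, List.nodup_append] at this
      exact this.2.2 _ hc _ (by simp) rfl
    have hev : e.var .v = v := by rw [he.var _ (by simp), hfr'.var _ (by simp), hv]
    rw [Layout.vc]
    refine isOp_incr hF v .u e _ z _ (by simp)
      (by rw [he.var _ (by simp), hfr'.var _ (by simp), hI.var_n]) hev hz k4
      (by simp [hzv, hzl, hvA]) fun f hf hfA => ?_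
    have hfv : f.var .v = v := by rw [hf.var _ (by simp), hev]
    have hfz : f.var .u = z := by rw [hf.var _ (by simp), hz]
    have hfpos : ∀ w : Fin n, f.arr .pos w = σ w := fun w => by
      rw [hf.arr _ (by simp), he.arr _ (by simp), hfr'.arr _ (by simp), hpos]
    have hcnt : Counts f (fun w => if w = v ∨ w ∈ l₁ ++ [z] then insert v (A w) else A w) := by
      convert hfA using 1
      ext1 w
      by_cases hw : w = z
      · subst hw; simp [hzv, hzl]
      · simp [hw]
    simp only [Layout.vc, Cond.ok, Expr.ok, Cond.holds, Expr.eval, hfv, hfz, hfpos, true_and]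
    refine ⟨by omega, fun hlt => ?_, fun hlt => ?_⟩
    · have hlt' : σ v < σ z := hlt
      refine vc_append (k := k) (l := v :: l₁.filter fun u => σ v < σ u) (z := z) ?_ ?_
        (by simp [hfz]) ?_ fun g hg hgp hgs hgu => ?_
      · rw [Ast.tick_var, hf.var _ (by simp), k1]
      · rw [Ast.tick_arr, hf.arr _ (by simp)]; exact k2
      · have h3 : (l₁.filter fun u => σ v < σ u).length ≤ l₁.length := List.length_filter_le _ _
        have h4 : (L.list v).length = l₁.length + (l₂.length + 1) := by rw [hl]; simp
        rw [List.length_cons]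
        omega
      · refine ⟨⟨fun y hy => ?_, fun r hr => ?_, ?_, ?_, ?_⟩, ?_, ?_, ?_, ?_⟩
        · simp only [List.mem_cons, List.not_mem_nil, or_false, not_or] at hy
          rw [hg.var y (by simp [hy]), Ast.tick_var, hf.var y (by simp [hy])]
        · simp only [List.mem_cons, List.not_mem_nil, or_false, not_or] at hr
          rw [hg.arr r (by simp [hr]), Ast.tick_arr, hf.arr r (by simp [hr])]
        · rw [hg.current, Ast.tick_current, hf.current]
        · rw [hg.reported, Ast.tick_reported, hf.reported]
        · have h3 := hg.time
          have h4 := hf.time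
          simp at h3
          omega
        · rw [hgp]; simp [List.filter_append, hlt']
        · simpa [List.filter_append, hlt'] using hgs
        · intro j hj
          rw [hgu j hj, Ast.tick_arr, hf.arr _ (by simp), k3 j hj]
        · exact hcnt.congr (hg.arr _ (by simp)) (hg.arr _ (by simp))
    · have hlt' : ¬ σ v < σ z := hlt
      refine ⟨⟨fun y hy => ?_, fun r hr => ?_, hf.current, hf.reported, ?_⟩, ?_, ?_, ?_, ?_⟩
      · simp only [List.mem_cons, List.not_mem_nil, or_false, not_or] at hy
        exact hf.var y (by simp [hy])
      · simp only [List.mem_cons, List.not_mem_nil, or_false, not_or] at hr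
        exact hf.arr r (by simp [hr])
      · have h4 := hf.time
        simp
        omega
      · rw [Ast.tick_var, Ast.tick_var, hf.var _ (by simp), k1]; simp [List.filter_append, hlt']
      · rw [Ast.tick_arr, Ast.tick_arr, hf.arr _ (by simp)]
        simpa [List.filter_append, hlt'] using k2
      · rw [Ast.tick_arr, Ast.tick_arr, hf.arr _ (by simp)]; exact k3
      · exact hcnt.congr rfl rfl
  · rintro g hg ⟨k1, k2, k3, k4⟩
    refine hQ g ((hfr'.trans hg (by simp) (by simp)).mono (by omega)) k1 k2 k3 ?_ k4
    rw [hg.arr _ (by simp), hc.arr _ (by simp), hbups]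

end Preprocess

section Preprocess

variable {Λ : Layout} {n : ℕ} {a : Ast} {Q : Ast → Prop} {G : SimpleGraph (Fin n)}
  {L : AdjLists G}

theorem vc_link (hF : Λ.Fits n) (hI : Input Λ L a) {q : List (Fin n)} (hnd : q.Nodup)
    (hq : q.length = n)
    (hord : ∀ i (h : i < q.length), a.arr .ord i = q[i])
    (hQ : ∀ b, Frame [.i, .p, .v] [.nxt] (50 * n + 15) a b →
      Path (b.arr .nxt) n (q.filter fun v => L.list v ≠ []).reverse → Q b) :
    Λ.vc link Q a := by
  have h1 := hF.lt_len .nxt (by simp)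
  have h2 := hF.lt_len .ord (by simp)
  have hW := hF.lt_W
  have hlt := hI.lt
  simp only [link, Layout.vc, Expr.ok, Expr.eval, Expr.cost, Nat.zero_le, true_and]
  -- The list is built from its end, so no array cell points to its head yet. The invariant
  -- therefore speaks of every pointer function that agrees with `nxt` on the treated vertices and
  -- every place `s` where it has the value `p`.
  refine Layout.wp_whl_index (j := 0) (m := n)
    (fun j b => Frame [.i, .p, .v] [.nxt] (50 * j + 5) a b ∧ b.var .i = j ∧ b.var .p ≤ n ∧
      ∀ (nx : ℕ → ℕ) (s : ℕ), (∀ v ∈ q.take j, nx v = b.arr .nxt v) → nx s = b.var .p →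
        Path nx s ((q.take j).filter fun v => L.list v ≠ []).reverse) (Nat.zero_le _) ?_ ?_ ?_
  · refine ⟨⟨fun x hx => ?_, fun _ _ => rfl, rfl, rfl, by simp⟩, by simp, by simp [hI.var_n], ?_⟩
    · simp only [List.mem_cons, List.not_mem_nil, or_false, not_or] at hx
      simp [hx]
    · intro nx s _ hs
      simpa [Path, hI.var_n] using hs
  · rintro j - hj b ⟨hb, hi, hpn, hpath⟩
    have hjq : j < q.length := by omega
    have hbn : b.var .n = n := by rw [hb.var _ (by simp), hI.var_n]
    have hbo : b.arr .ord j = q[j] := by rw [hb.arr _ (by simp), hord j hjq]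
    have hvn := (q[j]).2
    have htake : q.take (j + 1) = q.take j ++ [q[j]] := List.take_succ_eq_append_getElem hjq
    have hfr := hb.time
    simp only [Cond.ok, Cond.holds, Expr.ok, Expr.eval, Layout.vc, Ast.tick_var, Ast.tick_arr, hi,
      hbn, hbo, Ast.set_var, Ast.set_arr, Ast.put_var, reduceCtorEq, if_true, if_false, true_and,
      hb.arr .inp (by simp), hI.lo, hI.hi]
    refine ⟨hj, by omega, ⟨⟨⟨by norm_num, by omega⟩, by omega⟩, ⟨by norm_num, by omega⟩, by omega⟩,
      fun hne => ⟨by omega, ⟨by norm_num, by omega⟩, ⟨fun x hx => ?_, fun r hr => ?_, hb.current,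
        hb.reported, ?_⟩, ?_, ?_⟩, fun hne => ⟨⟨by norm_num, by omega⟩, ⟨fun x hx => ?_,
        fun r hr => ?_, hb.current, hb.reported, ?_⟩, ?_, ?_⟩⟩
    · have := hb.var x hx
      simp only [List.mem_cons, List.not_mem_nil, or_false, not_or] at hx
      simp [hx, this]
    · have := hb.arr r hr
      simp only [List.mem_cons, List.not_mem_nil, or_false] at hr
      simp [hr, this]
    · simp
      omega
    · omega
    · intro nx s hnx hs
      have hL : L.list q[j] ≠ [] := by
        rintro h
        simp [h] at hne
      rw [htake, List.filter_append]
      simp only [hL, decide_true, List.filter_cons, List.filter_nil, ne_eq, not_false_eq_true, if_true,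
        List.reverse_append, List.reverse_cons, List.reverse_nil, List.nil_append, List.cons_append]
      refine ⟨hs, hpath nx _ (fun v hv => ?_) ?_⟩
      · have hvj : v ≠ q[j] := by
          rintro rfl
          rw [List.mem_take_iff_getElem] at hv
          obtain ⟨i, hi, he⟩ := hv
          have := (List.Nodup.getElem_inj_iff hnd).1 he
          omega
        rw [hnx v (by rw [htake]; exact List.mem_append_left _ hv)]
        simp [Function.update_of_ne (fun h => hvj (Fin.ext h))]
      · rw [hnx _ (by rw [htake]; exact List.mem_append_right _ (List.mem_singleton_self _))]
        simp
    · have := hb.var x hx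
      simp only [List.mem_cons, List.not_mem_nil, or_false, not_or] at hx
      simp [hx, this]
    · simpa using hb.arr r hr
    · simp
      omega
    · exact hpn
    · have hL : L.list q[j] = [] := by
        rw [← List.length_eq_zero_iff]
        omega
      intro nx s hnx hs
      have := hpath nx s (fun v hv => hnx v (by rw [htake]; exact List.mem_append_left _ hv)) hs
      rw [htake, List.filter_append]
      simpa [hL] using this
  · rintro b ⟨hb, hi, hpn, hpath⟩
    have hbn : b.var .n = n := by rw [hb.var _ (by simp), hI.var_n]
    simp only [Cond.ok, Cond.holds, Expr.ok, Expr.eval, Ast.tick_var, hi, hbn]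
    refine ⟨by simp, by simp, h1, hQ _ ⟨fun x hx => by simp [hb.var x hx],
      fun r hr => ?_, hb.current, hb.reported, ?_⟩ ?_⟩
    · have := hb.arr r hr
      simp only [List.mem_cons, List.not_mem_nil, or_false] at hr
      simp [hr, this]
    · have := hb.time
      simp
      omega
    · have := hpath (Function.update (b.arr .nxt) n (b.var .p)) n
        (fun v _ => by rw [Function.update_of_ne v.2.ne]) (by simp)
      rw [List.take_of_length_le hq.le] at this
      simpa using this

variable [DecidableRel G.Adj]

theorem vc_build (hF : Λ.Fits n) (hI : Input Λ L a) {σ : Equiv.Perm (Fin n)}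
    (hpos : ∀ v : Fin n, a.arr .pos v = σ v) (hA : Counts a fun _ : Fin n => ∅)
    (hup : ∑ v, ((L.list v).length + 1) ≤ Λ.len .up)
    (hQ : ∀ b, Frame [.v, .i, .h, .u, .p, .t] [.ups, .up, .cnt, .sum]
        (120 * (∑ v, ((L.list v).length + 1)) + 15) a b →
      Static Λ (upList L σ) b → Counts b (closedNbhd G) → Q b) :
    Λ.vc build Q a := by
  have h1 := hF.lt_len .ups (by simp)
  have hW := hF.lt_W
  simp only [build, Layout.vc, Expr.ok, Expr.eval, Expr.cost, Nat.zero_le, true_and]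
  refine Layout.wp_whl_index (j := 0) (m := n)
    (fun j b => Frame [.v, .i, .h, .u, .p, .t] [.ups, .up, .cnt, .sum]
        (120 * psum (fun v => (L.list v).length + 1) j + 4) a b ∧ b.var .v = j ∧
      b.var .p = psum (fun v => (upList L σ v).length) j ∧
      (∀ v : Fin n, (v : ℕ) < j → b.arr .ups v = psum (fun v => (upList L σ v).length) v ∧
        Seg (b.arr .up) (psum (fun v => (upList L σ v).length) v) (upList L σ v)) ∧
      Counts b fun w => (closedNbhd G w).filter fun v => (v : ℕ) < j) (Nat.zero_le _) ?_ ?_ ?_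
  · refine ⟨⟨fun x hx => ?_, fun _ _ => rfl, rfl, rfl, by simp [psum_zero]⟩, by simp, by simp [psum_zero],
      by simp, Counts.congr (a := a) (by simpa using hA) rfl rfl⟩
    simp only [List.mem_cons, List.not_mem_nil, or_false, not_or] at hx
    simp [hx]
  · rintro j - hj b ⟨hb, hv, hp, hups, hbA⟩
    obtain ⟨v, rfl⟩ : ∃ v : Fin n, (v : ℕ) = j := ⟨⟨j, hj⟩, rfl⟩
    have hbn : b.var .n = n := by rw [hb.var _ (by simp), hI.var_n]
    simp only [Cond.ok, Cond.holds, Expr.ok, Expr.eval, Layout.vc, hv, hbn]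
    refine ⟨by simp, hj, vc_collect (L := L) (σ := σ) (v := v)
      (k := psum (fun v => (upList L σ v).length) v) hF
      (hI.congr (hb.var _ (by simp)) (hb.arr _ (by simp))) ?_ hv hp ?_ (hbA.congr rfl rfl)
      (by simp) ?_⟩
    · intro w
      rw [Ast.tick_arr, hb.arr _ (by simp), hpos]
    · have h2 : psum (fun v => (upList L σ v).length) v ≤ psum (fun v => (L.list v).length + 1) v :=
        Finset.sum_le_sum fun w _ => length_upList_le L σ w
      have h3 := psum_succ (fun v => (L.list v).length + 1) v
      have h4 := psum_mono (fun v => (L.list v).length + 1) (Nat.succ_le_of_lt hj)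
      rw [psum_self] at h4
      simp only [Nat.succ_eq_add_one] at h4
      omega
    · intro c hc hcp hcs hcu hcups hcA
      have hcv : c.var .v = v := by rw [hc.var _ (by simp)]; simp [hv]
      rw [hcv]
      refine ⟨⟨trivial, by norm_num, by omega⟩, ⟨fun x hx => ?_, fun r hr => ?_, ?_, ?_, ?_⟩,
        by simp, ?_, ?_, ?_⟩
      · have := hb.var x hx
        simp only [List.mem_cons, List.not_mem_nil, or_false, not_or] at hx
        rw [Ast.set_var, if_neg hx.1, hc.var x (by simp [hx]), Ast.tick_var, this]
      · rw [Ast.set_arr, hc.arr r hr, Ast.tick_arr, hb.arr r hr]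
      · rw [Ast.set_current, hc.current, Ast.tick_current, hb.current]
      · rw [Ast.set_reported, hc.reported, Ast.tick_reported, hb.reported]
      · have h2 := hb.time
        have h3 := hc.time
        rw [psum_succ]
        simp at h3 ⊢
        omega
      · rw [psum_succ]
        simpa using hcp
      · intro w hw
        rcases Nat.lt_succ_iff_lt_or_eq.1 hw with hw' | hw'
        · obtain ⟨k1, k2⟩ := hups w hw'
          rw [Ast.set_arr, hcups, Function.update_of_ne hw'.ne, Ast.tick_arr]
          refine ⟨k1, fun i hi => ?_⟩
          have h2 := psum_mono (fun v => (upList L σ v).length) (Nat.succ_le_of_lt hw')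
          rw [Nat.succ_eq_add_one, psum_succ] at h2
          rw [hcu _ (by omega)]
          exact k2 i hi
        · obtain rfl : w = v := Fin.ext hw'
          rw [Ast.set_arr, hcups]
          exact ⟨by simp, hcs⟩
      · refine Counts.congr (a := c) ?_ rfl rfl
        convert hcA using 1
        ext1 w
        ext x
        simp only [Finset.mem_filter, L.mem_iff, closedNbhd, Finset.mem_insert,
          SimpleGraph.mem_neighborFinset]
        split_ifs with hw
        · simp only [Finset.mem_insert, Finset.mem_filter, SimpleGraph.mem_neighborFinset]
          constructor
          · rintro ⟨k1, k2⟩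
            rcases Nat.lt_succ_iff_lt_or_eq.1 k2 with k2 | k2
            · exact Or.inr ⟨k1, k2⟩
            · exact Or.inl (Fin.ext k2)
          · rintro (rfl | ⟨k1, k2⟩)
            · exact ⟨hw.imp Eq.symm SimpleGraph.Adj.symm, Nat.lt_succ_self _⟩
            · exact ⟨k1, by omega⟩
        · simp only [Finset.mem_insert, Finset.mem_filter, SimpleGraph.mem_neighborFinset]
          refine and_congr_right fun k1 => ?_
          have : (x : ℕ) ≠ v := fun h => by
            obtain rfl := Fin.ext h
            exact hw (k1.imp Eq.symm SimpleGraph.Adj.symm)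
          omega
  · rintro b ⟨hb, hv, hp, hups, hbA⟩
    have hbn : b.var .n = n := by rw [hb.var _ (by simp), hI.var_n]
    simp only [Cond.ok, Cond.holds, Expr.ok, Expr.eval, Ast.tick_var, hv, hbn, hp]
    refine ⟨by simp, by simp, h1, hQ _ ⟨fun x hx => ?_, fun r hr => ?_,
      hb.current, hb.reported, ?_⟩ ⟨by simp [hbn], fun v => ?_, fun v => ?_, fun v => ?_⟩
      (Counts.congr (a := b) ?_ (by simp) (by simp))⟩
    · simpa using hb.var x hx
    · have := hb.arr r hr
      simp only [List.mem_cons, List.not_mem_nil, or_false, not_or] at hr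
      simp [hr, this]
    · have := hb.time
      rw [psum_self] at this
      simp
      omega
    · have hvn := v.2
      -- The list of the last vertex ends at the address in the extra entry `n`, written after the
      -- loop.
      have hlast : Function.update (b.arr .ups) n (psum (fun v => (upList L σ v).length) n) (v + 1) =
          psum (fun v => (upList L σ v).length) (v + 1) := by
        by_cases h : (v : ℕ) + 1 = n
        · rw [h]; simp
        · rw [Function.update_of_ne h]
          exact (hups ⟨v + 1, by omega⟩ (by simp; omega)).1
      simp only [Ast.put_arr, if_true, Ast.tick_arr]
      rw [hlast, Function.update_of_ne hvn.ne, (hups v hvn).1, psum_succ]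
    · have hvn := v.2
      have h2 := psum_mono (fun v => (upList L σ v).length) (Nat.succ_le_of_lt hvn)
      rw [Nat.succ_eq_add_one, psum_succ, psum_self] at h2
      simp only [Ast.put_arr, if_true, Ast.tick_arr]
      rw [Function.update_of_ne hvn.ne, (hups v hvn).1]
      exact h2.trans ((Finset.sum_le_sum fun w _ => length_upList_le L σ w).trans hup)
    · have hvn := v.2
      simp only [Ast.put_arr, if_true, Ast.tick_arr, reduceCtorEq, if_false]
      rw [Function.update_of_ne hvn.ne, (hups v hvn).1]
      exact (hups v hvn).2
    · simpa using hbA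

end Preprocess

section Preprocess

variable {Λ : Layout} {n : ℕ} {a : Ast} {Q : Ast → Prop} {G : SimpleGraph (Fin n)}
  {L : AdjLists G} [DecidableRel G.Adj]

theorem queue_eq_map {σ : Equiv.Perm (Fin n)} {q : List (Fin n)} (hq : q.length = n)
    (h : ∀ i (hi : i < q.length), (σ q[i] : ℕ) = i) : q = (List.finRange n).map σ.symm := by
  refine List.ext_getElem (by simp [hq]) fun i h1 h2 => ?_
  rw [List.getElem_map, Equiv.eq_symm_apply]
  exact Fin.ext (by simp [h i h1])

theorem exists_numbering {q : List (Fin n)} (hq : q.length = n) (hnd : q.Nodup) :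
    ∃ σ : Equiv.Perm (Fin n), ∀ i (hi : i < q.length), (σ q[i] : ℕ) = i := by
  have hinj : Function.Injective fun i : Fin n => q[i] := fun i j hij =>
    Fin.ext ((List.Nodup.getElem_inj_iff hnd).1 hij)
  refine ⟨(Equiv.ofBijective _ (Finite.injective_iff_bijective.1 hinj)).symm, fun i hi => ?_⟩
  have : (Equiv.ofBijective _ (Finite.injective_iff_bijective.1 hinj)) ⟨i, by omega⟩ = q[i] := rfl
  rw [← this, Equiv.symm_apply_apply]

/-- The larger neighbours of `q[i]` are not among the first `i` members of `q`, so they are counted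
by `left`. -/
theorem isDegeneracyOrdering_of_left_le {σ : Equiv.Perm (Fin n)} {q : List (Fin n)}
    (hq : q.length = n) (h : ∀ i (hi : i < q.length), (σ q[i] : ℕ) = i) {k : ℕ}
    (hk : ∀ i (hi : i < q.length), left G (q.take i) q[i] ≤ k) : IsDegeneracyOrdering G σ k := by
  intro v
  have hv : (σ v : ℕ) < q.length := by rw [hq]; exact (σ v).2
  have hqv : q[(σ v : ℕ)] = v := σ.injective (Fin.ext (h _ hv))
  refine le_trans ?_ (hk _ hv)
  rw [hqv]
  refine Finset.card_le_card fun u hu => ?_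
  simp only [above, Finset.mem_filter] at hu
  rw [Finset.mem_sdiff, List.mem_toFinset, List.mem_take_iff_getElem]
  refine ⟨hu.1, ?_⟩
  rintro ⟨i, hi, rfl⟩
  have h1 := h i (by omega)
  have h2 := Fin.lt_def.1 hu.2
  omega

theorem vc_preprocess (hF : Λ.Fits n) (hI : Input Λ L a) (hcur : a.current = ∅)
    (hzero : ∀ r i, r ≠ .inp → a.arr r i = 0) (hup : ∑ v, ((L.list v).length + 1) ≤ Λ.len .up)
    (hQ : ∀ b (σ : Equiv.Perm (Fin n)), (∀ k, IsDegenerate G k → IsDegeneracyOrdering G σ k) →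
      (∀ v : Fin n, b.arr .pos v = (σ v : ℕ)) →
      Node Λ G (upList L σ) (rootCall G) (closedNbhd G) b →
      Path (b.arr .nxt) n (descending σ (rootCall G).C) → b.reported = a.reported →
      b.time ≤ a.time + 333 * (∑ v, ((L.list v).length + 1)) + 60 → Q b) :
    Λ.vc preprocess Q a := by
  have hn : n ≤ ∑ v, ((L.list v).length + 1) := by
    rw [Finset.sum_add_distrib]; simp
  rw [preprocess, Layout.vc]
  refine vc_setup hF hI hcur fun b hbI hdeg hlst hlen hd htail hhead hbcur hbrep hbarr hbt => ?_
  rw [Layout.vc]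
  refine wp_peel (L := L) hF (d := 0) (q := []) (la := List.finRange n) (T := b.time)
    ⟨hbI, ⟨htail, by simp, fun i h => by simp at h, fun i h => by simp at h⟩, hhead, by simp, hd, ?_,
      fun i h => by simp at h⟩ (by simp) (by simpa using hlen) (List.nodup_finRange n) hlst
    (by simp) (by simp) (by simp) ?_
  · intro u
    rw [hdeg, List.take_nil, left_nil]
  intro c q hq hcq hopt hcarr hcn hccur hcrep hct
  have hcI : Input Λ L c := hbI.congr hcn (hcarr _ (by simp) (by simp) (by simp) (by simp))
  obtain ⟨σ, hσ⟩ := exists_numbering hq hcq.nodup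
  have hqmap := queue_eq_map hq hσ
  have hpos : ∀ v : Fin n, c.arr .pos v = (σ v : ℕ) := fun v => by
    have hv : (σ v : ℕ) < q.length := by rw [hq]; exact (σ v).2
    have hqv : q[(σ v : ℕ)] = v := σ.injective (Fin.ext (hσ _ hv))
    have := hcq.pos _ hv
    rwa [hqv] at this
  -- Memory not yet written is zero; this already represents empty counted sets and cleared marks.
  have hczero : ∀ r, r ≠ .inp → r ≠ .deg → r ≠ .lst → r ≠ .ord → r ≠ .pos → ∀ i, c.arr r i = 0 :=
    fun r h1 h2 h3 h4 h5 i => by rw [hcarr r h2 h3 h4 h5, hbarr r h2 h3, hzero r i h1]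
  rw [Layout.vc]
  refine vc_build hF hcI hpos ⟨fun w => ?_, fun w => ?_⟩ hup fun e he heS heA => ?_
  · rw [hczero _ (by simp) (by simp) (by simp) (by simp) (by simp)]; simp
  · rw [hczero _ (by simp) (by simp) (by simp) (by simp) (by simp)]; simp
  refine vc_link hF (hcI.congr (he.var _ (by simp)) (he.arr _ (by simp))) hcq.nodup hq
    (fun i hi => by rw [he.arr _ (by simp)]; exact hcq.ord i hi) fun f hf hpath => ?_
  refine hQ f σ (fun k hk => isDegeneracyOrdering_of_left_le hq hσ fun i hi => hopt i hi k hk) ?_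
    ⟨heS.congr (hf.var _ (by simp)) (hf.arr _ (by simp)) (hf.arr _ (by simp)),
      heA.congr (hf.arr _ (by simp)) (hf.arr _ (by simp)), fun o => ?_, ⟨?_, ?_⟩, ?_⟩ ?_ ?_ ?_
  · intro v
    rw [hf.arr _ (by simp), he.arr _ (by simp), hpos]
  · rw [hf.arr _ (by simp), he.arr _ (by simp),
      hczero _ (by simp) (by simp) (by simp) (by simp) (by simp)]
  · intro w
    exact Finset.inter_subset_left
  · intro w _
    simp [rootCall]
  · rw [hf.current, he.current, hccur, hbcur]
    exact (toNatSet_univ n).symm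
  · convert hpath using 1
    rw [descending, List.map_reverse, ← hqmap, List.filter_reverse]
    congr 1
    refine List.filter_congr fun v _ => ?_
    have hL : L.list v ≠ [] ↔ ∃ u, u ∈ L.list v :=
      ⟨List.exists_mem_of_ne_nil _, fun ⟨_, hu⟩ => List.ne_nil_of_mem hu⟩
    rw [decide_eq_decide, hL]
    simp only [rootCall, Finset.mem_filter, Finset.mem_univ, true_and, Finset.Nonempty,
      SimpleGraph.mem_neighborFinset, L.mem_iff]
  · rw [hf.reported, he.reported, hcrep, hbrep]
  · have h1 := he.time
    have h2 := hf.time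
    omega

end Preprocess

/-! ### Reading the input and placing the arrays -/

section Input

variable {n : ℕ} {G : SimpleGraph (Fin n)} (L : AdjLists G)

theorem offset_eq {i : ℕ} (hi : i ≤ n) :
    L.offset i = n + 2 + psum (fun v => (L.list v).length) i := by
  induction i with
  | zero => simp [AdjLists.offset, psum_zero]
  | succ i ih =>
    have h1 : i < (List.ofFn L.list).length := by simp; omega
    have h2 := psum_succ (fun v => (L.list v).length) ⟨i, hi⟩
    have h3 := ih (by omega)
    rw [AdjLists.offset, List.take_succ_eq_append_getElem h1, List.map_append, List.sum_append]
    rw [AdjLists.offset] at h3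
    simp only [List.map_cons, List.map_nil, List.sum_singleton, List.getElem_ofFn]
    simp only at h2
    omega

theorem offset_succ (v : Fin n) : L.offset (v + 1) = L.offset v + (L.list v).length := by
  rw [offset_eq L v.2, offset_eq L v.2.le, psum_succ]
  omega

theorem offset_self : L.offset n = n + 2 + ∑ v, (L.list v).length := by
  rw [offset_eq L le_rfl, psum_self]

theorem offset_mono {i j : ℕ} (h : i ≤ j) (hj : j ≤ n) : L.offset i ≤ L.offset j := by
  rw [offset_eq L hj, offset_eq L (h.trans hj)]
  exact Nat.add_le_add_left (psum_mono _ h) _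

theorem length_encode : L.encode.length = L.offset n := by
  rw [offset_self]
  simp [AdjLists.encode, List.length_flatten, List.sum_ofFn]
  omega

theorem encode_zero : L.encode.getD 0 0 = n := by simp [AdjLists.encode]

theorem encode_succ {i : ℕ} (hi : i ≤ n) : L.encode.getD (i + 1) 0 = L.offset i := by
  have h : i < n + 1 := by omega
  rw [AdjLists.encode, List.getD_cons_succ, List.getD_eq_getElem?_getD,
    List.getElem?_append_left (by simpa using h)]
  simp [h]

theorem getElem?_flatten {α : Type*} (ls : List (List α)) (i : ℕ) (hi : i < ls.length) (j : ℕ)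
    (hj : j < ls[i].length) :
    ls.flatten[((ls.take i).map List.length).sum + j]? = some (ls[i][j]) := by
  have h : ls = ls.take i ++ ls[i] :: ls.drop (i + 1) := by simp
  have h' : ls.flatten = (ls.take i).flatten ++ (ls[i] ++ (ls.drop (i + 1)).flatten) := by
    conv_lhs => rw [h, List.flatten_append, List.flatten_cons]
  rw [h', ← List.length_flatten, List.getElem?_append_right (by omega), Nat.add_sub_cancel_left,
    List.getElem?_append_left hj, List.getElem?_eq_getElem hj]

theorem encode_offset (v : Fin n) : Seg (fun i => L.encode.getD i 0) (L.offset v) (L.list v) := by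
  intro j hj
  have h1 := getElem?_flatten (List.ofFn L.list) v (by simp) j (by simpa using hj)
  have h2 : L.offset v + j = (((List.ofFn L.list).take v).map List.length).sum + j + (n + 1) + 1 := by
    rw [AdjLists.offset]; omega
  simp only [h2, AdjLists.encode, List.getD_cons_succ]
  rw [List.getD_eq_getElem?_getD, List.getElem?_append_right (by simp)]
  simp only [List.length_map, List.length_range, Nat.add_sub_cancel, List.getElem?_map, h1]
  simp

theorem sum_length [DecidableRel G.Adj] : ∑ v, (L.list v).length = 2 * G.edgeFinset.card := by
  rw [← G.sum_degrees_eq_twice_card_edges]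
  refine Finset.sum_congr rfl fun v _ => ?_
  rw [← left_nil, left]
  simp

/-- Put consecutive arrays of the same length at the given registers. -/
def allot : List ℕ → Cmd
  | [] => .skip
  | x :: l => .seq (.copy x tmp) (.seq (.plus tmp tmp (tmp + 1)) (allot l))

theorem exec_allot {W : ℕ} (l : List ℕ) : ∀ s : State, l.Nodup → (∀ x ∈ l, x < tmp) →
    s.reg tmp + l.length * s.reg (tmp + 1) < W → ∃ s', Exec W (allot l) s (2 * l.length + 1) s' ∧
      (∀ i (h : i < l.length), s'.reg l[i] = s.reg tmp + i * s.reg (tmp + 1)) ∧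
      (∀ x, x ∉ l → x ≠ tmp → s'.reg x = s.reg x) ∧ s'.mem = s.mem ∧ s'.current = s.current ∧
      s'.reported = s.reported := by
  induction l with
  | nil => exact fun s _ _ _ => ⟨s, .skip s, fun i h => by simp at h, by simp, rfl, rfl, rfl⟩
  | cons x l ih =>
    intro s hnd hlt hW
    have hx := hlt x (by simp)
    rw [List.nodup_cons] at hnd
    rw [List.length_cons, add_mul, one_mul] at hW
    set s₁ := s.setReg x (s.reg tmp) with hs₁
    have h1 : s₁.reg tmp = s.reg tmp := by
      simp [s₁, State.setReg, Function.update_of_ne hx.ne']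
    have h2 : s₁.reg (tmp + 1) = s.reg (tmp + 1) := by
      simp [s₁, State.setReg, Function.update_of_ne (show tmp + 1 ≠ x by omega)]
    set s₂ := s₁.setReg tmp (s₁.reg tmp + s₁.reg (tmp + 1)) with hs₂
    have h3 : s₂.reg tmp = s.reg tmp + s.reg (tmp + 1) := by
      simp [s₂, State.setReg, h1, h2]
    have h4 : s₂.reg (tmp + 1) = s.reg (tmp + 1) := by
      simp [s₂, State.setReg, h2]
    obtain ⟨s', k1, k2, k3, k4, k5, k6⟩ := ih s₂ hnd.2 (fun y hy => hlt y (by simp [hy]))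
      (by rw [h3, h4]; omega)
    refine ⟨s', ?_, ?_, ?_, k4, k5, k6⟩
    · have := Exec.seq (Exec.copy (W := W) s x tmp) (Exec.seq (Exec.plus s₁ tmp tmp (tmp + 1)
        (by rw [h1, h2]; omega)) k1)
      rwa [show 2 * (x :: l).length + 1 = 1 + (1 + (2 * l.length + 1)) by
        rw [List.length_cons]; ring]
    · intro i hi
      cases i with
      | zero =>
        rw [List.getElem_cons_zero, k3 x hnd.1 hx.ne]
        simp [s₂, s₁, State.setReg, Function.update_of_ne hx.ne]
      | succ i =>
        rw [List.getElem_cons_succ, k2, h3, h4]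
        ring
    · intro y hy hyt
      rw [List.mem_cons, not_or] at hy
      rw [k3 y hy.2 hyt]
      simp [s₂, s₁, State.setReg, Function.update_of_ne hyt, Function.update_of_ne hy.1]

/-- Determine the places of the arrays. -/
def place : Cmd :=
  .seq (.load Var.n.reg Var.n.reg) (.seq (.const (tmp + 1) 1)
    (.seq (.plus (tmp + 1) (tmp + 1) Var.n.reg) (.seq (.load tmp (tmp + 1))
      (.seq (.copy Arr.up.reg tmp) (.seq (.plus tmp tmp tmp)
        (allot [0, 2, 4, 5, 6, 7, 8, 9, 10, 11, 12]))))))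

/-- The rank of an array among those of the same length. -/
def Arr.slot : Arr → ℕ
  | pos => 0 | inp => 0 | ups => 1 | up => 0 | nxt => 2 | pr => 3 | und => 4 | cnt => 5
  | sum => 6 | mark => 7 | deg => 8 | lst => 9 | ord => 10

/-- The arrays `inp` and `up` of length `E`, and the other arrays of length `n + 1`. -/
def arrayLen (n E : ℕ) : Arr → ℕ
  | .inp => E
  | .up => E
  | _ => n + 1

def arrayBase (n E : ℕ) : Arr → ℕ
  | .inp => 0
  | .up => E
  | r => 2 * E + r.slot * (n + 1)

theorem array_disj (n E : ℕ) (r r' : Arr) (i i' : ℕ) (h : i < arrayLen n E r)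
    (h' : i' < arrayLen n E r') (he : arrayBase n E r + i = arrayBase n E r' + i') : r = r' := by
  cases r <;> cases r' <;> simp only [arrayLen, arrayBase, Arr.slot] at h h' he <;>
    first | rfl | (exfalso; omega)

/-- The placement of the arrays in a memory of `W` words. -/
def layout (n E W : ℕ) (h2 : 2 < W) (hW : 2 * E + 11 * (n + 1) < W) : Layout where
  W := W
  base := arrayBase n E
  len := arrayLen n E
  two_lt := h2
  base_add_len_lt r := by
    cases r <;> simp only [arrayLen, arrayBase, Arr.slot] <;> omega
  disj := array_disj n E

end Input

/-! ### Running times of the complete programs -/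

section Main

variable {n : ℕ} {G : SimpleGraph (Fin n)} (L : AdjLists G)

/-- The input word at address `n + 1` is the end address of the lists, hence the length `E` of the
input. All base addresses are computed from `E` and `n + 1` by additions. -/
theorem exec_place {W : ℕ} (hW : 2 * L.offset n + 11 * (n + 1) < W) : ∃ t s,
    Exec W place L.init t s ∧ t ≤ 30 ∧ (∀ r : Arr, s.reg r.reg = arrayBase n (L.offset n) r) ∧
      s.reg Var.n.reg = n ∧ s.mem = L.init.mem ∧ s.current = ∅ ∧ s.reported = [] := by
  have h0 : L.init.mem 0 = n := encode_zero L
  have h1 : L.init.mem (1 + n) = L.offset n := by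
    rw [add_comm]; exact encode_succ L le_rfl
  set E := L.offset n
  set s₁ := L.init.setReg Var.n.reg n with hs₁
  set s₂ := s₁.setReg (tmp + 1) 1 with hs₂
  set s₃ := s₂.setReg (tmp + 1) (1 + n) with hs₃
  set s₄ := s₃.setReg tmp E with hs₄
  set s₅ := s₄.setReg Arr.up.reg E with hs₅
  set s₆ := s₅.setReg tmp (E + E) with hs₆
  have e₁ : Exec W (.load Var.n.reg Var.n.reg) L.init 1 s₁ := by
    have := Exec.load (W := W) L.init Var.n.reg Var.n.reg (by simp [AdjLists.init]; omega)
    rwa [show L.init.mem (L.init.reg Var.n.reg) = n from h0] at this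
  have e₂ : Exec W (.const (tmp + 1) 1) s₁ 1 s₂ := Exec.const _ _ _ (by omega)
  have e₃ : Exec W (.plus (tmp + 1) (tmp + 1) Var.n.reg) s₂ 1 s₃ :=
    Exec.plus (W := W) s₂ (tmp + 1) (tmp + 1) Var.n.reg (by
      show 1 + n < W
      omega)
  have e₄ : Exec W (.load tmp (tmp + 1)) s₃ 1 s₄ := by
    have := Exec.load (W := W) s₃ tmp (tmp + 1) (by
      show 1 + n < W
      omega)
    rwa [show s₃.mem (s₃.reg (tmp + 1)) = E from h1] at this
  have e₅ : Exec W (.copy Arr.up.reg tmp) s₄ 1 s₅ := Exec.copy _ _ _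
  have e₆ : Exec W (.plus tmp tmp tmp) s₅ 1 s₆ :=
    Exec.plus (W := W) s₅ tmp tmp tmp (by
      show E + E < W
      omega)
  have k1 : s₆.reg tmp = E + E := rfl
  have k2 : s₆.reg (tmp + 1) = 1 + n := rfl
  obtain ⟨s₇, e₇, l1, l2, l3, l4, l5⟩ := exec_allot (W := W) [0, 2, 4, 5, 6, 7, 8, 9, 10, 11, 12] s₆
    (by decide) (by decide) (by rw [k1, k2]; simp only [List.length_cons, List.length_nil]; omega)
  refine ⟨_, s₇, .seq e₁ (.seq e₂ (.seq e₃ (.seq e₄ (.seq e₅ (.seq e₆ e₇))))), by simp, fun r => ?_,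
    ?_, l3, l4, l5⟩
  · rw [k1, k2] at l1
    cases r
    case inp => rw [Arr.reg, l2 1 (by decide) (by decide)]; rfl
    case up => rw [Arr.reg, l2 3 (by decide) (by decide)]; rfl
    case pos => have := l1 0 (by decide); simp [Arr.reg, arrayBase, Arr.slot] at this ⊢; omega
    case ups => have := l1 1 (by decide); simp [Arr.reg, arrayBase, Arr.slot] at this ⊢; omega
    case nxt => have := l1 2 (by decide); simp [Arr.reg, arrayBase, Arr.slot] at this ⊢; omega
    case pr => have := l1 3 (by decide); simp [Arr.reg, arrayBase, Arr.slot] at this ⊢; omega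
    case und => have := l1 4 (by decide); simp [Arr.reg, arrayBase, Arr.slot] at this ⊢; omega
    case cnt => have := l1 5 (by decide); simp [Arr.reg, arrayBase, Arr.slot] at this ⊢; omega
    case sum => have := l1 6 (by decide); simp [Arr.reg, arrayBase, Arr.slot] at this ⊢; omega
    case mark => have := l1 7 (by decide); simp [Arr.reg, arrayBase, Arr.slot] at this ⊢; omega
    case deg => have := l1 8 (by decide); simp [Arr.reg, arrayBase, Arr.slot] at this ⊢; omega
    case lst => have := l1 9 (by decide); simp [Arr.reg, arrayBase, Arr.slot] at this ⊢; omega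
    case ord => have := l1 10 (by decide); simp [Arr.reg, arrayBase, Arr.slot] at this ⊢; omega
  · rw [l2 _ (by decide) (by decide)]; rfl

variable [DecidableRel G.Adj]

theorem exists_isDegenerate : ∃ k, IsDegenerate G k :=
  ⟨n, fun _ ⟨v, hv⟩ => ⟨v, hv, by simpa using Finset.card_le_univ (G.neighborFinset v ∩ _)⟩⟩

/-- Each edge is counted at its smaller end, which has at most `k` larger neighbours. -/
theorem card_edgeFinset_le {σ : Equiv.Perm (Fin n)} {k : ℕ} (hk : IsDegeneracyOrdering G σ k) :
    G.edgeFinset.card ≤ k * n := by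
  have h1 : ∀ v, G.degree v = (∑ u, if G.Adj v u ∧ σ v < σ u then 1 else 0) +
      ∑ u, if G.Adj u v ∧ σ u < σ v then 1 else 0 := fun v => by
    have hf : G.neighborFinset v = Finset.univ.filter fun u => G.Adj v u := by ext; simp
    rw [← Finset.sum_add_distrib, ← SimpleGraph.card_neighborFinset_eq_degree, hf,
      Finset.card_filter]
    refine Finset.sum_congr rfl fun u _ => ?_
    by_cases h : G.Adj v u
    · rcases lt_trichotomy (σ v) (σ u) with hlt | he | hlt
      · simp [h, h.symm, hlt, hlt.not_gt]
      · exact absurd (σ.injective he) h.ne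
      · simp [h, h.symm, hlt, hlt.not_gt]
    · simp [h, mt SimpleGraph.Adj.symm h]
  have h2 : ∑ v, (∑ u, if G.Adj v u ∧ σ v < σ u then 1 else 0) ≤ k * n := by
    refine (Finset.sum_le_card_nsmul _ _ k fun v _ => ?_).trans (by simp [mul_comm])
    refine le_of_eq_of_le ?_ (hk v)
    rw [Finset.sum_boole, Nat.cast_id]
    congr 1
    ext u
    simp [above]
  have h3 := G.sum_degrees_eq_twice_card_edges
  rw [Finset.sum_congr rfl fun v _ => h1 v, Finset.sum_add_distrib,
    Finset.sum_comm (f := fun v u => if G.Adj u v ∧ σ u < σ v then 1 else 0)] at h3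
  omega

/-- Without isolated vertices each of the `n` sets `V \ {v}` is dominating. -/
theorem le_card_dominatingSets (h : ∀ v, ∃ u, G.Adj v u) : n ≤ (dominatingSets G).card := by
  calc n = (Finset.univ : Finset (Fin n)).card := by simp
    _ ≤ _ := Finset.card_le_card_of_injOn (fun v => Finset.univ.erase v) (fun v _ => ?_)
      fun v _ w _ hvw => ?_
  · simp only [dominatingSets, Finset.coe_filter, Finset.mem_univ, true_and, Set.mem_ofPred_eq]
    intro w
    by_cases hw : w = v
    · obtain ⟨u, hu⟩ := h w
      exact Or.inr ⟨u, by simp [← hw, hu.ne'], hu.symm⟩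
    · exact Or.inl (by simp [hw])
  · by_contra hne
    have : v ∈ (Finset.univ : Finset (Fin n)).erase w := by simp [hne]
    rw [← show (Finset.univ : Finset (Fin n)).erase v = Finset.univ.erase w from hvw] at this
    simp at this

/-- The preprocessing and the enumeration, with their running times. -/
theorem exec_preprocess_enumerate {W : ℕ} (hW : 2 * L.offset n + 11 * (n + 1) < W) :
    ∃ σ : Equiv.Perm (Fin n), (∀ k, IsDegenerate G k → IsDegeneracyOrdering G σ k) ∧
      ∃ t₁ t₂ s₁ s₂, Exec W (.seq place preprocess.compile) L.init t₁ s₁ ∧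
        Exec W enumerate.compile s₁ t₂ s₂ ∧
        t₁ ≤ 333 * (∑ v, ((L.list v).length + 1)) + 90 ∧ s₁.reported = [] ∧
        (∀ v : Fin n, s₁.mem (s₁.reg 0 + v) = σ v) ∧
        s₂.reported = (edsd G σ).map (fun s => toNatSet s.X) ∧
        ∀ k, IsDegenerate G k → t₂ ≤ 1480 * (k * (dominatingSets G).card) + 20 := by
  classical
  have hE := offset_self L
  obtain ⟨t₀, s₀, e₀, ht₀, hbase, hvn, hmem, hcur, hrep⟩ := exec_place L hW
  let Λ := layout n (L.offset n) W (by omega) hW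
  have hF : Λ.Fits n := by
    refine ⟨fun r hr => ?_, show 3 * n + 3 < W by omega⟩
    cases r <;> simp only [Λ, layout, arrayLen] <;> omega
  let a : Ast :=
    { var := fun x => s₀.reg x.reg
      arr := fun r i => if r = .inp then L.encode.getD i 0 else 0
      current := ∅
      reported := []
      time := 0 }
  have hR : Λ.Repr a s₀ := by
    refine ⟨hbase, fun _ => rfl, fun r i hi => ?_, hcur, hrep⟩
    rw [hmem]
    -- All arrays other than `inp` lie behind the input, where the memory is zero.
    have hnil : r ≠ .inp → L.encode.getD (arrayBase n (L.offset n) r + i) 0 = 0 := fun hr => by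
      refine List.getD_eq_default _ _ ?_
      rw [length_encode]
      cases r <;> simp only [arrayBase] <;> first | omega | exact absurd rfl hr
    by_cases hr : r = .inp
    · subst hr
      simp [a, AdjLists.init, Λ, layout, arrayBase]
    · rw [show a.arr r i = 0 from if_neg hr]
      exact hnil hr
  have hI : Input Λ L a := by
    refine ⟨hvn, fun v => encode_succ L v.2.le, fun v => ?_, encode_offset L, fun v => ?_, ?_⟩
    · rw [← offset_succ]
      exact encode_succ L v.2
    · rw [← offset_succ]
      exact offset_mono L v.2 le_rfl
    · show n + 1 < L.offset n
      omega
  have hup : ∑ v, ((L.list v).length + 1) ≤ Λ.len .up := by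
    rw [Finset.sum_add_distrib]
    show _ ≤ L.offset n
    simp only [Finset.sum_const, Finset.card_univ, Fintype.card_fin, smul_eq_mul, mul_one]
    omega
  have hpre : Λ.vc preprocess (fun b => ∃ σ : Equiv.Perm (Fin n),
      (∀ k, IsDegenerate G k → IsDegeneracyOrdering G σ k) ∧
      (∀ v : Fin n, b.arr .pos v = (σ v : ℕ)) ∧
      Node Λ G (upList L σ) (rootCall G) (closedNbhd G) b ∧
      Path (b.arr .nxt) n (descending σ (rootCall G).C) ∧ b.reported = [] ∧
      b.time ≤ 333 * (∑ v, ((L.list v).length + 1)) + 60) a := by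
    refine vc_preprocess hF hI rfl (fun r i hr => by simp [a, hr]) hup
      fun b σ h1 h2 h3 h4 h5 h6 => ⟨σ, h1, h2, h3, h4, h5, ?_⟩
    simpa [a] using h6
  obtain ⟨t₁, s₁, b, e₁, hR₁, hb, σ, hσ, hpos, hN, hpath, hbrep, hbt⟩ :=
    Layout.wp_of_vc hpre s₀ hR
  -- The programs do not know `k`, which enters only into the analysis. The run is bounded with the
  -- least `k₀`; as the bound is monotone, it holds for every admissible `k`.
  obtain ⟨k₀, hk₀, hmin⟩ : ∃ k₀, IsDegenerate G k₀ ∧ ∀ k, IsDegenerate G k → k₀ ≤ k :=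
    ⟨Nat.find exists_isDegenerate, Nat.find_spec exists_isDegenerate,
      fun k hk => Nat.find_min' exists_isDegenerate hk⟩
  have hU := upLists_upList L σ
  have hen : Λ.vc enumerate (fun c => c.reported = (edsd G σ).map (fun s => toNatSet s.X) ∧
      c.time ≤ b.time + treeCost G σ (k₀ + 1) (rootCall G) + 20) b :=
    vc_enumerate hF hU (hU.length_le (hσ k₀ hk₀)) hN hpath fun c hc hct =>
      ⟨by rw [hc, hbrep, List.nil_append], hct⟩
  obtain ⟨t₂, s₂, c, e₂, hR₂, hc, hcrep, hct⟩ := Layout.wp_of_vc hen s₁ hR₁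
  refine ⟨σ, hσ, t₀ + t₁, t₂, s₁, s₂, .seq e₀ e₁, e₂, ?_, hR₁.reported.trans hbrep, fun v => ?_,
    hR₂.reported.trans hcrep, fun k hk => ?_⟩
  · simp only [a] at hb
    omega
  · rw [show s₁.reg 0 = Λ.base .pos from hR₁.base .pos,
      hR₁.mem .pos v (v.2.trans (hF.lt_len .pos (by simp))), hpos]
  · have h1 := treeCost_rootCall_le hU (hσ k₀ hk₀)
    have h2 := Nat.mul_le_mul_right (dominatingSets G).card (hmin k hk)
    omega

end Main

end DomEnum

theorem mainTheorem1 :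
    -- EDS-D lists every dominating set exactly once, for every numbering of the vertices,
    -- and its sets `C` and `D` are the candidate sets and the dominated lists
    (∀ (n : ℕ) (G : SimpleGraph (Fin n)) [DecidableRel G.Adj] (σ : Equiv.Perm (Fin n)),
      ((DomEnum.edsd G σ).map DomEnum.Call.X).Nodup ∧
      (∀ X : Finset (Fin n),
        X ∈ (DomEnum.edsd G σ).map DomEnum.Call.X ↔ DomEnum.IsDominating G X) ∧
      (∀ s ∈ DomEnum.edsd G σ,
        s.C = DomEnum.cand G σ s.X ∧ ∀ u, s.D u = DomEnum.domList G σ s.X u)) ∧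
    -- implementation: preprocessing and enumeration, in linear space
    (∃ (prep enum : DomEnum.Cmd) (c : ℕ),
      ∀ (n : ℕ) (G : SimpleGraph (Fin n)) [DecidableRel G.Adj] (L : DomEnum.AdjLists G),
      ∃ σ : Equiv.Perm (Fin n),
        (∀ k, DomEnum.IsDegenerate G k → DomEnum.IsDegeneracyOrdering G σ k) ∧
        ∃ (t₁ t₂ : ℕ) (s₁ s₂ : DomEnum.State),
          DomEnum.Exec (c * (n + G.edgeFinset.card + 1)) prep L.init t₁ s₁ ∧
          DomEnum.Exec (c * (n + G.edgeFinset.card + 1)) enum s₁ t₂ s₂ ∧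
          -- the preprocessing computes the degeneracy ordering in linear time
          t₁ ≤ c * (n + G.edgeFinset.card + 1) ∧
          s₁.reported = [] ∧
          (∀ v : Fin n, s₁.mem (s₁.reg 0 + v) = σ v) ∧
          -- the enumeration outputs exactly what EDS-D outputs, in the same order
          s₂.reported = (DomEnum.edsd G σ).map (fun s => DomEnum.toNatSet s.X) ∧
          ∀ k, DomEnum.IsDegenerate G k →
            t₂ ≤ c * (k * (DomEnum.dominatingSets G).card + 1) ∧
            (0 < n → (∀ v, ∃ u, G.Adj v u) →
              t₁ + t₂ ≤ c * (k * (DomEnum.dominatingSets G).card))) ∧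
    -- optimality: no program needs fewer steps than there are dominating sets
    (∀ (n : ℕ) (G : SimpleGraph (Fin n)) [DecidableRel G.Adj] (L : DomEnum.AdjLists G)
      (W t : ℕ) (p : DomEnum.Cmd) (s : DomEnum.State),
      DomEnum.Exec W p L.init t s →
      (∀ X : Finset (Fin n), DomEnum.IsDominating G X → DomEnum.toNatSet X ∈ s.reported) →
      (DomEnum.dominatingSets G).card ≤ t) := by
  refine ⟨fun n G _ σ => ⟨DomEnum.allChildren_nodup DomEnum.rootCall_valid,
    fun X => DomEnum.mem_edsd_iff, fun s hs => ?_⟩, ?_,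
    fun n G _ L W t p s h hs => DomEnum.card_dominatingSets_le_time h hs⟩
  · have := DomEnum.valid_of_mem_allChildren DomEnum.rootCall_valid s hs
    exact ⟨this.C_eq, this.D_eq⟩
  -- The constant is generous: the arrays take `13n + 4m + 15` words, the preprocessing at most
  -- `666m + 333n + 90` steps, and in the last claim both programs together at most `2589 kN` steps.
  · refine ⟨.seq DomEnum.place DomEnum.preprocess.compile, DomEnum.enumerate.compile, 5000,
      fun n G _ L => ?_⟩
    have hE := DomEnum.offset_self L
    have hm := DomEnum.sum_length L
    have hm1 : ∑ v, ((L.list v).length + 1) = 2 * G.edgeFinset.card + n := by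
      rw [Finset.sum_add_distrib, hm]; simp
    obtain ⟨σ, hσ, t₁, t₂, s₁, s₂, e₁, e₂, ht₁, h1, h2, h3, ht₂⟩ :=
      DomEnum.exec_preprocess_enumerate L (W := 5000 * (n + G.edgeFinset.card + 1)) (by omega)
    rw [hm1] at ht₁
    refine ⟨σ, hσ, t₁, t₂, s₁, s₂, e₁, e₂, by omega, h1, h2, h3, fun k hk => ⟨?_, fun hn hG => ?_⟩⟩
    · have := ht₂ k hk
      omega
    -- Here `m ≤ kn ≤ kN`, and `1 ≤ n ≤ N ≤ kN`, so `kN` absorbs the linear time of the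
    -- preprocessing and the additive constants.
    · have h4 := DomEnum.card_edgeFinset_le (hσ k hk)
      have h5 := DomEnum.le_card_dominatingSets hG
      have hk1 : 1 ≤ k := by
        by_contra hk0
        obtain rfl : k = 0 := by omega
        obtain ⟨v, -, hv⟩ := hk Finset.univ ⟨⟨0, hn⟩, Finset.mem_univ _⟩
        obtain ⟨u, hu⟩ := hG v
        rw [Nat.le_zero, Finset.card_eq_zero, Finset.inter_univ] at hv
        have : u ∈ G.neighborFinset v := by simpa using hu
        simp [hv] at this
      have h6 := Nat.mul_le_mul_left k h5
      have h7 := Nat.mul_le_mul_right (DomEnum.dominatingSets G).card hk1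
      have h8 := ht₂ k hk
      omega
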